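/- Connecting Lemma. A $k$-graph is a finite $k$-uniform hypergraph $F=(V(F),E(F))$, with $v(F)=|V(F)|$, $e(F)=|E(F)|$; $\log$ is the logarithm to base two; an $r$-tuple consists of $r$ distinct vertices and is treated as a set where convenient. For a $k$-graph $F$ with $e(F)>0$ and $X\subsetneq V(F)$ containing no edge of $F$, let $$m(F,X)=\max\left\{\frac{e(F')}{v(F')-\max\{1,|V(F')\cap X|\}}\;:\;F'\subseteq F,\ e(F')>0,\ X\subseteq V(F')\text{ or }X\cap V(F')=\emptyset\right\}.$$ For $r$-tuples $\mathbf x$ in $V(F)$ and $\mathbf y$ in $V(G)$, a subgraph $F'\subseteq G$ is an $(F,\mathbf x,\mathbf y)$-copy if there is an isomorphism $f\colon F\to F'$ with $f(\mathbf x)=\mathbf y$; the vertices in $V(F')\setminus\mathbf y$ are its internal vertices. For a family $\mathcal Y=\{\mathbf y_i\}_{i\in[t]}$ of $r$-tuples in $V(G)$, an $(F,\mathbf x,\mathcal Y)$-matching in $G$ is a family $\{F_i\subseteq G\}_{i\in[t]}$ of pairwise vertex-disjoint subgraphs such that $F_i$ is an $(F,\mathbf x,\mathbf y_i)$-copy for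 every $i$. Let $k\ge2$ and $r\ge0$ be integers and $K>0$ a real number. There exist $C>1$, $n_0,A\in\mathbb N$ and a deterministic random access machine program $M$ (unit cost per addition, subtraction, memory access, assignment and test), all depending only on $k,r,K$, such that the following holds for every $n\ge n_0$. Let $F$ be a $k$-graph with $v(F)\ge r+2$ vertices ($F$ may depend on $n$), let $\mathbf x\in V(F)^r$ be an $r$-tuple of distinct vertices such that no edge of $F$ is contained in $\mathbf x$, let $W\subseteq[n]$ be a set of size $|W|\ge C\,v(F)^4\log^2 n$, and let $p\in[0,1]$. If $F$ has at least one edge, assume moreover that $$p\ge\left(\frac{C\,v(F)^4\log^2 n}{|W|}\right)^{1/m(F,\mathbf x)}.$$ Then with probability at least $1-n^{-K}$ the random $k$-graph $G\sim\mathcal G^{(k)}(n,p)$ has the following property. For every $t\in\mathbb N$ with $t(v(F)-r)\le|W|/4$ and every family $\mathcal Y=\{\mathbf y_i\in([n]\setminus W)^r\}_{i\in[t]}$ of pairwise disjoint $r$-tuples of distinct vertices, there exists an $(F,\mathbf x,\mathcal Y)$-matching in $G$ all of whose internal vertices lie in $W$; moreover, on input $(G,F,\mathbf x,W,\mathcal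 Y)$ the program $M$ finds such a matching in at most $n^{A\,v(F)}$ steps. -/

import Mathlib

open Set

namespace ConnectingLemma

/-! ### Hypergraphs -/

/-- Every edge of `H` has exactly `k` vertices, i.e. `H` is a `k`-graph. -/
def IsUniform {α : Type*} (k : ℕ) (H : Hypergraph α) : Prop :=
  ∀ e ∈ H.edgeSet, e.ncard = k

/-- `H` is a (not necessarily induced) subgraph of `G`. -/
def IsSubgraph {α : Type*} (H G : Hypergraph α) : Prop :=
  H.vertexSet ⊆ G.vertexSet ∧ H.edgeSet ⊆ G.edgeSet

/-- `f` restricts to an isomorphism from `F` to `H`. -/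
def IsIso {α β : Type*} (F : Hypergraph α) (H : Hypergraph β) (f : α → β) : Prop :=
  BijOn f F.vertexSet H.vertexSet ∧
    ∀ e, e ⊆ F.vertexSet → (f '' e ∈ H.edgeSet ↔ e ∈ F.edgeSet)

/-- `H` is an `(F, x, y)`-copy: some isomorphism from `F` to `H` maps the tuple `x` to `y`. -/
def IsCopy {α β : Type*} {r : ℕ} (F : Hypergraph α) (x : Fin r → α) (y : Fin r → β)
    (H : Hypergraph β) : Prop :=
  ∃ f : α → β, IsIso F H f ∧ ∀ j, f (x j) = y j

/-- The family `H` of subgraphs of `G` is an `(F, x, y)`-matching for the family `y` of tuples. -/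
def IsMatching {α β : Type*} {r t : ℕ} (G : Hypergraph β) (F : Hypergraph α) (x : Fin r → α)
    (y : Fin t → Fin r → β) (H : Fin t → Hypergraph β) : Prop :=
  (∀ i, IsSubgraph (H i) G ∧ IsCopy F x (y i) (H i)) ∧
    ∀ i j, i ≠ j → Disjoint (H i).vertexSet (H j).vertexSet

/-- All internal vertices of the copies `H i` rooted at `y i` lie in `W`. -/
def InternalIn {β : Type*} {r t : ℕ} (y : Fin t → Fin r → β) (H : Fin t → Hypergraph β)
    (W : Set β) : Prop :=
  ∀ i, (H i).vertexSet \ range (y i) ⊆ W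

/-- The density `m(F, X)`: the maximum of `e(F') / (v(F') - max {1, |V(F') ∩ X|})` over all
subgraphs `F'` of `F` with at least one edge whose vertex set contains `X` or avoids `X`.
(On a finite hypergraph this is the supremum of a finite set.) -/
noncomputable def density {α : Type*} (F : Hypergraph α) (X : Set α) : ℝ :=
  sSup {d : ℝ | ∃ F' : Hypergraph α, IsSubgraph F' F ∧ F'.edgeSet.Nonempty ∧
    (X ⊆ F'.vertexSet ∨ X ∩ F'.vertexSet = ∅) ∧
    d = (F'.edgeSet.ncard : ℝ) /
      ((F'.vertexSet.ncard : ℝ) - max 1 ((F'.vertexSet ∩ X).ncard : ℝ))}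

/-! ### The binomial random `k`-graph -/

/-- The hypergraph on the vertex set `{0, …, n-1}` with edge set `E`. -/
def ofEdges {n : ℕ} (E : Set (Set (Fin n))) : Hypergraph (Fin n) where
  vertexSet := univ
  edgeSet := E
  subset_vertexSet_of_mem_edgeSet' := fun _ _ => subset_univ _

/-- The law of the edge set of `G^{(k)}(n, p)`: every `k`-element subset of the `n` vertices is
an edge with probability `p`, independently of all the others. -/
noncomputable def edgeLaw (k n : ℕ) (p : unitInterval) :
    MeasureTheory.Measure (Set (Set (Fin n))) :=
  ProbabilityTheory.setBernoulli {e : Set (Fin n) | e.ncard = k} p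

/-! ### Random access machine programs with a step count

A program works on a memory that consists of arrays of natural numbers; the name of an array is a
constant of the program, the position inside it is computed. Every elementary operation (constant,
memory access, addition, truncated subtraction, assignment, test) costs one step. There is no
multiplication, so each step lengthens the largest number in play by at most a constant number of
bits, and the model is polynomially equivalent to Turing machines. -/

/-- The contents of the memory: array name, position, value. -/
abbrev Store : Type := ℕ → ℕ → ℕ

/-- Expressions. -/
inductive Expr : Type
  | lit (c : ℕ)
  | get (a : ℕ) (i : Expr)
  | add (e₁ e₂ : Expr)
  | sub (e₁ e₂ : Expr)

/-- The value of an expression. -/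
def Expr.eval (s : Store) : Expr → ℕ
  | .lit c => c
  | .get a i => s a (i.eval s)
  | .add e₁ e₂ => e₁.eval s + e₂.eval s
  | .sub e₁ e₂ => e₁.eval s - e₂.eval s

/-- The number of elementary operations in an expression. -/
def Expr.cost : Expr → ℕ
  | .lit _ => 1
  | .get _ i => i.cost + 1
  | .add e₁ e₂ => e₁.cost + e₂.cost + 1
  | .sub e₁ e₂ => e₁.cost + e₂.cost + 1

/-- Programs. `assign a i e` writes the value of `e` to position `i` of the array `a`;
`ite e P Q` and `loop e P` (a while loop) test whether the value of `e` is nonzero. -/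
inductive Prog : Type
  | skip
  | assign (a : ℕ) (i e : Expr)
  | seq (P Q : Prog)
  | ite (e : Expr) (P Q : Prog)
  | loop (e : Expr) (P : Prog)

/-- The memory after writing the value `c` to position `q` of the array `a`. -/
def write (s : Store) (a q c : ℕ) : Store :=
  Function.update s a (Function.update (s a) q c)

/-- `Runs P s m s'`: started in the memory `s`, the program `P` halts after exactly `m` steps in
the memory `s'`. -/
inductive Runs : Prog → Store → ℕ → Store → Prop
  | skip (s : Store) : Runs .skip s 1 s
  | assign (a : ℕ) (i e : Expr) (s : Store) :
      Runs (.assign a i e) s (i.cost + e.cost + 1) (write s a (i.eval s) (e.eval s))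
  | seq {P Q : Prog} {s s' s'' : Store} {m m' : ℕ} :
      Runs P s m s' → Runs Q s' m' s'' → Runs (.seq P Q) s (m + m') s''
  | ite_true {e : Expr} {P Q : Prog} {s s' : Store} {m : ℕ} :
      e.eval s ≠ 0 → Runs P s m s' → Runs (.ite e P Q) s (e.cost + 1 + m) s'
  | ite_false {e : Expr} {P Q : Prog} {s s' : Store} {m : ℕ} :
      e.eval s = 0 → Runs Q s m s' → Runs (.ite e P Q) s (e.cost + 1 + m) s'
  | loop_true {e : Expr} {P : Prog} {s s' s'' : Store} {m m' : ℕ} :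
      e.eval s ≠ 0 → Runs P s m s' → Runs (.loop e P) s' m' s'' →
        Runs (.loop e P) s (e.cost + 1 + m + m') s''
  | loop_false {e : Expr} {P : Prog} {s : Store} :
      e.eval s = 0 → Runs (.loop e P) s (e.cost + 1) s

/-! ### Input and output of the algorithm -/

/-- The array that holds the finite list `g`, followed by zeros. -/
def table {m : ℕ} (g : Fin m → ℕ) (q : ℕ) : ℕ :=
  if h : q < m then g ⟨q, h⟩ else 0

open Classical in
/-- The adjacency array of a `k`-graph on `{0, …, n-1}`: for all vertices `a₀, …, a_{k-1}`, the
entry at position `a₀ + a₁ n + ⋯ + a_{k-1} n^{k-1}` is `1` if `{a₀, …, a_{k-1}}` is an edge, and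
`0` otherwise. -/
noncomputable def adjTable (k : ℕ) {n : ℕ} (H : Hypergraph (Fin n)) : ℕ → ℕ :=
  table fun q : Fin (n ^ k) =>
    if range (finFunctionFinEquiv.symm q : Fin k → Fin n) ∈ H.edgeSet then 1 else 0

open Classical in
/-- The initial memory. Array `0` holds `n`, `v` and `t`, array `1` the indicator of `W`, array `2`
the tuple `x`, array `3` the tuples `y 0, y 1, …` one after the other, and arrays `4` and `5` the
adjacency arrays of `F` and of `G`. All other cells are zero. -/
noncomputable def input (k : ℕ) {n v r t : ℕ} (G : Hypergraph (Fin n)) (F : Hypergraph (Fin v))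
    (x : Fin r → Fin v) (W : Finset (Fin n)) (y : Fin t → Fin r → Fin n) : Store
  | 0 => table ![n, v, t]
  | 1 => table fun a : Fin n => if a ∈ W then 1 else 0
  | 2 => table fun j : Fin r => (x j : ℕ)
  | 3 => table fun q : Fin (t * r) =>
      (y (finProdFinEquiv.symm q).1 (finProdFinEquiv.symm q).2 : ℕ)
  | 4 => adjTable k F
  | 5 => adjTable k G
  | _ => fun _ => 0

/-- Array `6` of the memory `s` describes the family `H` of `(F, x, y i)`-copies: its block number
`i` of length `v` lists the values of an isomorphism from `F` to `H i` that maps `x` to `y i`. -/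
def Describes {n v r t : ℕ} (s : Store) (F : Hypergraph (Fin v)) (x : Fin r → Fin v)
    (y : Fin t → Fin r → Fin n) (H : Fin t → Hypergraph (Fin n)) : Prop :=
  ∀ i : Fin t, ∃ f : Fin v → Fin n, IsIso F (H i) f ∧ (∀ j, f (x j) = y i j) ∧
    ∀ j : Fin v, s 6 ((i : ℕ) * v + (j : ℕ)) = (f j : ℕ)

end ConnectingLemma

open ConnectingLemma

/-! The set `W` is split into `L = 4 * Nat.size n + 8` pieces of at least `⌊|W| / L⌋` vertices, and
a greedy algorithm runs for `L` rounds. Round `j` uses only piece `j`: each root tuple that is still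
unmatched receives a copy of `F` with internal vertices in the unused part of the piece, if there is
one. The only random input is the event `Good`, which covers all families of roots simultaneously:
if at most half of a piece is deleted, as a set listed by `s * v` entries, then among any `s`
disjoint roots one still has a copy in the remainder.

`Good` is likely (`le_prob_good`). For fixed roots and deletions, `avoid_copies_le` applies the
extended Janson inequality `janson` to all rooted copies. Let two copies share an edge and `h`
internal vertices, and let `m` be the density. They share at most `m h` edges if they have the same
root, and at most `m (h - 1)` if their roots differ (`overlap_bound`). The hypothesis on `p` says `p
^ m ≥ 1 / ρ` with `ρ = |W| / (C v ^ 4 log² n)`, so the shared edges cost a factor `ρ ^ h` or `ρ ^ (h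
- 1)`. This is outweighed by the scarcity of pairs with many common vertices (`sum_hits_le`). The
resulting exponent is of order `s w / (v ^ 3 ρ)`, where `w` is the size of the piece. It exceeds `(2
v + K + 3) s log n` and so beats the `n ^ (2 v s)` choices of roots and deletions.

`Good` suffices (`reach_complete`). When a round ends, no unmatched root has a copy in the free part
of the piece. If at most half of the piece is used, `Good` then forces at least half of the roots
unmatched at the start to have been served (`InRound.halves`). Since `t (v - r) ≤ |W| / 4`, at most
three quarters of the rounds can use more than half of their piece. The others number at least
`Nat.size n`, and that many halvings leave no root (`rounds_suffice`).

The program finds copies by trying all `n ^ v` maps. A Hoare logic (`Comp`) bounds its time by `size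
* Z ^ depth` if no loop runs more than `Z` times; here `Z = n ^ (v + k)`, while size and depth
depend only on `k` and `r`. The relation `Reach` links the two halves: the combinatorics holds for
every greedy run, and the program performs one of them. -/

namespace ConnectingLemma

/-! ### Product weights on the subsets of a finite type -/

section Weights

variable {ι : Type*} [Fintype ι] [DecidableEq ι]

/-- The probability that a random subset, which contains each `i` independently with probability
`q i`, equals `R`. -/
def wt (q : ι → ℝ) (R : Finset ι) : ℝ := ∏ i, if i ∈ R then q i else 1 - q i

/-- The expectation of `f` with respect to the weights `wt q`. -/
def ex (q : ι → ℝ) (f : Finset ι → ℝ) : ℝ := ∑ R, wt q R * f R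

variable {q : ι → ℝ}

lemma wt_nonneg (h0 : ∀ i, 0 ≤ q i) (h1 : ∀ i, q i ≤ 1) (R : Finset ι) : 0 ≤ wt q R := by
  refine Finset.prod_nonneg fun i _ => ?_
  split_ifs
  · exact h0 i
  · linarith [h1 i]

lemma ex_mono (h0 : ∀ i, 0 ≤ q i) (h1 : ∀ i, q i ≤ 1) {f g : Finset ι → ℝ}
    (h : ∀ R, f R ≤ g R) : ex q f ≤ ex q g :=
  Finset.sum_le_sum fun R _ => mul_le_mul_of_nonneg_left (h R) (wt_nonneg h0 h1 R)

lemma ex_nonneg (h0 : ∀ i, 0 ≤ q i) (h1 : ∀ i, q i ≤ 1) {f : Finset ι → ℝ}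
    (h : ∀ R, 0 ≤ f R) : 0 ≤ ex q f :=
  Finset.sum_nonneg fun R _ => mul_nonneg (wt_nonneg h0 h1 R) (h R)

lemma ex_sub (f g : Finset ι → ℝ) : ex q (fun R => f R - g R) = ex q f - ex q g := by
  simp [ex, mul_sub, Finset.sum_sub_distrib]

lemma ex_const_mul (c : ℝ) (f : Finset ι → ℝ) : ex q (fun R => c * f R) = c * ex q f := by
  simp only [ex, Finset.mul_sum]
  exact Finset.sum_congr rfl fun _ _ => by ring

lemma ex_sum {κ : Type*} (s : Finset κ) (f : κ → Finset ι → ℝ) :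
    ex q (fun R => ∑ j ∈ s, f j R) = ∑ j ∈ s, ex q (f j) := by
  simp only [ex, Finset.mul_sum]
  exact Finset.sum_comm

lemma ex_one : ex q (fun _ => 1) = 1 := by
  have := Finset.prod_add q (fun i => 1 - q i) Finset.univ
  simp only [add_sub_cancel, Finset.prod_const_one, Finset.powerset_univ] at this
  refine Eq.trans (Finset.sum_congr rfl fun R _ => ?_) this.symm
  rw [mul_one, wt, ← Finset.prod_sdiff (Finset.subset_univ R), mul_comm]
  congr 1
  · exact Finset.prod_congr rfl fun i hi => by simp [hi]
  · exact Finset.prod_congr rfl fun i hi => by simp [(Finset.mem_sdiff.1 hi).2]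

/-- Pair each `R` missing `i` with `insert i R`: `g` agrees on the two sets, and their weights are
in the ratio `1 - q i` to `q i`. -/
lemma ex_mem (i : ι) (g : Finset ι → ℝ) (hg : ∀ R, g (R.erase i) = g R) :
    ex q (fun R => if i ∈ R then g R else 0) = q i * ex q g := by
  have hu : (Finset.univ : Finset (Finset ι)) =
      (insert i (Finset.univ.erase i) : Finset ι).powerset := by
    rw [Finset.insert_erase (Finset.mem_univ i), Finset.powerset_univ]
  have hi : i ∉ (Finset.univ.erase i : Finset ι) := Finset.notMem_erase _ _
  simp only [ex]
  rw [hu, Finset.sum_powerset_insert hi, Finset.sum_powerset_insert hi, mul_add, Finset.mul_sum,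
    Finset.mul_sum, ← Finset.sum_add_distrib, ← Finset.sum_add_distrib]
  refine Finset.sum_congr rfl fun R hR => ?_
  have hiR : i ∉ R := fun h => hi (Finset.mem_powerset.1 hR h)
  have hg' : g (insert i R) = g R := by
    rw [← hg (insert i R), Finset.erase_insert hiR]
  have w1 : wt q R = (1 - q i) * ∏ j ∈ Finset.univ.erase i, if j ∈ R then q j else 1 - q j := by
    rw [wt, ← Finset.mul_prod_erase _ _ (Finset.mem_univ i)]; simp [hiR]
  have w2 : wt q (insert i R) = q i * ∏ j ∈ Finset.univ.erase i, if j ∈ R then q j else 1 - q j := by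
    rw [wt, ← Finset.mul_prod_erase _ _ (Finset.mem_univ i)]
    congr 1
    · simp
    · refine Finset.prod_congr rfl fun j hj => ?_
      simp [Finset.ne_of_mem_erase hj]
  rw [if_neg hiR, if_pos (Finset.mem_insert_self _ _), hg', w1, w2]
  ring

/-- Independence of the event `S ⊆ R` from a function that ignores the coordinates in `S`; the
coordinates are split off one at a time. -/
lemma ex_subset (S : Finset ι) (g : Finset ι → ℝ) (hg : ∀ R, g (R \ S) = g R) :
    ex q (fun R => if S ⊆ R then g R else 0) = (∏ i ∈ S, q i) * ex q g := by
  induction S using Finset.induction_on with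
  | empty => simp
  | insert i S hi ih =>
    have hS : ∀ R, g (R \ S) = g R := fun R => by
      rw [← hg (R \ S), ← hg R]
      congr 1
      ext; simp; tauto
    have hE : ∀ R, g (R.erase i) = g R := fun R => by
      rw [← hg (R.erase i), ← hg R]
      congr 1
      ext; simp; tauto
    rw [Finset.prod_insert hi, mul_assoc, ← ih hS, ← ex_mem]
    · congr 1
      ext R
      simp only [Finset.insert_subset_iff]
      split_ifs <;> tauto
    · intro R
      have : S ⊆ R.erase i ↔ S ⊆ R := by
        rw [Finset.subset_erase]; tauto
      simp only [this, hE]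

lemma ex_subset_one (S : Finset ι) :
    ex q (fun R => if S ⊆ R then 1 else 0) = ∏ i ∈ S, q i := by
  rw [ex_subset S (fun _ => 1) fun _ => rfl, ex_one, mul_one]

/-- **Harris' inequality** for an increasing and a decreasing function. -/
lemma ex_mul_le (h0 : ∀ i, 0 ≤ q i) (h1 : ∀ i, q i ≤ 1) {f g : Finset ι → ℝ}
    (hf0 : ∀ R, 0 ≤ f R) (hf : Monotone f) (hg1 : ∀ R, g R ≤ 1) (hg : Antitone g) :
    ex q (fun R => f R * g R) ≤ ex q f * ex q g := by
  -- FKG needs two increasing functions, hence the complement `1 - g`. For product weights the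
  -- lattice condition is an equality.
  have key := fkg (μ := wt q) (f := f) (g := fun R => 1 - g R) (fun R => wt_nonneg h0 h1 R) hf0
    (fun R => sub_nonneg.2 (hg1 R)) hf (fun a b h => sub_le_sub_left (hg h) 1) (fun a b => by
      simp only [wt, ← Finset.prod_mul_distrib]
      refine le_of_eq (Finset.prod_congr rfl fun i _ => ?_)
      by_cases ha : i ∈ a <;> by_cases hb : i ∈ b <;> simp [ha, hb, mul_comm])
  have e0 : ∑ R, wt q R = 1 := by simpa [ex] using ex_one (q := q)
  have e1 : ex q (fun R => 1 - g R) = 1 - ex q g := by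
    rw [ex_sub (fun _ => 1) g, ex_one]
  have e2 : ex q (fun R => f R * (1 - g R)) = ex q f - ex q (fun R => f R * g R) := by
    rw [← ex_sub]; congr 1; ext; ring
  rw [e0, one_mul] at key
  change ex q f * ex q (fun R => 1 - g R) ≤ ex q (fun R => f R * (1 - g R)) at key
  rw [e1, e2] at key
  linarith

/-! ### Janson's inequality -/

variable {κ : Type*}

open Classical in
/-- The probability that none of the sets `S j`, `j ∈ J`, is contained in the random set. -/
noncomputable def avoid (q : ι → ℝ) (S : κ → Finset ι) (J : Finset κ) : ℝ :=
  ex q fun R => if ∀ j ∈ J, ¬ S j ⊆ R then 1 else 0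

lemma avoid_nonneg (h0 : ∀ i, 0 ≤ q i) (h1 : ∀ i, q i ≤ 1) (S : κ → Finset ι) (J : Finset κ) :
    0 ≤ avoid q S J :=
  ex_nonneg h0 h1 fun R => by split_ifs <;> norm_num

lemma avoid_anti (h0 : ∀ i, 0 ≤ q i) (h1 : ∀ i, q i ≤ 1) (S : κ → Finset ι) {J J' : Finset κ}
    (h : J ⊆ J') : avoid q S J' ≤ avoid q S J := by
  refine ex_mono h0 h1 fun R => ?_
  split_ifs with a b
  · exact le_rfl
  · exact absurd (fun j hj => a j (h hj)) b
  · norm_num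
  · exact le_rfl

variable [DecidableEq κ]

-- The Boppana–Spencer step. Condition only on `D0`, the avoidance of the sets disjoint from `S i`,
-- which is independent of `S i ⊆ R`. The sets meeting `S i` are subtracted by a union bound, and
-- Harris' inequality bounds each such term. What is lost from `avoid q S J` is thus at least `(a -
-- b) * avoid q S J0`, where `a` is the probability of `S i ⊆ R` and `b` is the sum over the sets
-- meeting `S i`.
open Classical in
lemma avoid_insert_le (h0 : ∀ i, 0 ≤ q i) (h1 : ∀ i, q i ≤ 1) (S : κ → Finset ι) (J : Finset κ)
    (i : κ) :
    avoid q S (insert i J) ≤ avoid q S J * Real.exp (-(∏ e ∈ S i, q e) +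
      ∑ j ∈ J with ¬ Disjoint (S i) (S j), ∏ e ∈ S i ∪ S j, q e) := by
  set N := J.filter fun j => ¬ Disjoint (S i) (S j) with hN
  set J0 := J.filter fun j => Disjoint (S i) (S j) with hJ0
  set D0 : Finset ι → ℝ := fun R => if ∀ j ∈ J0, ¬ S j ⊆ R then 1 else 0 with hD0
  have hA : Antitone D0 := by
    intro a b hab
    simp only [hD0]
    split_ifs with x y
    · exact le_rfl
    · exact absurd (fun j hj hs => x j hj (hs.trans hab)) y
    · norm_num
    · exact le_rfl
  have e1 : ex q (fun R => if S i ⊆ R then D0 R else 0) = (∏ e ∈ S i, q e) * avoid q S J0 := by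
    refine ex_subset (S i) D0 fun R => ?_
    have : ∀ j ∈ J0, (S j ⊆ R \ S i ↔ S j ⊆ R) := fun j hj => by
      rw [Finset.subset_sdiff]
      have := (Finset.mem_filter.1 hj).2
      exact ⟨fun h => h.1, fun h => ⟨h, this.symm⟩⟩
    simp only [hD0]
    congr 1
    exact propext (forall₂_congr fun j hj => not_congr (this j hj))
  have e2 : ∀ j, ex q (fun R => (if S i ∪ S j ⊆ R then 1 else 0) * D0 R) ≤
      (∏ e ∈ S i ∪ S j, q e) * avoid q S J0 := fun j => by
    rw [← ex_subset_one]
    refine ex_mul_le h0 h1 (fun R => by split_ifs <;> norm_num) ?_ (fun R => ?_) hA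
    · intro a b hab
      dsimp only
      split_ifs with x y
      · exact le_rfl
      · exact absurd (x.trans hab) y
      · norm_num
      · exact le_rfl
    · simp only [hD0]; split_ifs <;> norm_num
  have e3 : avoid q S (insert i J) ≤ avoid q S J - (ex q (fun R => if S i ⊆ R then D0 R else 0) -
      ∑ j ∈ N, ex q (fun R => (if S i ∪ S j ⊆ R then 1 else 0) * D0 R)) := by
    rw [← ex_sum, ← ex_sub, avoid, avoid, ← ex_sub]
    -- Pointwise: if `R` contains `S i` and satisfies `D0` but contains some `S j`, `j ∈ J`, then `j
    -- ∈ N`, and its term in the sum compensates.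
    refine ex_mono h0 h1 fun R => ?_
    have hs0 : 0 ≤ ∑ j ∈ N, (if S i ∪ S j ⊆ R then (1 : ℝ) else 0) * D0 R :=
      Finset.sum_nonneg fun j _ => by simp only [hD0]; split_ifs <;> norm_num
    by_cases hd : ∀ j ∈ J, ¬ S j ⊆ R
    · have hd0 : ∀ j ∈ J0, ¬ S j ⊆ R := fun j hj => hd j (Finset.filter_subset _ _ hj)
      rw [if_pos hd]
      by_cases hiR : S i ⊆ R
      · rw [if_neg (fun h => h i (Finset.mem_insert_self _ _) hiR), if_pos hiR]
        simp only [hD0, if_pos hd0] at hs0 ⊢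
        linarith
      · rw [if_neg hiR]
        have : (if ∀ j ∈ insert i J, ¬ S j ⊆ R then (1 : ℝ) else 0) ≤ 1 := by
          split_ifs <;> norm_num
        linarith
    · rw [if_neg hd, if_neg (fun h => hd fun j hj => h j (Finset.mem_insert_of_mem hj))]
      by_cases hiR : S i ⊆ R
      · rw [if_pos hiR]
        by_cases hd0 : ∀ j ∈ J0, ¬ S j ⊆ R
        · push Not at hd
          obtain ⟨j, hj, hjR⟩ := hd
          have hjN : j ∈ N := by
            refine Finset.mem_filter.2 ⟨hj, fun hdis => hd0 j (Finset.mem_filter.2 ⟨hj, hdis⟩) hjR⟩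
          have := Finset.single_le_sum (f := fun j => (if S i ∪ S j ⊆ R then (1 : ℝ) else 0) * D0 R)
            (fun j _ => by simp only [hD0]; split_ifs <;> norm_num) hjN
          simp only [Finset.union_subset hiR hjR, if_true, one_mul] at this
          linarith
        · have : D0 R = 0 := by simp only [hD0, if_neg hd0]
          rw [this] at hs0 ⊢
          linarith
      · rw [if_neg hiR]; linarith
  set b := ∑ j ∈ N, ∏ e ∈ S i ∪ S j, q e with hb
  have hJ0J : avoid q S J ≤ avoid q S J0 := avoid_anti h0 h1 S (Finset.filter_subset _ _)
  have hpos := avoid_nonneg h0 h1 S J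
  have e4 : ∑ j ∈ N, ex q (fun R => (if S i ∪ S j ⊆ R then 1 else 0) * D0 R) ≤
      b * avoid q S J0 := by
    rw [hb, Finset.sum_mul]
    exact Finset.sum_le_sum fun j _ => e2 j
  rw [e1] at e3
  -- If the difference is nonnegative, replace `J0` by `J` and use `1 - u ≤ exp (-u)`; otherwise the
  -- exponential is at least `1` and monotonicity is enough.
  rcases le_total 0 ((∏ e ∈ S i, q e) - b) with hc | hc
  · have h5 := mul_le_mul_of_nonneg_left hJ0J hc
    have h6 := Real.add_one_le_exp (-(∏ e ∈ S i, q e) + b)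
    have h7 := mul_le_mul_of_nonneg_left h6 hpos
    nlinarith
  · have h6 : 1 ≤ Real.exp (-(∏ e ∈ S i, q e) + b) := Real.one_le_exp (by linarith)
    have h7 := mul_le_mul_of_nonneg_left h6 hpos
    have h8 := avoid_anti h0 h1 S (Finset.subset_insert i J)
    linarith

-- Adding the indices one at a time meets each dependent pair once; the double sum counts ordered
-- pairs, hence the division by two.
open Classical in
lemma avoid_le_exp (h0 : ∀ i, 0 ≤ q i) (h1 : ∀ i, q i ≤ 1) (S : κ → Finset ι) (J : Finset κ) :
    avoid q S J ≤ Real.exp (-(∑ i ∈ J, ∏ e ∈ S i, q e) +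
      (∑ i ∈ J, ∑ j ∈ J with j ≠ i ∧ ¬ Disjoint (S i) (S j), ∏ e ∈ S i ∪ S j, q e) / 2) := by
  induction J using Finset.induction_on with
  | empty => simp [avoid, ex_one]
  | insert i J hi ih =>
    refine (avoid_insert_le h0 h1 S J i).trans ?_
    refine (mul_le_mul_of_nonneg_right ih (Real.exp_pos _).le).trans ?_
    rw [← Real.exp_add]
    refine le_of_eq (congrArg _ ?_)
    have hne : ∀ j ∈ J, j ≠ i := fun j hj h => hi (h ▸ hj)
    have f1 : ∑ j ∈ insert i J with j ≠ i ∧ ¬ Disjoint (S i) (S j), ∏ e ∈ S i ∪ S j, q e =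
        ∑ j ∈ J with ¬ Disjoint (S i) (S j), ∏ e ∈ S i ∪ S j, q e := by
      rw [Finset.filter_insert, if_neg (by simp)]
      congr 1
      exact Finset.filter_congr fun j hj => by simp [hne j hj]
    have f2 : ∀ j ∈ J, ∑ l ∈ insert i J with l ≠ j ∧ ¬ Disjoint (S j) (S l), ∏ e ∈ S j ∪ S l, q e =
        (∑ l ∈ J with l ≠ j ∧ ¬ Disjoint (S j) (S l), ∏ e ∈ S j ∪ S l, q e) +
          if ¬ Disjoint (S i) (S j) then ∏ e ∈ S i ∪ S j, q e else 0 := fun j hj => by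
      simp only [Finset.sum_filter]
      rw [Finset.sum_insert hi, add_comm]
      congr 1
      by_cases h : Disjoint (S i) (S j)
      · simp [h, h.symm]
      · simp [h, (hne j hj).symm, disjoint_comm (a := S j), Finset.union_comm (S j)]
    rw [Finset.sum_insert hi, Finset.sum_insert hi, f1, Finset.sum_congr rfl f2,
      Finset.sum_add_distrib, ← Finset.sum_filter]
    ring

open Classical in
/-- **Janson's inequality** in its extended form. -/
theorem janson [Fintype κ] (h0 : ∀ i, 0 ≤ q i) (h1 : ∀ i, q i ≤ 1) (S : κ → Finset ι)
    (hS : ∀ j, (S j).Nonempty) {μ Δ : ℝ} (hμ : μ = ∑ i, ∏ e ∈ S i, q e)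
    (hΔ : ∑ i, ∑ j with ¬ Disjoint (S i) (S j), ∏ e ∈ S i ∪ S j, q e ≤ Δ) (hμ0 : 0 < μ) :
    avoid q S Finset.univ ≤ Real.exp (-(μ ^ 2 / (2 * Δ))) := by
  set a : κ → ℝ := fun i => ∏ e ∈ S i, q e with ha
  set b : κ → κ → ℝ := fun i j =>
    if j ≠ i ∧ ¬ Disjoint (S i) (S j) then ∏ e ∈ S i ∪ S j, q e else 0 with hb
  set D := ∑ i, ∑ j, b i j with hD
  have hprod : ∀ T : Finset ι, 0 ≤ ∏ e ∈ T, q e := fun T => Finset.prod_nonneg fun i _ => h0 i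
  have hb0 : ∀ i j, 0 ≤ b i j := fun i j => by
    simp only [hb]; split_ifs
    · exact hprod _
    · exact le_rfl
  have hD0 : 0 ≤ D := Finset.sum_nonneg fun i _ => Finset.sum_nonneg fun j _ => hb0 i j
  -- The diagonal pairs contribute exactly `μ`. This gives both `μ / Δ ≤ 1` and `D ≤ Δ`.
  have hsplit : μ + D ≤ Δ := by
    refine le_trans (le_of_eq ?_) hΔ
    rw [hμ, hD, ← Finset.sum_add_distrib]
    refine Finset.sum_congr rfl fun i _ => ?_
    rw [Finset.sum_filter, ← Finset.add_sum_erase _ (b i) (Finset.mem_univ i),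
      ← Finset.add_sum_erase _ (fun j => if ¬ Disjoint (S i) (S j) then
        ∏ e ∈ S i ∪ S j, q e else 0) (Finset.mem_univ i)]
    have : ¬ Disjoint (S i) (S i) := by
      rw [disjoint_self, Finset.bot_eq_empty]; exact (hS i).ne_empty
    rw [if_pos this, Finset.union_self]
    simp only [hb, ne_eq, not_true_eq_false, false_and, if_false, zero_add]
    congr 1
    refine Finset.sum_congr rfl fun j hj => ?_
    simp [Finset.ne_of_mem_erase hj]
  have hΔ0 : 0 < Δ := by linarith
  -- The basic bound is applied to a random subfamily of density `p`: the linear term shrinks by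
  -- `p`, the quadratic one by `p ^ 2`. This choice maximises `p * μ - p ^ 2 * Δ / 2`.
  set p : ℝ := μ / Δ with hp
  have hp0 : 0 ≤ p := by positivity
  have hp1 : p ≤ 1 := by rw [hp, div_le_one hΔ0]; linarith
  set Φ : Finset κ → ℝ := fun J => ∑ i, (if i ∈ J then a i else 0) -
    (∑ i, ∑ j, if {i, j} ⊆ J then b i j else 0) / 2 with hΦ
  have hΦJ : ∀ J, avoid q S Finset.univ ≤ Real.exp (-Φ J) := fun J => by
    refine (avoid_anti h0 h1 S (Finset.subset_univ J)).trans
      ((avoid_le_exp h0 h1 S J).trans (le_of_eq (congrArg _ ?_)))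
    simp only [hΦ, neg_sub]
    rw [sub_eq_add_neg, add_comm]
    congr 1
    · congr 1
      rw [← Finset.sum_filter_add_sum_filter_not Finset.univ (· ∈ J)]
      rw [Finset.sum_eq_zero (s := Finset.univ.filter (· ∉ J)), add_zero]
      · refine Finset.sum_congr (by ext; simp) fun i hi => ?_
        rw [Finset.sum_filter]
        rw [← Finset.sum_subset (f := fun j => if {i, j} ⊆ J then b i j else 0)
          (Finset.subset_univ J)]
        · refine Finset.sum_congr rfl fun j hj => ?_
          have hiJ : i ∈ J := by simpa using hi
          have hij : {i, j} ⊆ J := by simp [Finset.insert_subset_iff, hiJ, hj]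
          simp only [hb, if_pos hij]
        · intro j _ hj
          rw [if_neg (by simp [Finset.insert_subset_iff, hj])]
      · intro i hi
        refine Finset.sum_eq_zero fun j _ => ?_
        rw [if_neg]
        simp only [Finset.mem_filter, Finset.mem_univ, true_and] at hi
        simp [Finset.insert_subset_iff, hi]
    · rw [Finset.sum_ite_mem, Finset.univ_inter]
  have hexp : ex (fun _ : κ => p) Φ = p * μ - p ^ 2 * D / 2 := by
    have e1 : ∀ (T : Finset κ) (c : ℝ), ex (fun _ : κ => p) (fun J => if T ⊆ J then c else 0) =
        p ^ T.card * c := fun T c => by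
      have : (fun J : Finset κ => if T ⊆ J then c else 0) =
          fun J => c * if T ⊆ J then 1 else 0 := by ext; split_ifs <;> simp
      rw [this, ex_const_mul, ex_subset_one, Finset.prod_const, mul_comm]
    have e2 : Φ = fun J => (∑ i, (if ({i} : Finset κ) ⊆ J then a i else 0)) -
        (1 / 2 : ℝ) * ∑ i, ∑ j, if {i, j} ⊆ J then b i j else 0 := by
      ext J; simp only [hΦ, Finset.singleton_subset_iff]; ring
    rw [e2, ex_sub, ex_const_mul, ex_sum, ex_sum]
    simp only [ex_sum, e1]
    have e3 : ∀ i j, p ^ ({i, j} : Finset κ).card * b i j = p ^ 2 * b i j := fun i j => by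
      by_cases h : j = i
      · simp [hb, h]
      · rw [Finset.card_pair (Ne.symm h)]
    simp only [e3, Finset.card_singleton, pow_one, ← Finset.mul_sum]
    rw [hμ, hD]; ring
  -- Some subfamily does at least as well as the average.
  obtain ⟨J, hJ⟩ : ∃ J, p * μ - p ^ 2 * D / 2 ≤ Φ J := by
    by_contra! hcon
    have hw : ∀ J, 0 ≤ wt (fun _ : κ => p) J := wt_nonneg (fun _ => hp0) (fun _ => hp1)
    have e0 : ∑ J, wt (fun _ : κ => p) J = 1 := by
      simpa [ex] using ex_one (q := fun _ : κ => p)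
    have : 0 < ∑ J, wt (fun _ : κ => p) J * ((p * μ - p ^ 2 * D / 2) - Φ J) := by
      obtain ⟨J, _, hJ⟩ := Finset.exists_ne_zero_of_sum_ne_zero (e0.trans_ne one_ne_zero)
      refine Finset.sum_pos' (fun J _ => mul_nonneg (hw J) (by linarith [hcon J]))
        ⟨J, Finset.mem_univ _, mul_pos (lt_of_le_of_ne (hw J) (Ne.symm hJ)) (by linarith [hcon J])⟩
    simp only [mul_sub, Finset.sum_sub_distrib, ← Finset.sum_mul, e0] at this
    change 0 < 1 * (p * μ) - 1 * (p ^ 2 * D / 2) - ex (fun _ : κ => p) Φ at this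
    rw [hexp] at this
    linarith
  refine (hΦJ J).trans (Real.exp_le_exp.2 (neg_le_neg (le_trans ?_ hJ)))
  have h1 : p * Δ = μ := by rw [hp]; field_simp
  have h2 : μ ^ 2 / (2 * Δ) = p * μ / 2 := by rw [hp]; field_simp
  rw [h2]
  have h3 : p ^ 2 * D ≤ p ^ 2 * Δ := by
    apply mul_le_mul_of_nonneg_left _ (by positivity); linarith
  have h4 : p ^ 2 * Δ = p * μ := by rw [← h1]; ring
  linarith

end Weights

/-- The law of a random set of the form `setBernoulli u p` in terms of product weights. -/
lemma setBernoulli_real_eq {ι : Type*} [Fintype ι] [DecidableEq ι] (u : Set ι) [DecidablePred (· ∈ u)]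
    (p : unitInterval) (A : Set (Set ι)) [DecidablePred (· ∈ A)] :
    (ProbabilityTheory.setBernoulli u p).real A =
      ex (fun i => if i ∈ u then (p : ℝ) else 0) fun R => if (R : Set ι) ∈ A then 1 else 0 := by
  classical
  have hs : ∀ R : Finset ι, (ProbabilityTheory.setBernoulli u p).real {(R : Set ι)} =
      wt (fun i => if i ∈ u then (p : ℝ) else 0) R := fun R => by
    by_cases h : (R : Set ι) ⊆ u
    · rw [ProbabilityTheory.setBernoulli_real_singleton p h (Set.toFinite u), wt,
        ← Finset.prod_sdiff (Finset.subset_univ R), mul_comm]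
      congr 1
      · rw [← Finset.prod_sdiff (s₁ := u.toFinset \ R) (s₂ := Finset.univ \ R)
          (Finset.sdiff_subset_sdiff (Finset.subset_univ _) le_rfl)]
        rw [Finset.prod_eq_one, one_mul, Finset.prod_congr (g := fun _ => 1 - (p : ℝ)) rfl,
          Finset.prod_const]
        · congr 1
          rw [Set.ncard_eq_toFinset_card']
          congr 1
          ext; simp
        · intro i hi
          simp only [Finset.mem_sdiff, Set.mem_toFinset] at hi
          simp [hi.1, hi.2]
        · intro i hi
          simp only [Finset.mem_sdiff, Set.mem_toFinset, Finset.mem_univ, true_and, not_and,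
            not_not] at hi
          have : i ∉ u := fun h' => hi.1 (hi.2 h')
          simp [hi.1, this]
      · rw [Set.ncard_coe_finset, ← Finset.prod_const]
        refine Finset.prod_congr rfl fun i hi => ?_
        have : i ∈ u := h hi
        simp [hi, this]
    · rw [MeasureTheory.measureReal_def, ProbabilityTheory.setBernoulli_singleton_of_not_subset p h]
      obtain ⟨i, hi, hiu⟩ := Set.not_subset.1 h
      rw [wt, Finset.prod_eq_zero (Finset.mem_univ i)]
      · simp
      · rw [if_pos (by exact_mod_cast hi), if_neg hiu]
  have hA : A = ⋃ R ∈ Finset.univ.filter (fun R : Finset ι => (R : Set ι) ∈ A), {(R : Set ι)} := by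
    ext B
    simp only [Finset.mem_filter, Finset.mem_univ, true_and, Set.mem_iUnion, Set.mem_singleton_iff,
      exists_prop]
    constructor
    · intro h
      exact ⟨B.toFinset, by simpa using h, by simp⟩
    · rintro ⟨R, h, rfl⟩; exact h
  conv_lhs => rw [hA]
  rw [MeasureTheory.measureReal_biUnion_finset]
  · simp only [hs, ex, mul_ite, mul_one, mul_zero, Finset.sum_filter]
  · intro a _ b _ hab
    simpa using hab
  · intro _ _
    exact Set.Finite.measurableSet (Set.finite_singleton _)

/-! ### Sums over functions, weighted by the number of hits of a set -/

section Hits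

variable {I β : Type*} [Fintype I] [DecidableEq I] [Fintype β] [DecidableEq β]

/-- The number of arguments that `ψ` maps into `R`. -/
def hits (R : Finset β) (ψ : I → β) : ℕ := (Finset.univ.filter fun u => ψ u ∈ R).card

/-- Choose `j` arguments `T` that hit `R`. For fixed `T` the sum over all functions factorises: an
argument in `T` contributes `|R| * ρ`, any other at most `|β| + ρ * |R|`. Overcounting the choices
of `T` is harmless for an upper bound. -/
lemma sum_hits_le (R : Finset β) {ρ : ℝ} (hρ : 1 ≤ ρ) (j : ℕ) :
    ∑ ψ : I → β, (if j ≤ hits R ψ then ρ ^ hits R ψ else 0) ≤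
      (Fintype.card I : ℝ) ^ j * ((R.card * ρ) ^ j *
        (Fintype.card β + ρ * R.card) ^ (Fintype.card I - j)) := by
  have hρ0 : 0 ≤ ρ := by linarith
  set g : Finset I → I → β → ℝ := fun T u b =>
    if u ∈ T then (if b ∈ R then ρ else 0) else (if b ∈ R then ρ else 1) with hg
  have hg0 : ∀ T u b, 0 ≤ g T u b := fun T u b => by
    simp only [hg]; split_ifs <;> first | exact hρ0 | norm_num
  have h1 : ∀ ψ : I → β, (if j ≤ hits R ψ then ρ ^ hits R ψ else 0) ≤
      ∑ T ∈ Finset.powersetCard j Finset.univ, ∏ u, g T u (ψ u) := fun ψ => by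
    split_ifs with h
    · obtain ⟨T, hT, hTc⟩ := Finset.exists_subset_card_eq h
      refine le_trans (le_of_eq ?_) (Finset.single_le_sum (f := fun T => ∏ u, g T u (ψ u))
        (fun T _ => Finset.prod_nonneg fun u _ => hg0 _ _ _)
        (Finset.mem_powersetCard.2 ⟨Finset.subset_univ T, hTc⟩))
      have : ∀ u, g T u (ψ u) = if ψ u ∈ R then ρ else 1 := fun u => by
        simp only [hg]
        by_cases hu : u ∈ T
        · have := (Finset.mem_filter.1 (hT hu)).2
          simp [this]
        · simp [hu]
      simp only [this, hits]
      rw [Finset.prod_ite]; simp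
    · exact Finset.sum_nonneg fun T _ => Finset.prod_nonneg fun u _ => hg0 _ _ _
  have hR : (R.card : ℝ) ≤ Fintype.card β := by exact_mod_cast Finset.card_le_univ R
  have h2 : ∀ T ∈ Finset.powersetCard j (Finset.univ : Finset I),
      ∑ ψ : I → β, ∏ u, g T u (ψ u) ≤ (R.card * ρ) ^ j *
        (Fintype.card β + ρ * R.card) ^ (Fintype.card I - j) := fun T hT => by
    have hT := (Finset.mem_powersetCard.1 hT).2
    have e := Finset.prod_univ_sum (fun _ : I => (Finset.univ : Finset β)) (g T)
    rw [Fintype.piFinset_univ] at e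
    rw [← e, ← Finset.prod_sdiff (Finset.subset_univ T), mul_comm]
    refine mul_le_mul ?_ ?_ (Finset.prod_nonneg fun u _ => Finset.sum_nonneg fun b _ => hg0 _ _ _)
      (by positivity)
    · rw [← hT, ← Finset.prod_const]
      refine le_of_eq (Finset.prod_congr rfl fun u hu => ?_)
      simp [hg, hu]
    · rw [← hT, ← Finset.card_univ (α := I), ← Finset.card_sdiff_of_subset (Finset.subset_univ T),
        ← Finset.prod_const]
      refine Finset.prod_le_prod (fun u _ => Finset.sum_nonneg fun b _ => hg0 _ _ _)
        fun u hu => ?_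
      have hu : u ∉ T := (Finset.mem_sdiff.1 hu).2
      simp only [hg, if_neg hu]
      rw [Finset.sum_ite]
      simp only [Finset.sum_const, nsmul_eq_mul, mul_one, Finset.filter_mem_eq_inter,
        Finset.univ_inter]
      have : (((Finset.univ.filter fun b => b ∉ R).card : ℕ) : ℝ) ≤ Fintype.card β := by
        exact_mod_cast Finset.card_le_univ _
      linarith [mul_comm ρ (R.card : ℝ)]
  have hM : 0 ≤ (R.card * ρ) ^ j * (Fintype.card β + ρ * R.card) ^ (Fintype.card I - j) := by
    positivity
  calc _ ≤ ∑ ψ : I → β, ∑ T ∈ Finset.powersetCard j Finset.univ, ∏ u, g T u (ψ u) :=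
        Finset.sum_le_sum fun ψ _ => h1 ψ
    _ = ∑ T ∈ Finset.powersetCard j Finset.univ, ∑ ψ : I → β, ∏ u, g T u (ψ u) :=
        Finset.sum_comm
    _ ≤ _ := Finset.sum_le_card_nsmul _ _ _ h2
    _ ≤ _ := by
        rw [nsmul_eq_mul, Finset.card_powersetCard, Finset.card_univ]
        refine mul_le_mul_of_nonneg_right ?_ hM
        exact_mod_cast Nat.choose_le_pow _ _

lemma sum_embedding_hits_le (R : Finset β) {ρ : ℝ} (hρ : 1 ≤ ρ) (j : ℕ) :
    ∑ ψ : I ↪ β, (if j ≤ hits R ψ then ρ ^ hits R ψ else 0) ≤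
      (Fintype.card I : ℝ) ^ j * ((R.card * ρ) ^ j *
        (Fintype.card β + ρ * R.card) ^ (Fintype.card I - j)) := by
  refine le_trans ?_ (sum_hits_le R hρ j)
  rw [← Finset.sum_image (s := (Finset.univ : Finset (I ↪ β))) (g := fun ψ : I ↪ β => (ψ : I → β))
    (f := fun ψ : I → β => if j ≤ hits R ψ then ρ ^ hits R ψ else 0)
    (fun a _ b _ h => DFunLike.coe_injective h)]
  refine Finset.sum_le_sum_of_subset_of_nonneg (Finset.subset_univ _) fun ψ _ _ => ?_
  split_ifs
  · exact pow_nonneg (by linarith) _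
  · exact le_rfl

end Hits

/-- This compares the product from `sum_hits_le` with the number of injections. Both are close to `w
^ a`, because `ρ * a ^ 2` is small compared with `w`. -/
lemma pow_le_two_mul_descFactorial {w a : ℕ} {ρ : ℝ} (hρ : 1 ≤ ρ)
    (h : 4 * ρ * a ^ 2 ≤ w) : ((w : ℝ) + ρ * a) ^ a ≤ 2 * (w.descFactorial a : ℝ) := by
  rcases Nat.eq_zero_or_pos a with rfl | ha
  · simp
  have ha1 : (1 : ℝ) ≤ a := by exact_mod_cast ha
  have hw : (0 : ℝ) < w := by nlinarith [mul_pos (by linarith : (0:ℝ) < ρ) (by positivity : (0:ℝ) < (a:ℝ)^2)]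
  have haw : (a : ℝ) ≤ w := by nlinarith [mul_le_mul hρ (le_self_pow₀ ha1 two_ne_zero) (by linarith) (by linarith)]
  have haw' : a ≤ w := by exact_mod_cast haw
  set M : ℝ := w + ρ * a with hM
  have hM0 : 0 < M := by positivity
  -- Large enough that `M * (1 - δ) ≤ w - a`, and small enough that Bernoulli's inequality gives `(1
  -- - δ) ^ a ≥ 1 / 2`.
  set δ : ℝ := 2 * ρ * a / w with hδ
  have hδ1 : a * δ ≤ 1 / 2 := by
    rw [hδ, mul_div_assoc', div_le_iff₀ hw]; nlinarith
  have hδ0 : 0 ≤ δ := by positivity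
  have hδ2 : δ ≤ 1 / 2 := by nlinarith
  have h1 : M * (1 - δ) ≤ w - a := by
    have : δ * w = 2 * ρ * a := by rw [hδ]; field_simp
    have h2 : 0 ≤ ρ * a * δ := by positivity
    have : M * (1 - δ) = w + ρ * a - δ * w - ρ * a * δ := by rw [hM]; ring
    nlinarith
  have h2 : (M * (1 - δ)) ^ a ≤ ((w : ℝ) - a) ^ a :=
    pow_le_pow_left₀ (mul_nonneg hM0.le (by linarith)) h1 a
  have h3 : ((w : ℝ) - a) ^ a ≤ (w.descFactorial a : ℝ) := by
    have := Nat.pow_sub_le_descFactorial w a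
    have h4 : ((w - a : ℕ) : ℝ) ^ a ≤ (w.descFactorial a : ℝ) := by
      exact_mod_cast (Nat.pow_le_pow_left (by omega : w - a ≤ w + 1 - a) a).trans this
    rwa [Nat.cast_sub haw'] at h4
  have h5 : 1 / 2 ≤ (1 - δ) ^ a := by
    have := one_add_mul_le_pow (a := -δ) (by linarith) a
    rw [← sub_eq_add_neg] at this
    nlinarith
  have h6 : 0 ≤ M ^ a := by positivity
  rw [mul_pow] at h2
  nlinarith

/-! ### Rooted embeddings -/

section Rooted

variable {n v r : ℕ}

/-- The vertices of `Fin v` outside the tuple `x`. -/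
abbrev Internal (x : Fin r → Fin v) : Type := {u : Fin v // u ∉ range x}

open Classical in
/-- The map that sends the tuple `x` to `y` and agrees with `φ` on all other vertices. -/
noncomputable def extend (x : Fin r → Fin v) (y : Fin r → Fin n) (φ : Internal x → Fin n) :
    Fin v → Fin n :=
  fun u => if h : u ∈ range x then y h.choose else φ ⟨u, h⟩

variable {x : Fin r → Fin v} {y : Fin r → Fin n} {φ : Internal x → Fin n}

lemma extend_root (hx : Function.Injective x) (l : Fin r) : extend x y φ (x l) = y l := by
  have h : x l ∈ range x := ⟨l, rfl⟩
  rw [extend, dif_pos h]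
  exact congrArg y (hx h.choose_spec)

lemma extend_internal (u : Internal x) : extend x y φ u = φ u := by
  rw [extend, dif_neg u.2]

lemma extend_injective (hx : Function.Injective x) (hy : Function.Injective y)
    (hφ : Function.Injective φ) (hd : ∀ l u, y l ≠ φ u) : Function.Injective (extend x y φ) := by
  intro a b hab
  by_cases ha : a ∈ range x
  · obtain ⟨l, rfl⟩ := ha
    by_cases hb : b ∈ range x
    · obtain ⟨l', rfl⟩ := hb
      rw [extend_root hx, extend_root hx] at hab
      rw [hy hab]
    · rw [extend_root hx, extend_internal ⟨b, hb⟩] at hab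
      exact absurd hab (hd _ _)
  · by_cases hb : b ∈ range x
    · obtain ⟨l', rfl⟩ := hb
      rw [extend_root hx, extend_internal ⟨a, ha⟩] at hab
      exact absurd hab.symm (hd _ _)
    · rw [extend_internal ⟨a, ha⟩, extend_internal ⟨b, hb⟩] at hab
      exact congrArg Subtype.val (hφ hab)

lemma card_internal (hx : Function.Injective x) [Fintype (Internal x)] :
    Fintype.card (Internal x) = v - r := by
  classical
  rw [Fintype.card_subtype_compl (fun u => u ∈ range x)]
  have : Fintype.card {u // u ∈ range x} = r := by
    refine Eq.trans ?_ (Fintype.card_fin r)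
    exact (Fintype.card_congr (Equiv.ofInjective x hx)).symm
  rw [this, Fintype.card_fin]

end Rooted

/-! ### The density -/

/-- The supremum is a genuine one: the quotient depends only on the vertex set and the edge set, and
there are finitely many such pairs. -/
lemma le_density {v : ℕ} (F F' : Hypergraph (Fin v)) (X : Set (Fin v)) (hs : IsSubgraph F' F)
    (hne : F'.edgeSet.Nonempty) (hX : X ⊆ F'.vertexSet ∨ X ∩ F'.vertexSet = ∅) :
    (F'.edgeSet.ncard : ℝ) / ((F'.vertexSet.ncard : ℝ) - max 1 ((F'.vertexSet ∩ X).ncard : ℝ)) ≤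
      density F X := by
  refine le_csSup ?_ ⟨F', hs, hne, hX, rfl⟩
  refine Set.Finite.bddAbove (Set.Finite.subset (Set.finite_range
    fun q : Set (Fin v) × Set (Set (Fin v)) => (q.2.ncard : ℝ) /
      ((q.1.ncard : ℝ) - max 1 ((q.1 ∩ X).ncard : ℝ))) ?_)
  rintro d ⟨H, -, -, -, rfl⟩
  exact ⟨(H.vertexSet, H.edgeSet), rfl⟩

/-! ### Overlaps of two copies, controlled by the density -/

section Overlap

variable {k n v r : ℕ} {F : Hypergraph (Fin v)} {x : Fin r → Fin v}

/-- The subgraph of `F` that `g` maps into the copy of `F` given by `f`. -/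
def overlapGraph (F : Hypergraph (Fin v)) (f g : Fin v → Fin n) : Hypergraph (Fin v) where
  vertexSet := {u | g u ∈ range f}
  edgeSet := {e ∈ F.edgeSet | g '' e ∈ (fun e => f '' e) '' F.edgeSet}
  subset_vertexSet_of_mem_edgeSet' := by
    rintro e ⟨-, e', -, he⟩ u hu
    have : g u ∈ f '' e' := by
      change f '' e' = g '' e at he
      rw [he]; exact ⟨u, hu, rfl⟩
    obtain ⟨u', -, h⟩ := this
    exact ⟨u', h⟩

/-- The overlap is a subgraph that contains all roots or avoids them, so it competes in the maximum
defining the density. With common roots, `h ≥ 1` because no edge lies inside the roots. With no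
roots, all `k ≥ 2` vertices of a shared edge are internal, and the `1` in `max 1 _` saves one
vertex. -/
lemma overlap_bound (hk : 2 ≤ k) (hF : IsUniform k F) (hV : F.vertexSet = univ)
    (hx : Function.Injective x)
    (hex : ∀ e ∈ F.edgeSet, ¬ e ⊆ range x) {f g : Fin v → Fin n}
    (hne : (overlapGraph F f g).edgeSet.Nonempty) {h : ℕ}
    (hh : {u | u ∉ range x ∧ g u ∈ range f}.ncard = h) :
    ((∀ l, g (x l) ∈ range f) →
      1 ≤ h ∧ ((overlapGraph F f g).edgeSet.ncard : ℝ) ≤ density F (range x) * h) ∧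
    ((∀ l, g (x l) ∉ range f) →
      2 ≤ h ∧ ((overlapGraph F f g).edgeSet.ncard : ℝ) ≤ density F (range x) * (h - 1)) := by
  have hsub : IsSubgraph (overlapGraph F f g) F := ⟨by simp [hV], fun e he => he.1⟩
  have hr : (range x).ncard = r := by
    rw [← Set.image_univ, Set.ncard_image_of_injective _ hx, Set.ncard_univ]; simp
  obtain ⟨e, he⟩ := hne
  have heV := (overlapGraph F f g).subset_vertexSet_of_mem_edgeSet' he
  have hek : e.ncard = k := hF e he.1
  have hkV : k ≤ (overlapGraph F f g).vertexSet.ncard := hek ▸ Set.ncard_le_ncard heV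
  have hd0 : 0 ≤ ((overlapGraph F f g).edgeSet.ncard : ℝ) := Nat.cast_nonneg _
  set m := density F (range x) with hm
  constructor
  · intro hl
    have hX : range x ⊆ (overlapGraph F f g).vertexSet := by rintro _ ⟨l, rfl⟩; exact hl l
    have hle := le_density F _ (range x) hsub ⟨e, he⟩ (Or.inl hX)
    rw [Set.inter_eq_right.2 hX, hr, ← hm] at hle
    have hc : (overlapGraph F f g).vertexSet.ncard = r + h := by
      have h1 := Set.ncard_sdiff_add_ncard_of_subset hX
      have h2 : (overlapGraph F f g).vertexSet \ range x = {u | u ∉ range x ∧ g u ∈ range f} := by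
        ext u; exact and_comm
      rw [h2, hh, hr] at h1; omega
    have h1 : 1 ≤ h := by
      obtain ⟨u, hu, hux⟩ := Set.not_subset.1 (hex e he.1)
      rw [← hh, Nat.one_le_iff_ne_zero, Ne, Set.ncard_eq_zero]
      exact Set.Nonempty.ne_empty ⟨u, hux, heV hu⟩
    refine ⟨h1, ?_⟩
    have hpos : 0 < ((overlapGraph F f g).vertexSet.ncard : ℝ) - max 1 (r : ℝ) := by
      rw [hc, sub_pos, max_lt_iff]
      constructor
      · rw [hc] at hkV; exact_mod_cast (by omega : 1 < r + h)
      · exact_mod_cast (by omega : r < r + h)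
    -- Only the case `r = 0` loses anything here.
    have hdle : ((overlapGraph F f g).vertexSet.ncard : ℝ) - max 1 (r : ℝ) ≤ h := by
      rw [hc]; push_cast; linarith [le_max_right (1 : ℝ) r]
    have hm0 : 0 ≤ m := le_trans (div_nonneg hd0 hpos.le) hle
    rw [div_le_iff₀ hpos] at hle
    exact hle.trans (mul_le_mul_of_nonneg_left hdle hm0)
  · intro hl
    have hX : range x ∩ (overlapGraph F f g).vertexSet = ∅ := by
      ext u
      simp only [Set.mem_inter_iff, Set.mem_empty_iff_false, iff_false, not_and]
      rintro ⟨l, rfl⟩; exact hl l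
    have hle := le_density F _ (range x) hsub ⟨e, he⟩ (Or.inr hX)
    rw [Set.inter_comm, hX, ← hm] at hle
    have hc : (overlapGraph F f g).vertexSet.ncard = h := by
      rw [← hh]
      congr 1
      ext u
      refine ⟨fun hu => ⟨fun hux => ?_, hu⟩, fun hu => hu.2⟩
      have : u ∈ range x ∩ (overlapGraph F f g).vertexSet := ⟨hux, hu⟩
      rw [hX] at this; exact this
    refine ⟨by omega, ?_⟩
    have h2 : (2 : ℝ) ≤ h := by exact_mod_cast (by omega : 2 ≤ h)
    simp only [Set.ncard_empty, Nat.cast_zero, max_eq_left (zero_le_one (α := ℝ)), hc] at hle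
    rwa [div_le_iff₀ (by linarith)] at hle

end Overlap

/-- Since `p ≤ 1`, `p ^ c ≥ (p ^ m) ^ d ≥ ρ ^ (-d)`: sharing `c` edges costs at most `ρ` for each of
`d` vertices. -/
lemma one_le_pow_mul_pow {p ρ m : ℝ} (hp : 0 < p) (hp1 : p ≤ 1) (hρ : 0 < ρ)
    (h : 1 / ρ ≤ p ^ m) {c d : ℕ} (hc : (c : ℝ) ≤ m * d) : 1 ≤ ρ ^ d * p ^ c := by
  have h1 : p ^ (m * d) ≤ p ^ c := by
    rw [← Real.rpow_natCast p c]
    exact Real.rpow_le_rpow_of_exponent_ge hp hp1 hc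
  rw [Real.rpow_mul hp.le, Real.rpow_natCast] at h1
  have h2 : (1 / ρ) ^ d ≤ (p ^ m) ^ d := pow_le_pow_left₀ (by positivity) h d
  calc (1 : ℝ) = ρ ^ d * (1 / ρ) ^ d := by rw [← mul_pow, mul_one_div_cancel hρ.ne', one_pow]
    _ ≤ ρ ^ d * p ^ c := mul_le_mul_of_nonneg_left (h2.trans h1) (by positivity)

/-! ### Janson's inequality for rooted copies -/

section CopyEdges

variable {k n v r : ℕ} {F : Hypergraph (Fin v)} {x : Fin r → Fin v}

open Classical in
/-- The edges of the copy of `F` given by `f`. -/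
noncomputable def copyEdges (F : Hypergraph (Fin v)) (f : Fin v → Fin n) :
    Finset (Set (Fin n)) :=
  F.edgeSet.toFinset.image fun e => f '' e

lemma mem_copyEdges {f : Fin v → Fin n} {e : Set (Fin n)} :
    e ∈ copyEdges F f ↔ ∃ e' ∈ F.edgeSet, f '' e' = e := by
  simp [copyEdges]

lemma card_copyEdges {f : Fin v → Fin n} (hf : Function.Injective f) :
    (copyEdges F f).card = F.edgeSet.ncard := by
  classical
  rw [copyEdges, Finset.card_image_of_injective _ (Set.image_injective.2 hf),
    Set.ncard_eq_toFinset_card']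

open Classical in
lemma card_copyEdges_inter {f g : Fin v → Fin n} (hg : Function.Injective g) :
    (copyEdges F f ∩ copyEdges F g).card = (overlapGraph F f g).edgeSet.ncard := by
  rw [← Set.ncard_image_of_injective _ (Set.image_injective.2 hg), ← Set.ncard_coe_finset]
  congr 1
  ext e
  simp only [Finset.coe_inter, Set.mem_inter_iff, Finset.mem_coe, mem_copyEdges, Set.mem_image]
  constructor
  · rintro ⟨⟨e', he', h1⟩, ⟨e'', he'', h2⟩⟩
    exact ⟨e'', ⟨he'', e', he', h1.trans h2.symm⟩, h2⟩
  · rintro ⟨e'', ⟨h1, e', he', h2⟩, h3⟩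
    exact ⟨⟨e', he', h2.trans h3⟩, ⟨e'', h1, h3⟩⟩

/-- The rooted embedding of `F` given by the index of a root and an embedding of the internal
vertices. -/
noncomputable def rooted {s : ℕ} (x : Fin r → Fin v) (y : Fin s → Fin r → Fin n)
    (B : Finset (Fin n)) (a : Fin s × (Internal x ↪ {b // b ∈ B})) : Fin v → Fin n :=
  extend x (y a.1) fun u => (a.2 u : Fin n)

variable {s : ℕ} {y : Fin s → Fin r → Fin n} {B : Finset (Fin n)}

lemma rooted_injective (hx : Function.Injective x) (hy : ∀ i, Function.Injective (y i))
    (hyB : ∀ i j, y i j ∉ B) (a : Fin s × (Internal x ↪ {b // b ∈ B})) :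
    Function.Injective (rooted x y B a) :=
  extend_injective hx (hy _) (Subtype.val_injective.comp a.2.injective)
    fun l u h => hyB a.1 l (h ▸ (a.2 u).2)

-- The roots avoid `B`, so an internal vertex of one copy can only coincide with an internal vertex
-- of the other.
open Classical in
lemma ncard_overlap (hx : Function.Injective x) (hyB : ∀ i j, y i j ∉ B)
    (a b : Fin s × (Internal x ↪ {b // b ∈ B})) :
    {u | u ∉ range x ∧ rooted x y B b u ∈ range (rooted x y B a)}.ncard =
      hits (Finset.univ.map a.2) b.2 := by
  rw [hits, ← Set.ncard_coe_finset, ← Set.ncard_image_of_injective _ Subtype.val_injective]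
  congr 1
  ext u
  simp only [Set.mem_ofPred_eq, Finset.coe_filter, Finset.mem_univ, true_and, Set.mem_image,
    Finset.mem_map]
  constructor
  · rintro ⟨hu, w, hw⟩
    refine ⟨⟨u, hu⟩, ?_, rfl⟩
    have hu' : rooted x y B b u = b.2 ⟨u, hu⟩ := extend_internal (⟨u, hu⟩ : Internal x)
    rw [hu'] at hw
    by_cases hwx : w ∈ range x
    · obtain ⟨l, rfl⟩ := hwx
      have : rooted x y B a (x l) = y a.1 l := extend_root hx l
      rw [this] at hw
      exact absurd (hw ▸ (b.2 _).2) (hyB a.1 l)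
    · refine ⟨⟨w, hwx⟩, Subtype.ext ?_⟩
      rw [← hw]
      exact (extend_internal (y := y a.1) (φ := fun u => (a.2 u : Fin n)) (⟨w, hwx⟩ : Internal x)).symm
  · rintro ⟨⟨u, hu⟩, ⟨w, hw⟩, rfl⟩
    refine ⟨hu, w, ?_⟩
    have hu' : rooted x y B b u = b.2 ⟨u, hu⟩ := extend_internal (⟨u, hu⟩ : Internal x)
    rw [hu', ← hw]
    exact extend_internal w

-- The union has `2 e(F)` edges minus the shared ones, and each shared edge is paid for by
-- `one_le_pow_mul_pow`. Different roots save one factor `ρ`, which is what makes the sum over all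
-- `s` roots affordable.
open Classical in
lemma copyEdges_pair_le (hk : 2 ≤ k) (hF : IsUniform k F) (hV : F.vertexSet = univ)
    (hx : Function.Injective x) (hex : ∀ e ∈ F.edgeSet, ¬ e ⊆ range x)
    (hy : ∀ i, Function.Injective (y i)) (hyB : ∀ i j, y i j ∉ B)
    (hyd : ∀ i j, i ≠ j → Disjoint (range (y i)) (range (y j)))
    {p ρ : ℝ} (hp : 0 < p) (hp1 : p ≤ 1) (hρ : 0 < ρ)
    (h : 1 / ρ ≤ p ^ density F (range x)) (a b : Fin s × (Internal x ↪ {b // b ∈ B}))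
    (hab : ¬ Disjoint (copyEdges F (rooted x y B a)) (copyEdges F (rooted x y B b))) :
    p ^ (copyEdges F (rooted x y B a) ∪ copyEdges F (rooted x y B b)).card ≤
      p ^ (2 * F.edgeSet.ncard) * if b.1 = a.1 then
        (if 1 ≤ hits (Finset.univ.map a.2) b.2 then ρ ^ hits (Finset.univ.map a.2) b.2 else 0)
      else ρ⁻¹ *
        (if 2 ≤ hits (Finset.univ.map a.2) b.2 then ρ ^ hits (Finset.univ.map a.2) b.2 else 0) := by
  have ia := rooted_injective hx hy hyB a
  have ib := rooted_injective hx hy hyB b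
  set f := rooted x y B a with hf
  set g := rooted x y B b with hg
  have hne : (overlapGraph F f g).edgeSet.Nonempty := by
    rw [← Set.ncard_pos, ← card_copyEdges_inter ib, Finset.card_pos]
    exact Finset.not_disjoint_iff_nonempty_inter.1 hab
  obtain ⟨h1, h2⟩ := overlap_bound hk hF hV hx hex hne (ncard_overlap hx hyB a b)
  set t := hits (Finset.univ.map a.2) b.2
  rw [← card_copyEdges_inter ib] at h1 h2
  have hcard := Finset.card_union_add_card_inter (copyEdges F f) (copyEdges F g)
  rw [card_copyEdges ia, card_copyEdges ib, ← two_mul] at hcard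
  have hmain : ∀ d : ℕ, ((copyEdges F f ∩ copyEdges F g).card : ℝ) ≤ density F (range x) * d →
      p ^ (copyEdges F f ∪ copyEdges F g).card ≤ p ^ (2 * F.edgeSet.ncard) * ρ ^ d := fun d hd => by
    have := one_le_pow_mul_pow hp hp1 hρ h hd
    rw [← hcard, pow_add, mul_assoc, mul_comm (p ^ _) (ρ ^ d)]
    exact le_mul_of_one_le_right (by positivity) this
  by_cases hi : b.1 = a.1
  · rw [if_pos hi]
    obtain ⟨ht, hd⟩ := h1 fun l => ⟨x l, by
      rw [hf, hg, rooted, rooted, extend_root hx, extend_root hx, hi]⟩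
    rw [if_pos ht]
    exact hmain _ hd
  · rw [if_neg hi]
    obtain ⟨ht, hd⟩ := h2 fun l => by
      rintro ⟨u, hu⟩
      have hgl : g (x l) = y b.1 l := extend_root hx l
      rw [hgl] at hu
      by_cases hux : u ∈ range x
      · obtain ⟨l', rfl⟩ := hux
        have hfl : f (x l') = y a.1 l' := extend_root hx l'
        rw [hfl] at hu
        exact Set.disjoint_left.1 (hyd _ _ hi) ⟨l, rfl⟩ ⟨l', hu⟩
      · have hfl : f u = a.2 ⟨u, hux⟩ := extend_internal (⟨u, hux⟩ : Internal x)
        exact hyB b.1 l (hu ▸ hfl ▸ (a.2 _).2)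
    rw [if_pos ht]
    have := hmain (t - 1) (by rw [Nat.cast_sub (by omega)]; exact_mod_cast hd)
    refine this.trans (le_of_eq ?_)
    congr 1
    obtain ⟨t', ht'⟩ : ∃ t', t = t' + 1 := ⟨t - 1, by omega⟩
    rw [ht', Nat.add_sub_cancel, pow_succ]
    field_simp

open Classical in
/-- It is exponentially unlikely that no vertex-rooted copy of `F` has its internal vertices in a
given set. -/
theorem avoid_copies_le (hk : 2 ≤ k) (hF : IsUniform k F) (hV : F.vertexSet = univ)
    (hrv : r + 2 ≤ v)
    (hx : Function.Injective x) (hex : ∀ e ∈ F.edgeSet, ¬ e ⊆ range x)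
    (hy : ∀ i, Function.Injective (y i)) (hyB : ∀ i j, y i j ∉ B)
    (hyd : ∀ i j, i ≠ j → Disjoint (range (y i)) (range (y j)))
    {p ρ : ℝ} (hp : 0 < p) (hp1 : p ≤ 1) (hρ : 1 ≤ ρ)
    (h : 1 / ρ ≤ p ^ density F (range x)) (hne : F.edgeSet.Nonempty)
    (hs : 0 < s) (hB : 4 * ρ * v ^ 2 ≤ B.card) (hsB : s * v ≤ 2 * B.card) :
    avoid (fun e : Set (Fin n) => if e ∈ {e : Set (Fin n) | e.ncard = k} then p else 0)
      (fun a => copyEdges F (rooted x y B a)) Finset.univ ≤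
      Real.exp (-(s * B.card / (12 * v ^ 3 * ρ))) := by
  set q := fun e : Set (Fin n) => if e ∈ {e : Set (Fin n) | e.ncard = k} then p else 0 with hq
  set S := fun a => copyEdges F (rooted x y B a) with hS
  set E := F.edgeSet.ncard with hE
  set α := v - r with hα
  set w := B.card with hw
  have hρ0 : 0 < ρ := by linarith
  have hcI : Fintype.card (Internal x) = α := card_internal hx
  have hα2 : 2 ≤ α := by omega
  have hα0 : (0 : ℝ) < α := by exact_mod_cast (by omega : 0 < α)
  have hαv : (α : ℝ) ≤ v := by exact_mod_cast Nat.sub_le v r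
  have hv0 : (0 : ℝ) < v := by linarith
  have hw0 : (0 : ℝ) < w := lt_of_lt_of_le (by positivity) hB
  have hs0 : (0 : ℝ) < s := by exact_mod_cast hs
  have hsB' : (s : ℝ) * v ≤ 2 * w := by exact_mod_cast hsB
  have inj := fun a => rooted_injective (x := x) hx hy hyB a
  have hSq : ∀ a, ∀ e ∈ S a, q e = p := fun a e he => by
    obtain ⟨e', he', rfl⟩ := mem_copyEdges.1 he
    simp only [hq]
    rw [if_pos]
    rw [Set.mem_ofPred_eq, Set.ncard_image_of_injective _ (inj a), hF e' he']
  have hprod1 : ∀ a, ∏ e ∈ S a, q e = p ^ E := fun a => by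
    rw [Finset.prod_congr rfl (hSq a), Finset.prod_const, card_copyEdges (inj a)]
  have hprod2 : ∀ a b, ∏ e ∈ S a ∪ S b, q e = p ^ (S a ∪ S b).card := fun a b => by
    rw [Finset.prod_congr rfl fun e he => ?_, Finset.prod_const]
    rcases Finset.mem_union.1 he with he | he
    · exact hSq a e he
    · exact hSq b e he
  set N : ℕ := w.descFactorial α with hN
  have hcemb : Fintype.card (Internal x ↪ {b // b ∈ B}) = N := by
    rw [Fintype.card_embedding_eq, hcI, Fintype.card_coe]
  set M : ℝ := w + ρ * α with hM
  have hMw : (w : ℝ) ≤ M := by rw [hM]; nlinarith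
  have hM0 : 0 < M := by linarith
  -- `M` is the factor of an unconstrained argument in `sum_hits_le`, and `N` counts the embeddings
  -- of the internal vertices into `B`.
  have hMN : M ^ α ≤ 2 * N := by
    refine pow_le_two_mul_descFactorial hρ (le_trans ?_ hB)
    have : (α : ℝ) ^ 2 ≤ v ^ 2 := pow_le_pow_left₀ hα0.le hαv 2
    nlinarith
  have hN0 : (0 : ℝ) < N := by
    have : 0 < M ^ α := by positivity
    linarith
  set T : ℕ → ℝ := fun j => (α : ℝ) ^ j * ((α * ρ) ^ j * M ^ (α - j)) with hT
  have hTsum : ∀ (φ : Internal x ↪ {b // b ∈ B}) (j : ℕ),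
      ∑ ψ : Internal x ↪ {b // b ∈ B}, (if j ≤ hits (Finset.univ.map φ) ψ then
        ρ ^ hits (Finset.univ.map φ) ψ else 0) ≤ T j := fun φ j => by
    have := sum_embedding_hits_le (I := Internal x) (Finset.univ.map φ) hρ j
    rwa [Finset.card_map, Finset.card_univ, hcI, Fintype.card_coe] at this
  have hTj : ∀ j, j ≤ α → T j ≤ 2 * N * (α ^ 2 * ρ / w) ^ j := fun j hj => by
    have h1 : T j = (α ^ 2 * ρ / M) ^ j * M ^ α := by
      rw [div_pow, div_mul_eq_mul_div, eq_div_iff (by positivity)]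
      simp only [hT]
      rw [mul_assoc, mul_assoc, ← pow_add, Nat.sub_add_cancel hj]
      ring
    rw [h1, mul_comm]
    refine mul_le_mul hMN (pow_le_pow_left₀ (by positivity) ?_ j) (by positivity) (by positivity)
    exact div_le_div_of_nonneg_left (by positivity) hw0 hMw
  -- The constant `6` is `2 + 4`, from pairs with equal and with different roots. Then `μ ^ 2 / (2 *
  -- Δ)` equals `s * w / (12 * v ^ 3 * ρ)`.
  set Δ : ℝ := p ^ (2 * E) * (s * N ^ 2 * (6 * v ^ 3 * ρ / w)) with hΔ
  have hrow : ∀ a, ∑ b with ¬ Disjoint (S a) (S b), ∏ e ∈ S a ∪ S b, q e ≤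
      p ^ (2 * E) * (T 1 + s * (ρ⁻¹ * T 2)) := fun a => by
    set G : Fin s × (Internal x ↪ {b // b ∈ B}) → ℝ := fun b => if b.1 = a.1 then
        (if 1 ≤ hits (Finset.univ.map a.2) b.2 then ρ ^ hits (Finset.univ.map a.2) b.2 else 0)
      else ρ⁻¹ *
        (if 2 ≤ hits (Finset.univ.map a.2) b.2 then ρ ^ hits (Finset.univ.map a.2) b.2 else 0)
      with hG
    have hG0 : ∀ b, 0 ≤ G b := fun b => by
      simp only [hG]; split_ifs <;> positivity
    have hT2 : 0 ≤ ρ⁻¹ * T 2 := by positivity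
    calc _ ≤ ∑ b with ¬ Disjoint (S a) (S b), p ^ (2 * E) * G b := by
          refine Finset.sum_le_sum fun b hb => ?_
          rw [hprod2]
          exact copyEdges_pair_le hk hF hV hx hex hy hyB hyd hp hp1 hρ0 h a b
            (Finset.mem_filter.1 hb).2
      _ ≤ ∑ b, p ^ (2 * E) * G b := Finset.sum_le_sum_of_subset_of_nonneg
          (Finset.filter_subset _ _) fun b _ _ => mul_nonneg (by positivity) (hG0 b)
      _ = p ^ (2 * E) * ∑ i, ∑ ψ, G (i, ψ) := by
          rw [← Finset.mul_sum, Fintype.sum_prod_type]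
      _ ≤ p ^ (2 * E) * ∑ i, ((if i = a.1 then T 1 else 0) + ρ⁻¹ * T 2) := by
          refine mul_le_mul_of_nonneg_left (Finset.sum_le_sum fun i _ => ?_) (by positivity)
          by_cases hi : i = a.1
          · simp only [hG, if_pos hi]
            linarith [hTsum a.2 1]
          · simp only [hG, if_neg hi, ← Finset.mul_sum, zero_add]
            exact mul_le_mul_of_nonneg_left (hTsum a.2 2) (by positivity)
      _ = _ := by
          rw [Finset.sum_add_distrib]
          simp
  have hΔle : ∑ a, ∑ b with ¬ Disjoint (S a) (S b), ∏ e ∈ S a ∪ S b, q e ≤ Δ := by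
    refine (Finset.sum_le_card_nsmul _ _ _ fun a _ => hrow a).trans ?_
    rw [Finset.card_univ, Fintype.card_prod, hcemb, Fintype.card_fin, nsmul_eq_mul, hΔ]
    have t1 := hTj 1 (by omega)
    have t2 := hTj 2 hα2
    rw [pow_one] at t1
    -- The bound `s * v ≤ 2 * w` trades the number of roots for one factor `w`.
    have t3 : s * (ρ⁻¹ * T 2) ≤ 2 * N * (2 * v ^ 3 * ρ / w) := by
      have : s * (ρ⁻¹ * T 2) ≤ s * (ρ⁻¹ * (2 * N * (α ^ 2 * ρ / w) ^ 2)) := by gcongr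
      refine this.trans ?_
      have e : s * (ρ⁻¹ * (2 * N * ((α : ℝ) ^ 2 * ρ / w) ^ 2)) =
          2 * N * (ρ / w ^ 2) * (s * α ^ 4) := by field_simp
      have e' : 2 * N * (2 * (v : ℝ) ^ 3 * ρ / w) = 2 * N * (ρ / w ^ 2) * (2 * w * v ^ 3) := by
        field_simp
      rw [e, e']
      refine mul_le_mul_of_nonneg_left ?_ (by positivity)
      calc (s : ℝ) * α ^ 4 ≤ s * (v : ℝ) ^ 4 := by gcongr
        _ = ((s : ℝ) * v) * (v : ℝ) ^ 3 := by ring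
        _ ≤ _ := by gcongr
    have t4 : 2 * N * ((α : ℝ) ^ 2 * ρ / w) ≤ 2 * N * (v ^ 3 * ρ / w) := by
      have : (α : ℝ) ^ 2 ≤ (v : ℝ) ^ 3 := by
        calc (α : ℝ) ^ 2 ≤ (v : ℝ) ^ 2 := by gcongr
          _ ≤ (v : ℝ) ^ 3 := pow_le_pow_right₀ (by exact_mod_cast (by omega : 1 ≤ v)) (by norm_num)
      gcongr
    have t5 : T 1 + s * (ρ⁻¹ * T 2) ≤ N * (6 * v ^ 3 * ρ / w) := by
      calc _ ≤ 2 * N * (v ^ 3 * ρ / w) + 2 * N * (2 * v ^ 3 * ρ / w) := by linarith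
        _ = _ := by ring
    calc _ ≤ ((s * N : ℕ) : ℝ) * (p ^ (2 * E) * (N * (6 * v ^ 3 * ρ / w))) := by gcongr
      _ = _ := by push_cast; ring
  have hμ : (s * N * p ^ E : ℝ) = ∑ a, ∏ e ∈ S a, q e := by
    simp only [hprod1]
    rw [Finset.sum_const, Finset.card_univ, Fintype.card_prod, hcemb, Fintype.card_fin]
    simp
  have := janson (q := q) (fun e => by simp only [hq]; split_ifs <;> linarith)
    (fun e => by simp only [hq]; split_ifs <;> linarith) S (fun a => by
      obtain ⟨e, he⟩ := hne
      exact ⟨_, mem_copyEdges.2 ⟨e, he, rfl⟩⟩) hμ hΔle (by positivity)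
  refine this.trans (le_of_eq (congrArg _ (congrArg _ ?_)))
  rw [hΔ]
  have : p ^ (2 * E) = (p ^ E) ^ 2 := by rw [mul_comm, pow_mul]
  rw [this]
  have hpE : p ^ E ≠ 0 := by positivity
  field_simp
  norm_num

end CopyEdges

/-! ### The pieces of `W` -/

section Pieces

variable {n : ℕ}

/-- The number of elements of `W` below `a`. -/
def rank (W : Finset (Fin n)) (a : Fin n) : ℕ := (W.filter (· < a)).card

/-- The `j`-th of the `L` pieces of `W`: the elements are dealt to the pieces in turn. -/
def piece (W : Finset (Fin n)) (L j : ℕ) : Finset (Fin n) := W.filter fun a => rank W a % L = j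

lemma rank_orderEmbOfFin (W : Finset (Fin n)) {c : ℕ} (h : W.card = c) (i : Fin c) :
    rank W (W.orderEmbOfFin h i) = i := by
  rw [rank, ← Fin.card_Iio i, ← Finset.card_map (W.orderEmbOfFin h).toEmbedding]
  congr 1
  ext b
  simp only [Finset.mem_filter, Finset.mem_map, Finset.mem_Iio]
  constructor
  · rintro ⟨hb, hlt⟩
    have : b ∈ Set.range (W.orderEmbOfFin h) := by
      rw [Finset.range_orderEmbOfFin]; exact hb
    obtain ⟨i', rfl⟩ := this
    exact ⟨i', (OrderEmbedding.lt_iff_lt _).1 hlt, rfl⟩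
  · rintro ⟨i', hi', rfl⟩
    exact ⟨Finset.orderEmbOfFin_mem W h i', (OrderEmbedding.lt_iff_lt _).2 hi'⟩

/-- The elements of rank `j`, `j + L`, `j + 2 * L`, … all land in piece `j`. -/
lemma le_card_piece (W : Finset (Fin n)) {L j : ℕ} (hj : j < L) :
    W.card / L ≤ (piece W L j).card := by
  have hlt : ∀ m : Fin (W.card / L), j + L * m < W.card := fun m => by
    have h1 : L * (m + 1) ≤ L * (W.card / L) := Nat.mul_le_mul_left _ m.2
    have h2 := Nat.mul_div_le W.card L
    rw [mul_add] at h1; omega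
  set g : Fin (W.card / L) → Fin n := fun m => W.orderEmbOfFin rfl ⟨j + L * m, hlt m⟩ with hg
  have hinj : Function.Injective g := fun a b hab => by
    have := (W.orderEmbOfFin rfl).injective hab
    simp only [Fin.mk.injEq, add_right_inj] at this
    exact Fin.ext (Nat.eq_of_mul_eq_mul_left (by omega) this)
  rw [← Fintype.card_fin (W.card / L), ← Finset.card_univ, ← Finset.card_image_of_injective _ hinj]
  refine Finset.card_le_card fun a ha => ?_
  obtain ⟨m, -, rfl⟩ := Finset.mem_image.1 ha
  refine Finset.mem_filter.2 ⟨Finset.orderEmbOfFin_mem _ _ _, ?_⟩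
  rw [rank_orderEmbOfFin]
  simp [Nat.mod_eq_of_lt hj]

end Pieces

/-! ### The good event -/

section Good

variable {k n v r : ℕ}

/-- `f` embeds `F` into the hypergraph with edge set `E`, maps `x` to `y`, and maps the internal
vertices into `B`. -/
def IsRootedEmb (F : Hypergraph (Fin v)) (x : Fin r → Fin v) (E : Set (Set (Fin n)))
    (y : Fin r → Fin n) (B : Set (Fin n)) (f : Fin v → Fin n) : Prop :=
  Function.Injective f ∧ (∀ l, f (x l) = y l) ∧ (∀ u, u ∉ range x → f u ∈ B) ∧
    ∀ e ∈ F.edgeSet, f '' e ∈ E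

/-- A family of pairwise disjoint tuples of distinct vertices outside `W`. -/
def IsRootFamily {s : ℕ} (W : Finset (Fin n)) (y : Fin s → Fin r → Fin n) : Prop :=
  (∀ i, Function.Injective (y i)) ∧ (∀ i j, y i j ∉ W) ∧
    ∀ i j, i ≠ j → Disjoint (range (y i)) (range (y j))

/-- In every piece of `W`, after the removal of a few vertices, some root of a large enough family
still has a copy of `F`. -/
def Good (F : Hypergraph (Fin v)) (x : Fin r → Fin v) (W : Finset (Fin n)) (L : ℕ)
    (E : Set (Set (Fin n))) : Prop :=
  ∀ j < L, ∀ s, 0 < s → ∀ y : Fin s → Fin r → Fin n, IsRootFamily W y →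
    ∀ z : Fin (s * v) → Fin n, s * v ≤ (piece W L j).card →
      2 * (piece W L j ∩ Finset.univ.image z).card ≤ (piece W L j).card →
      ∃ i f, IsRootedEmb F x E (y i) (↑(piece W L j \ Finset.univ.image z)) f

variable {F : Hypergraph (Fin v)} {x : Fin r → Fin v} {W : Finset (Fin n)} {L : ℕ}

lemma isRootedEmb_rooted (hx : Function.Injective x) {s : ℕ} {y : Fin s → Fin r → Fin n}
    {B : Finset (Fin n)} (hy : ∀ i, Function.Injective (y i)) (hyB : ∀ i j, y i j ∉ B)
    (a : Fin s × (Internal x ↪ {b // b ∈ B})) {E : Set (Set (Fin n))}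
    (h : ∀ e ∈ copyEdges F (rooted x y B a), e ∈ E) :
    IsRootedEmb F x E (y a.1) (↑B) (rooted x y B a) := by
  refine ⟨rooted_injective hx hy hyB a, fun l => extend_root hx l, fun u hu => ?_,
    fun e he => h _ (mem_copyEdges.2 ⟨e, he, rfl⟩)⟩
  have : rooted x y B a u = a.2 ⟨u, hu⟩ := extend_internal (⟨u, hu⟩ : Internal x)
  rw [this]
  exact (a.2 _).2

lemma card_piece_sdiff_image {j N : ℕ} (z : Fin N → Fin n)
    (h : 2 * (piece W L j ∩ Finset.univ.image z).card ≤ (piece W L j).card) :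
    (piece W L j).card ≤ 2 * (piece W L j \ Finset.univ.image z).card := by
  have := Finset.card_sdiff_add_card_inter (piece W L j) (Finset.univ.image z)
  omega

lemma good_of_no_edges (hx : Function.Injective x) (hne : ¬ F.edgeSet.Nonempty)
    (hw : ∀ j < L, 2 * v ≤ (piece W L j).card) (E : Set (Set (Fin n))) : Good F x W L E := by
  intro j hj s hs y hy z _ hz
  have hB := card_piece_sdiff_image z hz
  set B := piece W L j \ Finset.univ.image z with hBdef
  have hBW : B ⊆ W := Finset.sdiff_subset.trans (Finset.filter_subset _ _)
  have : Nonempty (Internal x ↪ {b // b ∈ B}) := by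
    rw [Function.Embedding.nonempty_iff_card_le]
    have h1 : Fintype.card (Internal x) ≤ v := by
      simp
    have h2 := hw j hj
    rw [Fintype.card_coe]; omega
  obtain ⟨φ⟩ := this
  refine ⟨⟨0, hs⟩, _, isRootedEmb_rooted hx hy.1 (fun i j h => hy.2.1 i j (hBW h)) (⟨0, hs⟩, φ) ?_⟩
  intro e he
  obtain ⟨e', he', -⟩ := mem_copyEdges.1 he
  exact absurd ⟨e', he'⟩ hne

open Classical in
theorem le_prob_good (hk : 2 ≤ k) (hF : IsUniform k F) (hV : F.vertexSet = univ) (hrv : r + 2 ≤ v)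
    (hx : Function.Injective x) (hex : ∀ e ∈ F.edgeSet, ¬ e ⊆ range x)
    (hn : 1 ≤ n) (hL : L ≤ n ^ 2) {p : unitInterval} {ρ K : ℝ} (hρ : 1 ≤ ρ) (hK : 0 < K)
    (h : F.edgeSet.Nonempty → 0 < (p : ℝ) ∧ 1 / ρ ≤ (p : ℝ) ^ density F (range x))
    (hw : ∀ j < L, 8 * ρ * v ^ 2 ≤ (piece W L j).card)
    (hθ : ∀ j < L, (2 * v + K + 3) * Real.log n ≤ (piece W L j).card / (24 * v ^ 3 * ρ)) :
    1 - (n : ℝ) ^ (-K) ≤ (edgeLaw k n p).real {E | Good F x W L E} := by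
  have hn1 : (1 : ℝ) ≤ n := by exact_mod_cast hn
  have hn0 : (0 : ℝ) < n := by linarith
  have hv1 : (1 : ℝ) ≤ v := by exact_mod_cast (by omega : 1 ≤ v)
  have hv0 : (0 : ℝ) < v := by linarith
  have hrv' : (r : ℝ) ≤ v := by exact_mod_cast (by omega : r ≤ v)
  by_cases hne : F.edgeSet.Nonempty
  swap
  · have : {E | Good F x W L E} = univ := Set.eq_univ_of_forall fun E =>
      good_of_no_edges hx hne (fun j hj => by
        have h1 := hw j hj
        have : (2 * v : ℝ) ≤ (piece W L j).card := by nlinarith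
        exact_mod_cast this) E
    rw [this, edgeLaw, MeasureTheory.probReal_univ]
    linarith [Real.rpow_pos_of_pos hn0 (-K)]
  obtain ⟨hp0, hpρ⟩ := h hne
  rw [edgeLaw, setBernoulli_real_eq]
  set q := fun e : Set (Fin n) => if e ∈ {e : Set (Fin n) | e.ncard = k} then (p : ℝ) else 0 with hq
  have hq0 : ∀ e, 0 ≤ q e := fun e => by simp only [hq]; split_ifs <;> linarith [p.2.1]
  have hq1 : ∀ e, q e ≤ 1 := fun e => by simp only [hq]; split_ifs <;> linarith [p.2.2]
  -- The deleted set is given as a list with possible repetitions, so roots and deletions together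
  -- have at most `n ^ (s * r + s * v)` choices.
  set X : (j : ℕ) → (s : ℕ) →
      Finset ((Fin s → Fin r → Fin n) × (Fin (s * v) → Fin n)) := fun j s =>
    Finset.univ.filter fun a => IsRootFamily W a.1 ∧ s * v ≤ (piece W L j).card ∧
      2 * (piece W L j ∩ Finset.univ.image a.2).card ≤ (piece W L j).card with hX
  set bad : ℕ → (s : ℕ) → (Fin s → Fin r → Fin n) × (Fin (s * v) → Fin n) →
      Finset (Set (Fin n)) → ℝ := fun j s a R =>
    if ∀ b ∈ (Finset.univ : Finset (Fin s × (Internal x ↪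
      {b // b ∈ piece W L j \ Finset.univ.image a.2}))), ¬ copyEdges F
        (rooted x a.1 (piece W L j \ Finset.univ.image a.2) b) ⊆ R then 1 else 0 with hbad
  have hbad0 : ∀ j s a R, 0 ≤ bad j s a R := fun j s a R => by
    simp only [hbad]; split_ifs <;> norm_num
  have hpoint : ∀ R : Finset (Set (Fin n)),
      1 - ∑ j ∈ Finset.range L, ∑ s ∈ Finset.Icc 1 n, ∑ a ∈ X j s, bad j s a R ≤
        if (R : Set (Set (Fin n))) ∈ {E | Good F x W L E} then 1 else 0 := fun R => by
    split_ifs with hR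
    · have : 0 ≤ ∑ j ∈ Finset.range L, ∑ s ∈ Finset.Icc 1 n, ∑ a ∈ X j s, bad j s a R :=
        Finset.sum_nonneg fun j _ => Finset.sum_nonneg fun s _ => Finset.sum_nonneg fun a _ =>
          hbad0 _ _ _ _
      linarith
    · rw [Set.mem_ofPred_eq, Good] at hR
      push Not at hR
      obtain ⟨j, hj, s, hs, y, hy, z, hsv, hz, hno⟩ := hR
      have hsn : s ≤ n := by
        have h1 : (piece W L j).card ≤ n := by simpa using Finset.card_le_univ (piece W L j)
        have h2 : s * 1 ≤ s * v := Nat.mul_le_mul_left _ (by omega)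
        omega
      have hone : bad j s (y, z) R = 1 := by
        simp only [hbad]
        rw [if_pos]
        intro b _ hb
        refine hno b.1 _ (isRootedEmb_rooted hx hy.1 (fun i l h => hy.2.1 i l ?_) b
          fun e he => hb he)
        exact Finset.filter_subset _ _ (Finset.sdiff_subset h)
      have h1 := Finset.single_le_sum (f := fun a => bad j s a R) (fun a _ => hbad0 j s a R)
        (Finset.mem_filter.2 ⟨Finset.mem_univ (y, z), hy, hsv, hz⟩ : (y, z) ∈ X j s)
      have h2 := Finset.single_le_sum (f := fun s => ∑ a ∈ X j s, bad j s a R)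
        (fun s _ => Finset.sum_nonneg fun a _ => hbad0 j s a R)
        (Finset.mem_Icc.2 ⟨hs, hsn⟩)
      have h3 := Finset.single_le_sum
        (f := fun j => ∑ s ∈ Finset.Icc 1 n, ∑ a ∈ X j s, bad j s a R)
        (fun j _ => Finset.sum_nonneg fun s _ => Finset.sum_nonneg fun a _ => hbad0 j s a R)
        (Finset.mem_range.2 hj)
      simp only [hone] at h1
      linarith
  -- At least half of the piece survives the deletion, which turns the `24` of the hypothesis into
  -- the `12` of `avoid_copies_le`.
  have hterm : ∀ j < L, ∀ s, 0 < s → ∀ a ∈ X j s,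
      ex q (bad j s a) ≤ (n : ℝ) ^ (-((2 * v + K + 3) * s)) := fun j hj s hs a ha => by
    obtain ⟨-, hroot, hsv, hz⟩ := Finset.mem_filter.1 ha
    have hB := card_piece_sdiff_image a.2 hz
    set B := piece W L j \ Finset.univ.image a.2 with hBdef
    have hB' : ((piece W L j).card : ℝ) ≤ 2 * B.card := by exact_mod_cast hB
    have hs0 : (0 : ℝ) < s := by exact_mod_cast hs
    have key := avoid_copies_le (y := a.1) (B := B) hk hF hV hrv hx hex hroot.1 (fun i l h => hroot.2.1 i l
      (Finset.filter_subset _ _ (Finset.sdiff_subset h))) hroot.2.2 hp0 p.2.2 hρ hpρ hne hs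
      (by linarith [hw j hj]) (hsv.trans hB)
    refine le_trans (le_of_eq ?_) (key.trans ?_)
    · simp only [avoid, hbad]
      congr!
    rw [Real.rpow_def_of_pos hn0, Real.exp_le_exp]
    have h1 := mul_le_mul_of_nonneg_left (hθ j hj) hs0.le
    have h2 : s * ((piece W L j).card / (24 * v ^ 3 * ρ)) ≤ s * B.card / (12 * v ^ 3 * ρ) := by
      rw [mul_div_assoc]
      refine mul_le_mul_of_nonneg_left ?_ hs0.le
      rw [div_le_div_iff₀ (by positivity) (by positivity)]
      have : 0 ≤ 12 * v ^ 3 * ρ := by positivity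
      nlinarith
    linarith
  have hcardX : ∀ j s, ((X j s).card : ℝ) ≤ (n : ℝ) ^ ((2 * v : ℝ) * s) := fun j s => by
    have h1 : (X j s).card ≤ n ^ (s * r + s * v) := by
      refine (Finset.card_le_univ _).trans (le_of_eq ?_)
      simp [Fintype.card_prod, pow_add, ← pow_mul, mul_comm]
    have h2 : n ^ (s * r + s * v) ≤ n ^ (2 * v * s) := by
      refine Nat.pow_le_pow_right hn ?_
      have : s * r ≤ s * v := Nat.mul_le_mul_left _ (by omega)
      nlinarith
    have h3 : ((X j s).card : ℝ) ≤ (n : ℝ) ^ (2 * v * s) := by exact_mod_cast h1.trans h2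
    refine h3.trans (le_of_eq ?_)
    rw [← Real.rpow_natCast]; push_cast; rfl
  -- For each `j` and `s` the failures sum to at most `n ^ (-(K + 3))`; the `3` pays for at most `n
  -- ^ 2` pieces and `n` values of `s`.
  have hsum : ∑ j ∈ Finset.range L, ∑ s ∈ Finset.Icc 1 n, ∑ a ∈ X j s, ex q (bad j s a) ≤
      (n : ℝ) ^ (-K) := by
    have hX1 : ∀ j ∈ Finset.range L, ∀ s ∈ Finset.Icc 1 n,
        ∑ a ∈ X j s, ex q (bad j s a) ≤ (n : ℝ) ^ (-(K + 3)) := fun j hj s hs => by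
      have hs1 := (Finset.mem_Icc.1 hs).1
      refine (Finset.sum_le_card_nsmul _ _ _ (hterm j (Finset.mem_range.1 hj) s hs1)).trans ?_
      rw [nsmul_eq_mul]
      refine (mul_le_mul_of_nonneg_right (hcardX j s) (Real.rpow_nonneg hn0.le _)).trans ?_
      rw [← Real.rpow_add hn0]
      refine Real.rpow_le_rpow_of_exponent_le hn1 ?_
      have : (1 : ℝ) ≤ s := by exact_mod_cast hs1
      nlinarith
    have hpos : (0 : ℝ) ≤ (n : ℝ) ^ (-(K + 3)) := Real.rpow_nonneg hn0.le _
    calc _ ≤ ∑ j ∈ Finset.range L, ∑ s ∈ Finset.Icc 1 n, (n : ℝ) ^ (-(K + 3)) :=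
          Finset.sum_le_sum fun j hj => Finset.sum_le_sum fun s hs => hX1 j hj s hs
      _ = (L : ℝ) * (n * (n : ℝ) ^ (-(K + 3))) := by simp
      _ ≤ (n : ℝ) ^ 2 * (n * (n : ℝ) ^ (-(K + 3))) := by
          refine mul_le_mul_of_nonneg_right ?_ (by positivity)
          exact_mod_cast hL
      _ = (n : ℝ) ^ ((3 : ℕ) : ℝ) * (n : ℝ) ^ (-(K + 3)) := by
          rw [Real.rpow_natCast]; ring
      _ = (n : ℝ) ^ (-K) := by
          rw [← Real.rpow_add hn0]; congr 1; push_cast; ring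
  have hfin := ex_mono hq0 hq1 hpoint
  rw [ex_sub, ex_one, ex_sum] at hfin
  simp only [ex_sum] at hfin
  linarith

end Good

/-! ### The greedy algorithm -/

section Greedy

variable {n v r t : ℕ}

/-- A partial choice of embeddings. -/
abbrev Choice (n v t : ℕ) : Type := Fin t → Option (Fin v → Fin n)

/-- The vertices of `B` that are not yet covered by the embeddings of `g`. -/
def free (B : Finset (Fin n)) (g : Choice n v t) : Set (Fin n) :=
  {a | a ∈ B ∧ ∀ i f, g i = some f → a ∉ range f}

/-- Processing the root `y i` with the set `B`: if `y i` has no embedding yet, and one into the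
free part of `B` exists, then one such embedding is chosen. -/
def GreedyStep (F : Hypergraph (Fin v)) (x : Fin r → Fin v) (E : Set (Set (Fin n)))
    (y : Fin t → Fin r → Fin n) (B : Finset (Fin n)) (i : Fin t) (g g' : Choice n v t) : Prop :=
  (g' = g ∧ (g i ≠ none ∨ ∀ f, ¬ IsRootedEmb F x E (y i) (free B g) f)) ∨
    (g i = none ∧ ∃ f, IsRootedEmb F x E (y i) (free B g) f ∧ g' = Function.update g i (some f))

/-- The choices that the greedy algorithm can have made when it has completed `j` rounds and
processed `i` roots in the current one. -/
inductive Reach (F : Hypergraph (Fin v)) (x : Fin r → Fin v) (E : Set (Set (Fin n)))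
    (y : Fin t → Fin r → Fin n) (W : Finset (Fin n)) (L : ℕ) : ℕ → ℕ → Choice n v t → Prop
  | zero : Reach F x E y W L 0 0 fun _ => none
  | step {j : ℕ} {i : Fin t} {g g' : Choice n v t} : Reach F x E y W L j i g →
      GreedyStep F x E y (piece W L j) i g g' → Reach F x E y W L j (i + 1) g'
  | next {j : ℕ} {g : Choice n v t} : Reach F x E y W L j t g → Reach F x E y W L (j + 1) 0 g

/-- The number of roots without an embedding. -/
def unmatched (g : Choice n v t) : ℕ := (Finset.univ.filter fun i => g i = none).card

lemma unmatched_le_card (g : Choice n v t) : unmatched g ≤ t :=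
  (Finset.card_le_univ _).trans (Fintype.card_fin t).le

variable {F : Hypergraph (Fin v)} {x : Fin r → Fin v} {E : Set (Set (Fin n))}
  {y : Fin t → Fin r → Fin n} {W : Finset (Fin n)} {L : ℕ}

/-- The chosen embeddings are embeddings into pairwise disjoint sets. -/
def Consistent (F : Hypergraph (Fin v)) (x : Fin r → Fin v) (E : Set (Set (Fin n)))
    (y : Fin t → Fin r → Fin n) (W : Finset (Fin n)) (g : Choice n v t) : Prop :=
  (∀ i f, g i = some f → IsRootedEmb F x E (y i) (↑W) f) ∧
    ∀ i i' f f', i ≠ i' → g i = some f → g i' = some f' → Disjoint (range f) (range f')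

lemma IsRootedEmb.mono {y : Fin r → Fin n} {B B' : Set (Fin n)} {f : Fin v → Fin n}
    (h : IsRootedEmb F x E y B f) (hB : B ⊆ B') : IsRootedEmb F x E y B' f :=
  ⟨h.1, h.2.1, fun u hu => hB (h.2.2.1 u hu), h.2.2.2⟩

lemma IsRootedEmb.mem_range {y : Fin r → Fin n} {B : Set (Fin n)} {f : Fin v → Fin n}
    (h : IsRootedEmb F x E y B f) {a : Fin n} (ha : a ∈ range f) :
    a ∈ range y ∨ ∃ u, u ∉ range x ∧ f u = a ∧ a ∈ B := by
  obtain ⟨u, rfl⟩ := ha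
  by_cases hu : u ∈ range x
  · obtain ⟨l, rfl⟩ := hu
    exact Or.inl ⟨l, (h.2.1 l).symm⟩
  · exact Or.inr ⟨u, hu, rfl, h.2.2.1 u hu⟩

/-- The new copy meets no older one: roots are disjoint from each other and from `W`, and the new
internal vertices are free. -/
lemma Consistent.update (hy : IsRootFamily W y) {g : Choice n v t} (hg : Consistent F x E y W g)
    {B : Finset (Fin n)} (hB : B ⊆ W) {i : Fin t} (hi : g i = none) {f : Fin v → Fin n}
    (hf : IsRootedEmb F x E (y i) (free B g) f) :
    Consistent F x E y W (Function.update g i (some f)) := by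
  have hfW : IsRootedEmb F x E (y i) (↑W) f := hf.mono fun a ha => hB ha.1
  have hdis : ∀ i' f', i' ≠ i → g i' = some f' → Disjoint (range f) (range f') := by
    intro i' f' hne hg'
    rw [Set.disjoint_left]
    intro a ha ha'
    rcases hf.mem_range ha with h1 | ⟨u, -, -, h1⟩
    · rcases (hg.1 i' f' hg').mem_range ha' with h2 | ⟨u, -, -, h2⟩
      · exact Set.disjoint_left.1 (hy.2.2 _ _ hne) h2 h1
      · obtain ⟨l, rfl⟩ := h1
        exact hy.2.1 _ _ h2
    · exact h1.2 i' f' hg' ha'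
  refine ⟨fun i' f' h => ?_, fun i' i'' f' f'' hne h' h'' => ?_⟩
  · by_cases h0 : i' = i
    · subst h0
      rw [Function.update_self, Option.some_inj] at h
      exact h ▸ hfW
    · rw [Function.update_of_ne h0] at h
      exact hg.1 i' f' h
  · by_cases h0 : i' = i
    · subst h0
      rw [Function.update_self, Option.some_inj] at h'
      rw [Function.update_of_ne hne.symm] at h''
      exact h' ▸ hdis _ _ hne.symm h''
    · rw [Function.update_of_ne h0] at h'
      by_cases h1 : i'' = i
      · subst h1
        rw [Function.update_self, Option.some_inj] at h''
        exact h'' ▸ (hdis _ _ h0 h').symm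
      · rw [Function.update_of_ne h1] at h''
        exact hg.2 _ _ _ _ hne h' h''

/-- The state within round `j`, when the choice at the beginning of the round was `g₀` and `m` roots
have been processed. -/
structure InRound (F : Hypergraph (Fin v)) (x : Fin r → Fin v) (E : Set (Set (Fin n)))
    (y : Fin t → Fin r → Fin n) (W : Finset (Fin n)) (L j m : ℕ) (g₀ g : Choice n v t) : Prop where
  consistent : Consistent F x E y W g
  extends_start : ∀ i f, g₀ i = some f → g i = some f
  new_mem : ∀ i f, g i = some f → g₀ i = none → ∀ u, u ∉ range x → f u ∈ piece W L j
  old_notMem : ∀ i f, g₀ i = some f → ∀ u, u ∉ range x → f u ∉ piece W L j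
  maximal : ∀ i : Fin t, (i : ℕ) < m → g i = none →
    ∀ f, ¬ IsRootedEmb F x E (y i) (free (piece W L j) g) f

/-- Maximality persists because the free part only shrinks: a root that had no copy when it was
processed has none later in the round. -/
lemma InRound.step (hy : IsRootFamily W y) {j : ℕ} {i : Fin t} {g₀ g g' : Choice n v t}
    (h : InRound F x E y W L j i g₀ g) (hs : GreedyStep F x E y (piece W L j) i g g') :
    InRound F x E y W L j (i + 1) g₀ g' := by
  rcases hs with ⟨rfl, hno⟩ | ⟨hi, f, hf, rfl⟩
  · refine ⟨h.consistent, h.extends_start, h.new_mem, h.old_notMem, fun i' hi' hn => ?_⟩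
    rcases Nat.lt_succ_iff_lt_or_eq.1 hi' with hlt | heq
    · exact h.maximal i' hlt hn
    · obtain rfl : i' = i := Fin.ext heq
      exact hno.resolve_left (fun h => h hn)
  · have h0 : g₀ i = none := by
      rcases hg0 : g₀ i with - | f0
      · rfl
      · rw [h.extends_start i f0 hg0] at hi; exact absurd hi (by simp)
    have hfree : free (piece W L j) (Function.update g i (some f)) ⊆ free (piece W L j) g := by
      rintro a ⟨ha, ha'⟩
      refine ⟨ha, fun i' f' hg' => ha' i' f' ?_⟩
      rw [Function.update_of_ne, hg']
      rintro rfl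
      rw [hi] at hg'; exact absurd hg' (by simp)
    refine ⟨h.consistent.update hy (Finset.filter_subset _ _) hi hf, fun i' f' hg' => ?_,
      fun i' f' hg' hn u hu => ?_, h.old_notMem, fun i' hi' hn f' hf' => ?_⟩
    · rw [Function.update_of_ne, h.extends_start _ _ hg']
      rintro rfl
      rw [h0] at hg'; exact absurd hg' (by simp)
    · by_cases h1 : i' = i
      · subst h1
        rw [Function.update_self, Option.some_inj] at hg'
        exact hg' ▸ (hf.2.2.1 u hu).1
      · rw [Function.update_of_ne h1] at hg'
        exact h.new_mem i' f' hg' hn u hu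
    · have h1 : i' ≠ i := by
        rintro rfl
        rw [Function.update_self] at hn; exact absurd hn (by simp)
      rw [Function.update_of_ne h1] at hn
      refine h.maximal i' ?_ hn f' (hf'.mono hfree)
      have : (i' : ℕ) ≠ i := fun h => h1 (Fin.ext h)
      omega

open Classical in
/-- The vertices of `B` that are covered by the embeddings of `g`. -/
noncomputable def usedIn (B : Finset (Fin n)) (g : Choice n v t) : Finset (Fin n) :=
  B.filter fun a => a ∉ free B g

lemma mem_usedIn {B : Finset (Fin n)} {g : Choice n v t} {a : Fin n} :
    a ∈ usedIn B g ↔ a ∈ B ∧ ∃ i f, g i = some f ∧ a ∈ range f := by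
  classical
  rw [usedIn, Finset.mem_filter, free, Set.mem_ofPred_eq]
  push Not
  constructor
  · rintro ⟨h1, h2⟩; exact ⟨h1, h2 h1⟩
  · rintro ⟨h1, h2⟩; exact ⟨h1, fun _ => h2⟩

lemma InRound.unmatched_le {j m : ℕ} {g₀ g : Choice n v t} (h : InRound F x E y W L j m g₀ g) :
    unmatched g ≤ unmatched g₀ := by
  refine Finset.card_le_card fun i hi => ?_
  simp only [Finset.mem_filter, Finset.mem_univ, true_and] at hi ⊢
  rcases hg0 : g₀ i with - | f0
  · rfl
  · rw [h.extends_start i f0 hg0] at hi; exact absurd hi (by simp)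

/-- Copies from earlier rounds have no internal vertex in this piece and roots lie outside `W`, so
only roots served in this round use up vertices of the piece. -/
lemma InRound.card_usedIn_le (hx : Function.Injective x) (hy : IsRootFamily W y) {j m : ℕ}
    {g₀ g : Choice n v t} (h : InRound F x E y W L j m g₀ g) :
    (usedIn (piece W L j) g).card ≤ (unmatched g₀ - unmatched g) * (v - r) := by
  classical
  set T := (Finset.univ.filter fun i => g₀ i = none) \ Finset.univ.filter fun i => g i = none
    with hT
  have hsub : (Finset.univ.filter fun i => g i = none) ⊆ Finset.univ.filter fun i => g₀ i = none := by
    intro i hi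
    simp only [Finset.mem_filter, Finset.mem_univ, true_and] at hi ⊢
    rcases hg0 : g₀ i with - | f0
    · rfl
    · rw [h.extends_start i f0 hg0] at hi; exact absurd hi (by simp)
  have hTc : T.card = unmatched g₀ - unmatched g := Finset.card_sdiff_of_subset hsub
  rw [← hTc, ← card_internal hx, ← Finset.card_univ, ← Finset.card_product]
  have hle : (usedIn (piece W L j) g) ⊆
      ((T ×ˢ (Finset.univ : Finset (Internal x))).image fun q => ((g q.1).map fun f => f q.2)).biUnion
        fun o => o.toFinset := by
    intro a ha
    obtain ⟨haB, i, f, hif, ha⟩ := mem_usedIn.1 ha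
    have haW : a ∈ W := Finset.filter_subset _ _ haB
    rcases (h.consistent.1 i f hif).mem_range ha with ⟨l, rfl⟩ | ⟨u, hu, rfl, -⟩
    · exact absurd haW (hy.2.1 _ _)
    · have hi0 : g₀ i = none := by
        rcases hg0 : g₀ i with - | f0
        · rfl
        · have := h.extends_start i f0 hg0
          rw [hif, Option.some_inj] at this
          subst this
          exact absurd haB (h.old_notMem i f hg0 u hu)
      rw [Finset.mem_biUnion]
      refine ⟨some (f u), Finset.mem_image.2 ⟨(i, ⟨u, hu⟩), ?_, by simp [hif]⟩, by simp⟩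
      simp [hT, hi0, hif]
  refine (Finset.card_le_card hle).trans (Finset.card_biUnion_le.trans ?_)
  refine (Finset.sum_le_card_nsmul _ _ 1 fun (o : Option (Fin n)) _ => ?_).trans ?_
  · rcases o with - | a <;> simp
  · rw [smul_eq_mul, mul_one]
    exact Finset.card_image_le

/-- This puts a set of used vertices into the list format of `Good`. A list of positive length has
nonempty image, hence the `1` when `U` is empty. -/
lemma exists_cover_fun {m : ℕ} (U B : Finset (Fin n)) (hB : B.Nonempty) (hU : U.card ≤ m)
    (hm : 0 < m) : ∃ z : Fin m → Fin n, U ⊆ Finset.univ.image z ∧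
      (Finset.univ.image z).card ≤ max 1 U.card := by
  obtain ⟨b, hb⟩ := hB
  obtain ⟨U', hU', hUU', hne, hc⟩ : ∃ U' : Finset (Fin n), U'.card ≤ m ∧ U ⊆ U' ∧ U'.Nonempty ∧
      U'.card ≤ max 1 U.card := by
    rcases U.eq_empty_or_nonempty with rfl | h
    · exact ⟨{b}, by simpa using Nat.succ_le_of_lt hm, by simp, by simp, by simp⟩
    · exact ⟨U, hU, le_rfl, h, le_max_right _ _⟩
  have : Nonempty {a // a ∈ U'} := hne.to_subtype
  obtain ⟨e⟩ : Nonempty ({a // a ∈ U'} ↪ Fin m) := by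
    rw [Function.Embedding.nonempty_iff_card_le]; simpa using hU'
  have hsurj := Function.invFun_surjective e.injective
  have him : Finset.univ.image (fun q => ((Function.invFun e q : {a // a ∈ U'}) : Fin n)) = U' := by
    ext a
    simp only [Finset.mem_image, Finset.mem_univ, true_and]
    constructor
    · rintro ⟨q, rfl⟩; exact (Function.invFun e q).2
    · intro ha
      obtain ⟨q, hq⟩ := hsurj ⟨a, ha⟩
      exact ⟨q, by rw [hq]⟩
  exact ⟨_, him.symm ▸ hUU', him.symm ▸ hc⟩

/-- Otherwise fewer roots were served in this round than remain. The used vertices then fit into a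
list of length `s * v`, and `Good` yields a copy at an unmatched root in the free part,
contradicting maximality. -/
lemma InRound.halves (hv : 1 ≤ v) (hG : Good F x W L E) (hy : IsRootFamily W y)
    (hx : Function.Injective x) {j : ℕ} (hj : j < L) (hw : 2 * v ≤ (piece W L j).card)
    {g₀ g : Choice n v t} (h : InRound F x E y W L j t g₀ g)
    (hU : 2 * (usedIn (piece W L j) g).card ≤ (piece W L j).card) :
    2 * unmatched g ≤ unmatched g₀ := by
  classical
  by_contra! hcon
  set B := piece W L j with hB
  set U := usedIn B g with hUdef
  -- The truncation ensures `s * v ≤ |B|`. When it is active, `s * v` is still at least `|B| / 2`,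
  -- hence at least `|U|`.
  set s := min (unmatched g) (B.card / v) with hs
  have hle := h.unmatched_le
  have hUc := h.card_usedIn_le hx hy
  have hdiv := Nat.div_mul_le_self B.card v
  have hdiv' := Nat.lt_div_mul_add (a := B.card) (by omega : 0 < v)
  have hdiv2 : 2 ≤ B.card / v := (Nat.le_div_iff_mul_le (by omega)).2 hw
  have hs0 : 0 < s := by rw [hs]; omega
  have hsv : s * v ≤ B.card := (Nat.mul_le_mul_right v (min_le_right _ _)).trans hdiv
  have hUs : U.card ≤ s * v := by
    rcases le_total (unmatched g) (B.card / v) with h1 | h1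
    · rw [hs, min_eq_left h1]
      refine hUc.trans ?_
      exact Nat.mul_le_mul (by omega) (Nat.sub_le _ _)
    · rw [hs, min_eq_right h1]; omega
  have hBne : B.Nonempty := Finset.card_pos.1 (by omega)
  obtain ⟨z, hUz, hz⟩ := exists_cover_fun U B hBne hUs (Nat.mul_pos hs0 (by omega))
  have hz2 : 2 * (B ∩ Finset.univ.image z).card ≤ B.card := by
    have h1 : (B ∩ Finset.univ.image z).card ≤ (Finset.univ.image z).card :=
      Finset.card_le_card Finset.inter_subset_right
    rcases le_total 1 U.card with h2 | h2
    · rw [max_eq_right h2] at hz; omega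
    · rw [max_eq_left h2] at hz; omega
  obtain ⟨T, hTsub, hTc⟩ := Finset.exists_subset_card_eq (min_le_left (unmatched g) (B.card / v))
  have hTc : T.card = s := hTc
  set c := T.orderEmbOfFin hTc with hc
  have hcT : ∀ q, g (c q) = none := fun q => by
    have := hTsub (Finset.orderEmbOfFin_mem T hTc q)
    simpa using this
  obtain ⟨q, f, hf⟩ := hG j hj s hs0 (fun q => y (c q))
    ⟨fun q => hy.1 _, fun q => hy.2.1 _, fun q q' hne => hy.2.2 _ _ (c.injective.ne hne)⟩ z hsv hz2
  refine h.maximal (c q) (c q).2 (hcT q) f (hf.mono fun a ha => ?_)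
  rw [Finset.mem_coe, Finset.mem_sdiff] at ha
  refine ⟨ha.1, fun i' f' hg' har => ha.2 (hUz (mem_usedIn.2 ⟨ha.1, i', f', hg', har⟩))⟩

/-- The state between two rounds: after `j` rounds, `b` of which used more than half of their
piece. -/
structure Between (F : Hypergraph (Fin v)) (x : Fin r → Fin v) (E : Set (Set (Fin n)))
    (y : Fin t → Fin r → Fin n) (W : Finset (Fin n)) (L w j : ℕ) (g : Choice n v t) : Prop where
  consistent : Consistent F x E y W g
  mem_piece : ∀ i f, g i = some f → ∃ j' < j, ∀ u, u ∉ range x → f u ∈ piece W L j'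
  bound : ∃ b ≤ j, b * w ≤ 2 * ((t - unmatched g) * (v - r)) ∧ unmatched g * 2 ^ (j - b) ≤ t

lemma Between.inRound {w j : ℕ} {g : Choice n v t} (h : Between F x E y W L w j g) :
    InRound F x E y W L j 0 g g := by
  refine ⟨h.consistent, fun _ _ h => h, fun i f h1 h2 => ?_, fun i f hif u hu hm => ?_,
    fun i hi => absurd hi (by omega)⟩
  · rw [h1] at h2; exact absurd h2 (by simp)
  · obtain ⟨j', hj', hmem⟩ := h.mem_piece i f hif
    have h1 := (Finset.mem_filter.1 (hmem u hu)).2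
    have h2 := (Finset.mem_filter.1 hm).2
    omega

/-- A round that uses at most half of its piece halves the number of unmatched roots. Any other
round increments `b` and is charged to more than `w / 2` newly used vertices. -/
lemma Between.next (hv : 1 ≤ v) (hG : Good F x W L E) (hy : IsRootFamily W y)
    (hx : Function.Injective x) {w j : ℕ} (hj : j < L) (hwv : 2 * v ≤ w)
    (hw : w ≤ (piece W L j).card) {g₀ g : Choice n v t} (h₀ : Between F x E y W L w j g₀)
    (h : InRound F x E y W L j t g₀ g) : Between F x E y W L w (j + 1) g := by
  refine ⟨h.consistent, fun i f hif => ?_, ?_⟩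
  · rcases hg0 : g₀ i with - | f0
    · exact ⟨j, by omega, h.new_mem i f hif hg0⟩
    · have := h.extends_start i f0 hg0
      rw [hif, Option.some_inj] at this
      subst this
      obtain ⟨j', hj', hm⟩ := h₀.mem_piece i f hg0
      exact ⟨j', by omega, hm⟩
  · obtain ⟨b, hbj, hb1, hb2⟩ := h₀.bound
    have hle := h.unmatched_le
    have hle' : unmatched g₀ ≤ t := unmatched_le_card g₀
    have hUc := h.card_usedIn_le hx hy
    have e1 : (t - unmatched g) * (v - r) =
        (t - unmatched g₀) * (v - r) + (unmatched g₀ - unmatched g) * (v - r) := by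
      rw [← add_mul]; congr 1; omega
    by_cases hU : 2 * (usedIn (piece W L j) g).card ≤ (piece W L j).card
    · have h2 := h.halves hv hG hy hx hj (by omega) hU
      refine ⟨b, by omega, by omega, ?_⟩
      have : j + 1 - b = (j - b) + 1 := by omega
      rw [this, pow_succ]
      calc unmatched g * (2 ^ (j - b) * 2) = (2 * unmatched g) * 2 ^ (j - b) := by ring
        _ ≤ unmatched g₀ * 2 ^ (j - b) := Nat.mul_le_mul_right _ h2
        _ ≤ t := hb2
    · refine ⟨b + 1, by omega, ?_, ?_⟩
      · rw [add_mul, one_mul]; omega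
      · rw [Nat.add_sub_add_right]
        exact (Nat.mul_le_mul_right _ hle).trans hb2

/-- After `L` rounds, a single remaining root would give `2 ^ (L - b) ≤ t`, against `hL`. No way of
selecting copies is prescribed, so this covers every greedy run. -/
theorem reach_complete (hv : 1 ≤ v) (hG : Good F x W L E) (hy : IsRootFamily W y)
    (hx : Function.Injective x) {w : ℕ} (hwv : 2 * v ≤ w)
    (hw : ∀ j < L, w ≤ (piece W L j).card)
    (hL : ∀ b ≤ L, b * w ≤ 2 * (t * (v - r)) → t < 2 ^ (L - b))
    {g : Choice n v t} (hg : Reach F x E y W L L 0 g) :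
    Consistent F x E y W g ∧ ∀ i, g i ≠ none := by
  have key : ∀ j m g, Reach F x E y W L j m g → (j < L ∨ (j = L ∧ m = 0)) →
      ∃ g₀, Between F x E y W L w j g₀ ∧ InRound F x E y W L j m g₀ g := by
    intro j m g hr
    induction hr with
    | zero =>
      intro _
      have : Between F x E y W L w 0 (fun _ : Fin t => (none : Option (Fin v → Fin n))) := by
        refine ⟨⟨fun i f h => absurd h (by simp), fun i i' f f' _ h => absurd h (by simp)⟩,
          fun i f h => absurd h (by simp), 0, le_rfl, by simp, ?_⟩
        simpa using unmatched_le_card _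
      exact ⟨_, this, this.inRound⟩
    | step _ hs ih =>
      intro hjL
      obtain ⟨g₀, h1, h2⟩ := ih (Or.inl (by omega))
      exact ⟨g₀, h1, h2.step hy hs⟩
    | @next j g _ ih =>
      intro hjL
      have hj : j < L := by omega
      obtain ⟨g₀, h1, h2⟩ := ih (Or.inl hj)
      have := h1.next hv hG hy hx hj hwv (hw j hj) h2
      exact ⟨_, this, this.inRound⟩
  obtain ⟨g₀, h1, h2⟩ := key L 0 g hg (Or.inr ⟨rfl, rfl⟩)
  refine ⟨h2.consistent, ?_⟩
  obtain ⟨b, hbL, hb1, hb2⟩ := h1.bound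
  have hle := h2.unmatched_le
  have hlt := hL b hbL (hb1.trans (by
    refine Nat.mul_le_mul_left _ (Nat.mul_le_mul_right _ (Nat.sub_le _ _))))
  have h0 : unmatched g = 0 := by
    by_contra hne
    have : 1 * 2 ^ (L - b) ≤ unmatched g₀ * 2 ^ (L - b) := Nat.mul_le_mul_right _ (by omega)
    omega
  intro i hi
  have : i ∈ (Finset.univ.filter fun i => g i = none) := by simpa using hi
  rw [Finset.card_eq_zero.1 h0] at this
  simp at this

/-! ### From embeddings to a matching -/

/-- The image of `F` under `f`. -/
def imageGraph (F : Hypergraph (Fin v)) (f : Fin v → Fin n) : Hypergraph (Fin n) where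
  vertexSet := range f
  edgeSet := (fun e => f '' e) '' F.edgeSet
  subset_vertexSet_of_mem_edgeSet' := by
    rintro _ ⟨e, -, rfl⟩
    exact image_subset_range f e

lemma isIso_imageGraph (hV : F.vertexSet = univ) {f : Fin v → Fin n} (hf : Function.Injective f) :
    IsIso F (imageGraph F f) f := by
  refine ⟨?_, fun e _ => ?_⟩
  · have : (imageGraph F f).vertexSet = f '' univ := image_univ.symm
    rw [hV, this]
    exact hf.injOn.bijOn_image
  · constructor
    · rintro ⟨e', he', h⟩
      rwa [← Set.image_injective.2 hf h]
    · exact fun h => ⟨e, h, rfl⟩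

lemma isMatching_imageGraph (hV : F.vertexSet = univ) {f : Fin t → Fin v → Fin n}
    (hf : ∀ i, IsRootedEmb F x E (y i) (↑W) (f i))
    (hd : ∀ i j, i ≠ j → Disjoint (range (f i)) (range (f j))) :
    IsMatching (ofEdges E) F x y (fun i => imageGraph F (f i)) ∧
      InternalIn y (fun i => imageGraph F (f i)) (↑W) := by
  refine ⟨⟨fun i => ⟨⟨subset_univ _, ?_⟩, f i, isIso_imageGraph hV (hf i).1, (hf i).2.1⟩, hd⟩,
    fun i => ?_⟩
  · rintro _ ⟨e, he, rfl⟩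
    exact (hf i).2.2.2 e he
  · rintro a ⟨ha, hay⟩
    rcases (hf i).mem_range ha with h | ⟨-, -, -, h⟩
    · exact absurd h hay
    · exact h

end Greedy

/-! ### A Hoare logic for total correctness with running times -/

/-- The contribution of the commands of a program to the bound for its running time. -/
def Prog.size : Prog → ℕ
  | .skip => 1
  | .assign _ i e => i.cost + e.cost + 1
  | .seq P Q => P.size + Q.size
  | .ite e P Q => e.cost + 1 + (P.size + Q.size)
  | .loop e P => 2 * (e.cost + 1) + P.size

/-- The nesting depth of the loops. -/
def Prog.depth : Prog → ℕ
  | .skip => 0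
  | .assign _ _ _ => 0
  | .seq P Q => max P.depth Q.depth
  | .ite _ P Q => max P.depth Q.depth
  | .loop _ P => P.depth + 1

/-- Started in `s`, the program halts in a memory with the property `Q`, within the time that it
needs at most if each loop is iterated at most `Z` times. -/
def Comp (Z : ℕ) (P : Prog) (s : Store) (Q : Store → Prop) : Prop :=
  ∃ m s', Runs P s m s' ∧ m ≤ P.size * Z ^ P.depth ∧ Q s'

section Rules

variable {Z : ℕ} {P P' : Prog} {s : Store} {Q R : Store → Prop}

lemma Comp.mono (h : Comp Z P s R) (hQ : ∀ s', R s' → Q s') : Comp Z P s Q := by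
  obtain ⟨m, s', h1, h2, h3⟩ := h
  exact ⟨m, s', h1, h2, hQ _ h3⟩

lemma Comp.skip (h : Q s) : Comp Z .skip s Q :=
  ⟨1, s, .skip s, by simp [Prog.size, Prog.depth], h⟩

lemma Comp.assign {a : ℕ} {i e : Expr} (h : Q (write s a (i.eval s) (e.eval s))) :
    Comp Z (.assign a i e) s Q :=
  ⟨_, _, .assign a i e s, by simp [Prog.size, Prog.depth], h⟩

lemma Comp.seq (hZ : 1 ≤ Z) (h : Comp Z P s fun s' => Comp Z P' s' Q) :
    Comp Z (.seq P P') s Q := by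
  obtain ⟨m, s', h1, h2, m', s'', h1', h2', h3⟩ := h
  refine ⟨_, _, .seq h1 h1', ?_, h3⟩
  rw [Prog.size, Prog.depth, add_mul]
  refine add_le_add (h2.trans (Nat.mul_le_mul_left _ ?_)) (h2'.trans (Nat.mul_le_mul_left _ ?_))
  · exact Nat.pow_le_pow_right hZ (le_max_left _ _)
  · exact Nat.pow_le_pow_right hZ (le_max_right _ _)

lemma Comp.ite (hZ : 1 ≤ Z) {e : Expr} (h1 : e.eval s ≠ 0 → Comp Z P s Q)
    (h2 : e.eval s = 0 → Comp Z P' s Q) : Comp Z (.ite e P P') s Q := by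
  have hpow : ∀ d, 1 ≤ Z ^ d := fun d => Nat.one_le_pow _ _ hZ
  by_cases he : e.eval s = 0
  · obtain ⟨m, s', h1, h2, h3⟩ := h2 he
    refine ⟨_, _, .ite_false he h1, ?_, h3⟩
    rw [Prog.size, Prog.depth, add_mul, add_mul P.size]
    have := h2.trans (Nat.mul_le_mul_left P'.size (Nat.pow_le_pow_right hZ (le_max_right P.depth _)))
    have := Nat.le_mul_of_pos_right (e.cost + 1) (hpow (max P.depth P'.depth))
    linarith [Nat.zero_le (P.size * Z ^ max P.depth P'.depth),
      Nat.zero_le (P'.size * Z ^ max P.depth P'.depth)]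
  · obtain ⟨m, s', h1, h2, h3⟩ := h1 he
    refine ⟨_, _, .ite_true he h1, ?_, h3⟩
    rw [Prog.size, Prog.depth, add_mul, add_mul P.size]
    have := h2.trans (Nat.mul_le_mul_left P.size (Nat.pow_le_pow_right hZ (le_max_left _ P'.depth)))
    have := Nat.le_mul_of_pos_right (e.cost + 1) (hpow (max P.depth P'.depth))
    linarith [Nat.zero_le (P.size * Z ^ max P.depth P'.depth),
      Nat.zero_le (P'.size * Z ^ max P.depth P'.depth)]

/-- The invariant is indexed by the number of completed iterations, so termination and the iteration
count come with it. -/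
lemma Comp.loop (hZ : 1 ≤ Z) {e : Expr} {N : ℕ} (hN : N ≤ Z) (I : ℕ → Store → Prop) (h0 : I 0 s)
    (hstep : ∀ q < N, ∀ s, I q s → e.eval s ≠ 0 ∧ Comp Z P s (I (q + 1)))
    (hend : ∀ s, I N s → e.eval s = 0) (hQ : ∀ s, I N s → Q s) : Comp Z (.loop e P) s Q := by
  have key : ∀ d q s, q + d = N → I q s → ∃ m s', Runs (.loop e P) s m s' ∧
      m ≤ d * (e.cost + 1 + P.size * Z ^ P.depth) + (e.cost + 1) ∧ Q s' := by
    intro d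
    induction d with
    | zero =>
      intro q s hq hI
      obtain rfl : q = N := hq
      exact ⟨_, _, .loop_false (hend s hI), by simp, hQ s hI⟩
    | succ d ih =>
      intro q s hq hI
      obtain ⟨he, m, s', hr, hm, hI'⟩ := hstep q (by omega) s hI
      obtain ⟨m', s'', hr', hm', hQ'⟩ := ih (q + 1) s' (by omega) hI'
      refine ⟨_, _, .loop_true he hr hr', ?_, hQ'⟩
      rw [add_mul, one_mul]; omega
  obtain ⟨m, s', h1, h2, h3⟩ := key N 0 s (zero_add N) h0
  refine ⟨m, s', h1, h2.trans ?_, h3⟩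
  rw [Prog.size, Prog.depth]
  have hp : 1 ≤ Z ^ P.depth := Nat.one_le_pow _ _ hZ
  have e1 : N * (e.cost + 1 + P.size * Z ^ P.depth) ≤
      Z * ((e.cost + 1) * Z ^ P.depth + P.size * Z ^ P.depth) :=
    Nat.mul_le_mul hN (by gcongr; exact Nat.le_mul_of_pos_right _ hp)
  -- The final failing test; it accounts for the factor `2` in `Prog.size`.
  have e2 : e.cost + 1 ≤ (e.cost + 1) * Z ^ (P.depth + 1) :=
    Nat.le_mul_of_pos_right _ (Nat.one_le_pow _ _ hZ)
  calc _ ≤ Z * ((e.cost + 1) * Z ^ P.depth + P.size * Z ^ P.depth) +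
        (e.cost + 1) * Z ^ (P.depth + 1) := add_le_add e1 e2
    _ = _ := by ring

end Rules

/-! ### Variables, counting loops and arithmetic without multiplication -/

/-- The value of the variable `a`, which is kept at position `0` of the array `a`. -/
abbrev var (a : ℕ) : Expr := .get a (.lit 0)

/-- Assignment to a variable. -/
abbrev setVar (a : ℕ) (e : Expr) : Prog := .assign a (.lit 0) e

/-- The loop over all values of the variable `i` below the value of `e`. -/
def forLoop (i : ℕ) (e : Expr) (P : Prog) : Prog :=
  .seq (setVar i (.lit 0))
    (.loop (.sub e (var i)) (.seq P (setVar i (.add (var i) (.lit 1)))))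

@[simp] lemma write_self (s : Store) (a q c : ℕ) : write s a q c a = Function.update (s a) q c := by
  simp [write]

lemma write_of_ne (s : Store) {a b : ℕ} (q c : ℕ) (h : b ≠ a) : write s a q c b = s b := by
  simp [write, h]

lemma write_apply (s : Store) (a q c b p : ℕ) :
    write s a q c b p = if b = a then (if p = q then c else s b p) else s b p := by
  by_cases h : b = a
  · subst h; simp [Function.update_apply]
  · simp [write_of_ne _ _ _ h, h]

/-- The memories `s` and `s'` agree on the arrays below `m`. -/
def Frame (m : ℕ) (s s' : Store) : Prop := ∀ b < m, s' b = s b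

lemma Frame.refl (m : ℕ) (s : Store) : Frame m s s := fun _ _ => rfl

lemma Frame.trans {m : ℕ} {s s' s'' : Store} (h : Frame m s s') (h' : Frame m s' s'') :
    Frame m s s'' := fun b hb => (h' b hb).trans (h b hb)

lemma Frame.mono {m m' : ℕ} {s s' : Store} (h : Frame m s s') (hm : m' ≤ m) : Frame m' s s' :=
  fun b hb => h b (hb.trans_le hm)

lemma Frame.write {m : ℕ} {s s' : Store} (h : Frame m s s') {a : ℕ} (ha : m ≤ a) (q c : ℕ) :
    Frame m s (write s' a q c) := fun b hb => by
  rw [write_of_ne _ _ _ (by omega), h b hb]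

section Rules

variable {Z : ℕ} {P : Prog} {s : Store} {Q : Store → Prop}

/-- The bound `e` is re-evaluated before each iteration, so the invariant must keep its value equal
to `N`. The body must restore the counter. -/
lemma Comp.forLoop (hZ : 1 ≤ Z) {i : ℕ} {e : Expr} {N : ℕ} (hN : N ≤ Z) (I : ℕ → Store → Prop)
    (h0 : I 0 (write s i 0 0))
    (he : ∀ q ≤ N, ∀ s, I q s → s i 0 = q → e.eval s = N)
    (hstep : ∀ q < N, ∀ s, I q s → s i 0 = q →
      Comp Z P s fun s' => s' i 0 = q ∧ I (q + 1) (write s' i 0 (q + 1)))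
    (hQ : ∀ s, I N s → s i 0 = N → Q s) : Comp Z (forLoop i e P) s Q := by
  refine Comp.seq hZ (Comp.assign ?_)
  refine Comp.loop hZ hN (fun q s => I q s ∧ s i 0 = q) ⟨h0, by simp [Expr.eval]⟩ ?_ ?_ ?_
  · rintro q hq s ⟨hI, hi⟩
    refine ⟨?_, Comp.seq hZ ((hstep q hq s hI hi).mono ?_)⟩
    · simp only [Expr.eval, he q hq.le s hI hi, hi]; omega
    · rintro s' ⟨hi', hI'⟩
      refine Comp.assign ?_
      simp only [Expr.eval, hi']
      exact ⟨hI', by simp⟩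
  · rintro s ⟨hI, hi⟩
    simp only [Expr.eval, he N le_rfl s hI hi, hi]; omega
  · rintro s ⟨hI, hi⟩
    exact hQ s hI hi

/-- Adding the value of `e'` to the variable `a` as many times as `e` says. -/
def addMul (a i : ℕ) (e e' : Expr) : Prog := forLoop i e (setVar a (.add (var a) e'))

lemma Comp.addMul (hZ : 1 ≤ Z) {a i : ℕ} (hai : a < i) {e e' : Expr} {N V : ℕ}
    (hN : N ≤ Z)
    (he : ∀ s', Frame a s s' → (∀ b, a < b → b < i → s' b = s b) → e.eval s' = N)
    (he' : ∀ s', Frame a s s' → (∀ b, a < b → b < i → s' b = s b) → e'.eval s' = V)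
    (hQ : ∀ s', Frame a s s' → (∀ b, a < b → b < i → s' b = s b) → s' a 0 = s a 0 + N * V → Q s') :
    Comp Z (addMul a i e e') s Q := by
  refine Comp.forLoop hZ hN (fun q s' => Frame a s s' ∧ (∀ b, a < b → b < i → s' b = s b) ∧
    s' a 0 = s a 0 + q * V) ?_ ?_ ?_ ?_
  · refine ⟨(Frame.refl a s).write hai.le 0 0, fun b _ hb => write_of_ne _ _ _ hb.ne, ?_⟩
    rw [write_of_ne _ _ _ hai.ne]; simp
  · rintro q - s' ⟨hf, hb, -⟩ -
    exact he s' hf hb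
  · rintro q - s' ⟨hf, hb, ha⟩ hi
    refine Comp.assign ⟨?_, (hf.write le_rfl _ _).write hai.le _ _, fun b h1 h2 => ?_, ?_⟩
    · rw [write_of_ne _ _ _ hai.ne', hi]
    · rw [write_of_ne _ _ _ h2.ne, write_of_ne _ _ _ h1.ne', hb b h1 h2]
    · rw [write_of_ne _ _ _ hai.ne]
      simp only [Expr.eval, write_self, Function.update_self, ha, he' s' hf hb]
      ring
  · rintro s' ⟨hf, hb, ha⟩ -
    exact hQ s' hf hb ha

/-- The power `e ^ e'`, computed into the variable `m`. -/
def powProg (m : ℕ) (e e' : Expr) : Prog :=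
  .seq (setVar m (.lit 1)) (forLoop (m + 2) e' (.seq (setVar (m + 1) (.lit 0))
    (.seq (addMul (m + 1) (m + 3) e (var m)) (setVar m (var (m + 1))))))

lemma Comp.powProg (hZ : 1 ≤ Z) {m : ℕ} {e e' : Expr} {N V : ℕ}
    (hN : N ≤ Z) (hV : V ≤ Z) (he : ∀ s', Frame m s s' → e.eval s' = N)
    (he' : ∀ s', Frame m s s' → e'.eval s' = V)
    (hQ : ∀ s', Frame m s s' → s' m 0 = N ^ V → Q s') :
    Comp Z (powProg m e e') s Q := by
  refine Comp.seq hZ (Comp.assign ?_)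
  refine Comp.forLoop hZ hV (fun q s' => Frame m s s' ∧ s' m 0 = N ^ q) ?_ ?_ ?_ ?_
  · exact ⟨((Frame.refl m s).write le_rfl _ _).write (by omega) _ _,
      by simp [write_apply, Expr.eval]⟩
  · rintro q - s' ⟨hf, -⟩ -
    exact he' s' hf
  · rintro q - s' ⟨hf, hm⟩ hi
    refine Comp.seq hZ (Comp.assign (Comp.seq hZ ?_))
    have hf1 := hf.write (le_refl m |>.trans (Nat.le_succ m)) ((Expr.lit 0).eval s') ((Expr.lit 0).eval s')
    refine Comp.addMul hZ (V := N ^ q) (by omega) hN (fun s'' h _ => ?_) (fun s'' h _ => ?_) ?_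
    · exact he s'' (hf1.trans (h.mono (by omega)))
    · simp only [Expr.eval]
      rw [h m (by omega)]
      simp [write_apply, hm]
    · intro s'' h hb h1
      have h2 := hb (m + 2) (by omega) (by omega)
      refine Comp.assign ⟨?_, ?_, ?_⟩
      · simp [write_apply, h2, hi]
      · exact ((hf1.trans (h.mono (by omega))).write le_rfl _ _).write (by omega) _ _
      · simp [write_apply, Expr.eval] at h1 ⊢
        rw [h1, pow_succ, mul_comm]
  · rintro s' ⟨hf, hm⟩ -
    exact hQ s' hf hm

/-- The digits of the value of `e` in base `b`, written into the first `l` cells of the array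
`m`. -/
def digitsProg (m : ℕ) (e b l : Expr) : Prog :=
  .seq (setVar (m + 1) e) (forLoop (m + 3) l (.seq (setVar (m + 2) (var (m + 1)))
    (.seq (setVar (m + 1) (.lit 0))
      (.seq (.loop (.sub (.add (var (m + 2)) (.lit 1)) b)
        (.seq (setVar (m + 2) (.sub (var (m + 2)) b)) (setVar (m + 1) (.add (var (m + 1)) (.lit 1)))))
        (.assign m (var (m + 3)) (var (m + 2)))))))

lemma Comp.digitsProg (hZ : 1 ≤ Z) {m : ℕ} {e b l : Expr} {N B L : ℕ}
    (hN : N ≤ Z) (hL : L ≤ Z) (hB : 0 < B) (he : e.eval s = N)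
    (hb : ∀ s', Frame m s s' → b.eval s' = B) (hl : ∀ s', Frame m s s' → l.eval s' = L)
    (hQ : ∀ s', Frame m s s' → (∀ u < L, s' m u = N / B ^ u % B) → Q s') :
    Comp Z (digitsProg m e b l) s Q := by
  refine Comp.seq hZ (Comp.assign ?_)
  refine Comp.forLoop hZ hL (fun q s' => Frame m s s' ∧ s' (m + 1) 0 = N / B ^ q ∧
    ∀ u < q, s' m u = N / B ^ u % B) ?_ ?_ ?_ ?_
  · refine ⟨((Frame.refl m s).write (by omega) _ _).write (by omega) _ _, ?_, by simp⟩
    simp [write_apply, Expr.eval, he]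
  · rintro q - s' ⟨hf, -⟩ -
    exact hl s' hf
  · rintro q - s' ⟨hf, hm, hd⟩ hi
    refine Comp.seq hZ (Comp.assign (Comp.seq hZ (Comp.assign (Comp.seq hZ ?_))))
    set X := N / B ^ q with hX
    have hXZ : X / B ≤ Z := (Nat.div_le_self _ _).trans ((Nat.div_le_self _ _).trans hN)
    -- Division with remainder by repeated subtraction. With truncated subtraction, the remainder
    -- plus one minus `B` is nonzero exactly when the remainder is at least `B`.
    refine Comp.loop hZ hXZ (fun a s'' => Frame m s s'' ∧ s'' (m + 1) 0 = a ∧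
      s'' (m + 2) 0 = X - a * B ∧ s'' (m + 3) 0 = q ∧ ∀ u < q, s'' m u = N / B ^ u % B)
      ?_ ?_ ?_ ?_
    · refine ⟨(hf.write (by omega) _ _).write (by omega) _ _, ?_⟩
      simpa [write_apply, Expr.eval, hm, hi] using hd
    · rintro a ha s'' ⟨hf', h1, h2, h3, h4⟩
      have haB : (a + 1) * B ≤ X := (Nat.mul_le_mul_right B ha).trans (Nat.div_mul_le_self X B)
      rw [add_mul, one_mul] at haB
      refine ⟨?_, Comp.seq hZ (Comp.assign (Comp.assign
        ⟨(hf'.write (by omega) _ _).write (by omega) _ _, ?_⟩))⟩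
      · simp only [Expr.eval, h2, hb s'' hf']; omega
      · simp [write_apply, Expr.eval, h1, h2, h3, hb s'' hf']
        refine ⟨?_, h4⟩
        rw [add_mul, one_mul]; omega
    · rintro s'' ⟨hf', h1, h2, h3, h4⟩
      have := Nat.div_add_mod X B
      have hlt := Nat.mod_lt X hB
      have : X - X / B * B = X % B := by rw [mul_comm]; omega
      simp only [Expr.eval, h2, hb s'' hf', this]; omega
    · rintro s'' ⟨hf', h1, h2, h3, h4⟩
      have hmod : X - X / B * B = X % B := by
        have := Nat.div_add_mod X B
        rw [mul_comm]; omega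
      refine Comp.assign ⟨?_, (hf'.write le_rfl _ _).write (by omega) _ _, ?_, ?_⟩
      · simp [write_apply, Expr.eval, h3]
      · simp [write_apply, Expr.eval, h1]
        rw [hX, Nat.div_div_eq_div_mul, pow_succ]
      · intro u hu
        simp only [write_apply, Expr.eval, h3, h2, hmod]
        rw [if_neg (by omega), if_pos trivial]
        split_ifs with h5
        · rw [h5]
        · exact h4 u (by omega)
  · rintro s' ⟨hf, -, hd⟩ -
    exact hQ s' hf hd

/-- The number whose digit at position `q` in base `b` is the value of `e` in a memory with `q` in
the variable `m + 2`, computed into the variable `m`. -/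
def indexProg (m : ℕ) (e b l : Expr) : Prog :=
  .seq (setVar m (.lit 0)) (.seq (setVar (m + 1) (.lit 1)) (forLoop (m + 2) l
    (.seq (addMul m (m + 3) e (var (m + 1))) (.seq (setVar (m + 3) (.lit 0))
      (.seq (addMul (m + 3) (m + 4) b (var (m + 1))) (setVar (m + 1) (var (m + 3))))))))

/-- The variable `m + 1` carries the current power of `B`. The loop counts are the digits and the
base, never the powers. -/
lemma Comp.indexProg (hZ : 1 ≤ Z) {m : ℕ} {e b l : Expr} {B L : ℕ} {f : ℕ → ℕ}
    (hf : ∀ q < L, f q ≤ Z) (hL : L ≤ Z) (hB : B ≤ Z)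
    (he : ∀ s' q, q < L → Frame m s s' → s' (m + 2) 0 = q → e.eval s' = f q)
    (hb : ∀ s', Frame m s s' → b.eval s' = B) (hl : ∀ s', Frame m s s' → l.eval s' = L)
    (hQ : ∀ s', Frame m s s' → s' m 0 = ∑ q ∈ Finset.range L, f q * B ^ q → Q s') :
    Comp Z (indexProg m e b l) s Q := by
  refine Comp.seq hZ (Comp.assign (Comp.seq hZ (Comp.assign ?_)))
  refine Comp.forLoop hZ hL (fun q s' => Frame m s s' ∧ s' (m + 1) 0 = B ^ q ∧
    s' m 0 = ∑ q ∈ Finset.range q, f q * B ^ q) ?_ ?_ ?_ ?_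
  · refine ⟨(((Frame.refl m s).write le_rfl _ _).write (by omega) _ _).write (by omega) _ _, ?_⟩
    simp [write_apply, Expr.eval]
  · rintro q - s' ⟨hf, -⟩ -
    exact hl s' hf
  · rintro q hq s' ⟨hfr, h1, h2⟩ hi
    refine Comp.seq hZ (Comp.addMul hZ (by omega) (hf q hq) (fun s'' h hb' => ?_)
      (fun s'' h hb' => ?_) (V := B ^ q) fun s₁ g₁ k₁ e₁ => ?_)
    · refine he s'' q hq (hfr.trans h) ?_
      rw [hb' (m + 2) (by omega) (by omega), hi]
    · simp only [Expr.eval]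
      rw [hb' (m + 1) (by omega) (by omega), h1]
    · have k2 := k₁ (m + 1) (by omega) (by omega)
      have k3 := k₁ (m + 2) (by omega) (by omega)
      refine Comp.seq hZ (Comp.assign (Comp.seq hZ ?_))
      have g₂ := (hfr.trans g₁).write (by omega : m ≤ m + 3) ((Expr.lit 0).eval s₁)
        ((Expr.lit 0).eval s₁)
      refine Comp.addMul hZ (by omega) hB (fun s'' h _ => hb _ (g₂.trans (h.mono (by omega))))
        (fun s'' h _ => ?_) (V := B ^ q) fun s₂ g₃ _ e₂ => ?_
      · simp only [Expr.eval]
        rw [h (m + 1) (by omega)]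
        simp [write_apply, k2, h1]
      · have k4 := g₃ (m + 1) (by omega)
        have k5 := g₃ (m + 2) (by omega)
        have k6 := g₃ m (by omega)
        refine Comp.assign ⟨?_, ((g₂.trans (g₃.mono (by omega))).write (by omega) _ _).write
          (by omega) _ _, ?_, ?_⟩
        · simp [write_apply, k5, k3, hi]
        · simp [write_apply, Expr.eval] at e₂ ⊢
          rw [e₂, pow_succ, mul_comm]
        · simp [write_apply, k6, e₁, h2, Finset.sum_range_succ]
  · rintro s' ⟨hfr, -, h2⟩ -
    exact hQ s' hfr h2

end Rules

/-! ### Reading the input -/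

lemma table_apply {m : ℕ} (g : Fin m → ℕ) (q : Fin m) : table g q = g q := by
  simp [table]

section Input

variable {k n v r t : ℕ} {E : Set (Set (Fin n))} {F : Hypergraph (Fin v)} {x : Fin r → Fin v}
  {W : Finset (Fin n)} {y : Fin t → Fin r → Fin n}

lemma input_root (l : Fin r) : input k (ofEdges E) F x W y 2 l = x l :=
  table_apply (fun j : Fin r => (x j : ℕ)) l

lemma input_target (i : Fin t) (l : Fin r) :
    input k (ofEdges E) F x W y 3 (r * i + l) = y i l := by
  have : r * (i : ℕ) + l = (finProdFinEquiv (i, l) : Fin (t * r)) := by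
    simp [finProdFinEquiv, add_comm]
  rw [this]
  refine (table_apply (fun q : Fin (t * r) =>
    (y (finProdFinEquiv.symm q).1 (finProdFinEquiv.symm q).2 : ℕ)) _).trans ?_
  simp

open Classical in
lemma adjTable_apply {m : ℕ} (H : Hypergraph (Fin m)) (a : Fin k → Fin m) :
    adjTable k H (∑ l, (a l : ℕ) * m ^ (l : ℕ)) = if range a ∈ H.edgeSet then 1 else 0 := by
  have : ∑ l, (a l : ℕ) * m ^ (l : ℕ) = (finFunctionFinEquiv a : Fin (m ^ k)) :=
    (finFunctionFinEquiv_apply a).symm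
  rw [this, adjTable, table_apply, Equiv.symm_apply_apply]

/-- The tuple with number `c`. -/
def decode (m l : ℕ) (c : Fin (m ^ l)) : Fin l → Fin m := finFunctionFinEquiv.symm c

lemma decode_val {m l : ℕ} (c : Fin (m ^ l)) (u : Fin l) :
    (decode m l c u : ℕ) = c / m ^ (u : ℕ) % m := finFunctionFinEquiv_symm_apply_val c u

lemma decode_surjective (m l : ℕ) : Function.Surjective (decode m l) :=
  finFunctionFinEquiv.symm.surjective

lemma sum_decode {m l : ℕ} (c : Fin (m ^ l)) :
    ∑ u, (decode m l c u : ℕ) * m ^ (u : ℕ) = c := by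
  rw [← finFunctionFinEquiv_apply (decode m l c), decode, Equiv.apply_symm_apply]

end Input

/-! ### Testing a candidate -/

/-- Multiplication by a constant. -/
def Expr.times (e : Expr) : ℕ → Expr
  | 0 => .lit 0
  | r + 1 => .add (e.times r) e

@[simp] lemma Expr.eval_times (e : Expr) (r : ℕ) (s : Store) :
    (e.times r).eval s = r * e.eval s := by
  induction r with
  | zero => simp [Expr.times, Expr.eval]
  | succ r ih => simp [Expr.times, Expr.eval, ih, add_mul]

/-- The distance of two values. -/
def Expr.dist (e e' : Expr) : Expr := .add (.sub e e') (.sub e' e)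

lemma Expr.eval_dist_eq_zero {e e' : Expr} {s : Store} :
    (e.dist e').eval s = 0 ↔ e.eval s = e'.eval s := by
  simp only [Expr.dist, Expr.eval]; omega

/-- Charging the value of `e` to the variable `24`, which counts violated conditions. -/
def charge (e : Expr) : Prog := setVar 24 (.add (var 24) e)

/-- The memories agree on the arrays below `m`, except possibly on the array `24`. -/
def Keep (m : ℕ) (s s' : Store) : Prop := ∀ b < m, b ≠ 24 → s' b = s b

lemma Keep.refl (m : ℕ) (s : Store) : Keep m s s := fun _ _ _ => rfl

lemma Keep.trans {m : ℕ} {s s' s'' : Store} (h : Keep m s s') (h' : Keep m s' s'') :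
    Keep m s s'' := fun b hb h0 => (h' b hb h0).trans (h b hb h0)

lemma Keep.mono {m m' : ℕ} {s s' : Store} (h : Keep m s s') (hm : m' ≤ m) : Keep m' s s' :=
  fun b hb => h b (hb.trans_le hm)

lemma Keep.write {m : ℕ} {s s' : Store} (h : Keep m s s') {a : ℕ} (ha : m ≤ a ∨ a = 24) (q c : ℕ) :
    Keep m s (write s' a q c) := fun b hb h0 => by
  rw [write_of_ne _ _ _ (by omega), h b hb h0]

lemma Frame.keep {m : ℕ} {s s' : Store} (h : Frame m s s') : Keep m s s' := fun b hb _ => h b hb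

section Check

variable {Z : ℕ} {s : Store} {Q : Store → Prop}

lemma Comp.charge {e : Expr} (hQ : ∀ s', (∀ m, Keep m s s') →
    (s' 24 0 = 0 ↔ s 24 0 = 0 ∧ e.eval s = 0) → Q s') : Comp Z (charge e) s Q := by
  refine Comp.assign (hQ _ (fun m => (Keep.refl m s).write (Or.inr rfl) _ _) ?_)
  simp [write_apply, Expr.eval]

/-- The violation counter is never reset within a loop, so its vanishing expresses the conjunction
of all tests so far, and nested checks compose. -/
lemma Comp.checkLoop (hZ : 1 ≤ Z) {i : ℕ} (hi : 24 < i) {e : Expr} {P : Prog} {N : ℕ} (hN : N ≤ Z)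
    (p : ℕ → Prop) (he : ∀ s', Keep i s s' → e.eval s' = N)
    (hP : ∀ q < N, ∀ s', Keep i s s' → s' i 0 = q → Comp Z P s' fun s'' =>
      Keep (i + 1) s' s'' ∧ (s'' 24 0 = 0 ↔ s' 24 0 = 0 ∧ p q))
    (hQ : ∀ s', Keep i s s' → (s' 24 0 = 0 ↔ s 24 0 = 0 ∧ ∀ q < N, p q) → Q s') :
    Comp Z (ConnectingLemma.forLoop i e P) s Q := by
  refine Comp.forLoop hZ hN (fun q s' => Keep i s s' ∧
    (s' 24 0 = 0 ↔ s 24 0 = 0 ∧ ∀ q' < q, p q')) ?_ ?_ ?_ ?_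
  · refine ⟨(Keep.refl i s).write (Or.inl le_rfl) _ _, ?_⟩
    rw [write_of_ne _ _ _ hi.ne]; simp
  · rintro q - s' ⟨hk, -⟩ -
    exact he s' hk
  · rintro q hq s' ⟨hk, hz⟩ hiq
    refine (hP q hq s' hk hiq).mono ?_
    rintro s'' ⟨hk', hz'⟩
    refine ⟨?_, (hk.trans (hk'.mono (Nat.le_succ i))).write (Or.inl le_rfl) _ _, ?_⟩
    · rw [hk' i (Nat.lt_succ_self i) hi.ne', hiq]
    · rw [write_of_ne _ _ _ hi.ne, hz', hz]
      constructor
      · rintro ⟨⟨h0, h1⟩, h2⟩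
        refine ⟨h0, fun q' hq' => ?_⟩
        rcases Nat.lt_succ_iff_lt_or_eq.1 hq' with h | rfl
        · exact h1 q' h
        · exact h2
      · rintro ⟨h0, h1⟩
        exact ⟨⟨h0, fun q' hq' => h1 q' (by omega)⟩, h1 q (by omega)⟩
  · rintro s' ⟨hk, hz⟩ -
    exact hQ s' hk hz

end Check

/-- The number of vertices of `G`. -/
abbrev exprN : Expr := .get 0 (.lit 0)

/-- The number of vertices of `F`. -/
abbrev exprV : Expr := .get 0 (.lit 1)

/-- The number of tuples. -/
abbrev exprT : Expr := .get 0 (.lit 2)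

/-- Writes the candidate into the array `16`. The array `20` receives the required labels. -/
def prepareProg (r : ℕ) : Prog :=
  .seq (digitsProg 16 (var 15) exprN exprV)
  (.seq (forLoop 21 exprV (.assign 20 (var 21) (.add (var 12) (.lit 1))))
  (forLoop 21 (.lit r) (.assign 20 (.get 2 (var 21)) (.lit 0))))

/-- Counts the edges of `F` that are not mapped to edges of `G`. -/
def edgesProg (k : ℕ) : Prog :=
  forLoop 26 (var 11) (.seq (digitsProg 27 (var 26) exprV (.lit k))
    (.seq (indexProg 31 (.get 16 (.get 27 (var 33))) exprN (.lit k))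
      (charge (.sub (.get 4 (var 26)) (.get 5 (var 31))))))

/-- Counts the violations of the conditions on the candidate. -/
def testProg (k r : ℕ) : Prog :=
  .seq (setVar 24 (.get 8 (var 14)))
  (.seq (forLoop 25 (.lit r) (charge (.dist (.get 16 (.get 2 (var 25)))
    (.get 3 (.add ((var 14).times r) (var 25))))))
  (.seq (forLoop 25 exprV (charge (.dist (.get 7 (.get 16 (var 25))) (.get 20 (var 25)))))
  (.seq (forLoop 25 exprV (forLoop 26 (var 25)
    (charge (.sub (.lit 1) (.dist (.get 16 (var 25)) (.get 16 (var 26)))))))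
  (edgesProg k))))

/-- Adopts the candidate. -/
def commitProg : Prog :=
  .seq (.assign 8 (var 14) (.lit 1)) (forLoop 21 exprV
    (.seq (.assign 6 (.add (var 13) (var 21)) (.get 16 (var 21)))
      (.assign 7 (.get 16 (var 21)) (.lit 0))))

/-! ### The memory invariant, and the test for edges -/

section Rep

variable {k n v r t : ℕ} {E : Set (Set (Fin n))} {F : Hypergraph (Fin v)} {x : Fin r → Fin v}
  {W : Finset (Fin n)} {y : Fin t → Fin r → Fin n} {L : ℕ}

open Classical in
/-- The memory `s` represents the choice `g`. -/
structure Rep (k : ℕ) (E : Set (Set (Fin n))) (F : Hypergraph (Fin v)) (x : Fin r → Fin v)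
    (W : Finset (Fin n)) (y : Fin t → Fin r → Fin n) (L : ℕ) (g : Choice n v t) (s : Store) :
    Prop where
  inp : ∀ b < 6, s b = input k (ofEdges E) F x W y b
  out : ∀ i f, g i = some f → ∀ u : Fin v, s 6 (i * v + u) = f u
  label : ∀ a : Fin n, s 7 a = if a ∈ free W g then rank W a % L + 1 else 0
  done : ∀ i : Fin t, s 8 i = if g i = none then 0 else 1
  pieces : s 9 0 = L
  candidates : s 10 0 = n ^ v
  tuples : s 11 0 = v ^ k

lemma Rep.congr {g : Choice n v t} {s s' : Store} (h : Rep k E F x W y L g s)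
    (hs : ∀ b < 12, s' b = s b) : Rep k E F x W y L g s' := by
  refine ⟨fun b hb => (hs b (by omega)).trans (h.inp b hb), ?_, ?_, ?_, ?_, ?_, ?_⟩
  · rw [hs 6 (by norm_num)]; exact h.out
  · rw [hs 7 (by norm_num)]; exact h.label
  · rw [hs 8 (by norm_num)]; exact h.done
  · rw [hs 9 (by norm_num)]; exact h.pieces
  · rw [hs 10 (by norm_num)]; exact h.candidates
  · rw [hs 11 (by norm_num)]; exact h.tuples

variable {g : Choice n v t} {s : Store} {Z : ℕ} {Q : Store → Prop}

lemma Rep.n_eq (h : Rep k E F x W y L g s) : s 0 0 = n := by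
  rw [h.inp 0 (by norm_num)]; rfl

lemma Rep.v_eq (h : Rep k E F x W y L g s) : s 0 1 = v := by
  rw [h.inp 0 (by norm_num)]; rfl

lemma Rep.t_eq (h : Rep k E F x W y L g s) : s 0 2 = t := by
  rw [h.inp 0 (by norm_num)]; rfl

lemma Rep.prepare (hZ : 1 ≤ Z) (hn : 0 < n)
    (hvZ : v ≤ Z) (hrZ : r ≤ Z) (hnZ : n ^ v ≤ Z) (h : Rep k E F x W y L g s) {j : ℕ}
    (hj : s 12 0 = j) (c : Fin (n ^ v)) (hc : s 15 0 = c)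
    (hQ : ∀ s', Frame 16 s s' → (∀ u : Fin v, s' 16 u = decode n v c u) →
      (∀ u : Fin v, u ∈ range x → s' 20 u = 0) → (∀ u : Fin v, u ∉ range x → s' 20 u = j + 1) →
      Q s') : Comp Z (prepareProg r) s Q := by
  have hN : ∀ s', Frame 16 s s' → s' 0 0 = n := fun s' hf => by
    rw [hf 0 (by norm_num), h.n_eq]
  have hV : ∀ s', Frame 16 s s' → s' 0 1 = v := fun s' hf => by
    rw [hf 0 (by norm_num), h.v_eq]
  refine Comp.seq hZ (Comp.digitsProg hZ (c.2.le.trans hnZ) hvZ hn hc hN hV fun s₁ f₁ d₁ => ?_)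
  have d₁' : ∀ u : Fin v, s₁ 16 u = decode n v c u := fun u => by
    rw [d₁ u u.2, decode_val]
  refine Comp.seq hZ (Comp.forLoop hZ hvZ (fun q s' => Frame 20 s₁ s' ∧ ∀ u < q, s' 20 u = j + 1)
    ?_ ?_ ?_ ?_)
  · exact ⟨(Frame.refl 20 s₁).write (by norm_num) _ _, by simp⟩
  · rintro q - s' ⟨hf, -⟩ -
    exact hV s' (f₁.trans (hf.mono (by norm_num)))
  · rintro q - s' ⟨hf, hu⟩ hi
    refine Comp.assign ⟨?_, (hf.write le_rfl _ _).write (by norm_num) _ _, fun u hu' => ?_⟩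
    · simp [write_apply, hi]
    · have : s' 12 0 = j := by rw [hf 12 (by norm_num), f₁ 12 (by norm_num), hj]
      simp only [write_apply, Expr.eval, hi, this]
      rw [if_neg (by norm_num), if_pos trivial]
      split_ifs with h1
      · rfl
      · exact hu u (by omega)
  · rintro s₂ ⟨f₂, u₂⟩ -
    refine Comp.forLoop hZ hrZ (fun q s' => Frame 20 s₁ s' ∧ (∀ l : Fin r, l < q → s' 20 (x l) = 0) ∧
      ∀ u : Fin v, u ∉ range x → s' 20 u = j + 1) ?_ ?_ ?_ ?_
    · refine ⟨f₂.write (by norm_num) _ _, by simp, fun u _ => ?_⟩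
      rw [write_of_ne _ _ _ (by norm_num)]
      exact u₂ u u.2
    · rintro q - s' - -
      rfl
    · rintro q hq s' ⟨hf, h1, h2⟩ hi
      have hx2 : s' 2 q = x ⟨q, hq⟩ := by
        rw [hf 2 (by norm_num), f₁ 2 (by norm_num), h.inp 2 (by norm_num)]
        exact input_root ⟨q, hq⟩
      refine Comp.assign ⟨?_, (hf.write le_rfl _ _).write (by norm_num) _ _, fun l hl => ?_,
        fun u hu => ?_⟩
      · simp [write_apply, hi]
      · simp only [write_apply, Expr.eval, hi, hx2]
        rw [if_neg (by norm_num), if_pos trivial]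
        split_ifs with h3
        · rfl
        · refine h1 l ?_
          have : (l : ℕ) ≠ q := fun hlq => h3 (by
            have : l = ⟨q, hq⟩ := Fin.ext hlq
            rw [this])
          omega
      · simp only [write_apply, Expr.eval, hi, hx2]
        rw [if_neg (by norm_num), if_pos trivial, if_neg, h2 u hu]
        intro h3
        exact hu ⟨⟨q, hq⟩, (Fin.ext h3).symm⟩
    · rintro s' ⟨hf, h1, h2⟩ -
      refine hQ s' (f₁.trans (hf.mono (by norm_num))) (fun u => ?_) ?_ h2
      · rw [hf 16 (by norm_num), d₁']
      · rintro _ ⟨l, rfl⟩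
        exact h1 l l.2

/-- The program runs through `k`-tuples of vertices; by uniformity every edge is the range of one of
them. -/
lemma forall_edge_iff {f : Fin v → Fin n} (hF : IsUniform k F) :
    (∀ a : Fin k → Fin v, range a ∈ F.edgeSet → range (f ∘ a) ∈ E) ↔
      ∀ e ∈ F.edgeSet, f '' e ∈ E := by
  constructor
  · intro h e he
    have hc : Nat.card e = k := hF e he
    have eq : e ≃ Fin k := (Finite.equivFin e).trans (finCongr hc)
    have hr : range (fun l => (eq.symm l : Fin v)) = e := by
      have := eq.symm.surjective.range_comp (Subtype.val : e → Fin v)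
      rw [Subtype.range_coe] at this
      exact this
    have := h (fun l => (eq.symm l : Fin v)) (by rw [hr]; exact he)
    rwa [range_comp, hr] at this
  · intro h a ha
    rw [range_comp]
    exact h _ ha

/-- The number of a tuple is also its position in the adjacency array of `F`. The truncated
difference of the two indicators is nonzero exactly for an edge of `F` that is not mapped to an edge
of `G`. -/
lemma Rep.edges (hZ : 1 ≤ Z) (hF : IsUniform k F) (hv : 0 < v) (hvZ : v ^ k ≤ Z) (hkZ : k ≤ Z)
    (hnZ : n ≤ Z) (h : Rep k E F x W y L g s) {f : Fin v → Fin n} {s₁ : Store}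
    (hs₁ : Frame 16 s s₁) (hf : ∀ u : Fin v, s₁ 16 u = f u)
    (hQ : ∀ s', Frame 24 s₁ s' →
      (s' 24 0 = 0 ↔ s₁ 24 0 = 0 ∧ ∀ e ∈ F.edgeSet, f '' e ∈ E) → Q s') :
    Comp Z (edgesProg k) s₁ Q := by
  classical
  have hinp : ∀ b < 6, s₁ b = input k (ofEdges E) F x W y b := fun b hb => by
    rw [hs₁ b (by omega), h.inp b hb]
  have hn : s₁ 0 0 = n := by rw [hs₁ 0 (by norm_num), h.n_eq]
  have hv' : s₁ 0 1 = v := by rw [hs₁ 0 (by norm_num), h.v_eq]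
  refine Comp.checkLoop hZ (i := 26) (by norm_num) hvZ (fun q => ∀ hq : q < v ^ k,
    range (decode v k ⟨q, hq⟩) ∈ F.edgeSet → range (f ∘ decode v k ⟨q, hq⟩) ∈ E) ?_ ?_ ?_
  · intro s' hk
    simp only [Expr.eval]
    rw [hk 11 (by norm_num) (by norm_num), hs₁ 11 (by norm_num), h.tuples]
  · intro q hq s' hk hi
    set a := decode v k ⟨q, hq⟩ with ha
    refine Comp.seq hZ (Comp.digitsProg hZ (N := q) (B := v) (L := k) (by omega) hkZ hv hi
      (fun s'' hf' => ?_) (fun _ _ => rfl) fun s₂ f₂ d₂ => ?_)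
    · simp only [Expr.eval]
      rw [hf' 0 (by norm_num), hk 0 (by norm_num) (by norm_num), hv']
    have h16 : s₂ 16 = s₁ 16 := by
      rw [f₂ 16 (by norm_num), hk 16 (by norm_num) (by norm_num)]
    refine Comp.seq hZ (Comp.indexProg hZ (B := n) (L := k)
      (f := fun l => if hl : l < k then (f (a ⟨l, hl⟩) : ℕ) else 0) (fun l hl => ?_) hkZ hnZ
      (fun s'' l hl hf' hi' => ?_) (fun s'' hf' => ?_) (fun _ _ => rfl) fun s₃ f₃ i₃ => ?_)
    · simp only [dif_pos hl]
      exact (f _).2.le.trans hnZ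
    · simp only [Expr.eval, dif_pos hl, hi']
      rw [hf' 27 (by norm_num), hf' 16 (by norm_num), h16, d₂ l hl, ← hf, ha, decode_val]
    · simp only [Expr.eval]
      rw [hf' 0 (by norm_num), f₂ 0 (by norm_num), hk 0 (by norm_num) (by norm_num), hn]
    have hF4 : s₃ 4 (s₃ 26 0) = if range a ∈ F.edgeSet then 1 else 0 := by
      rw [f₃ 26 (by norm_num), f₂ 26 (by norm_num), hi, f₃ 4 (by norm_num), f₂ 4 (by norm_num),
        hk 4 (by norm_num) (by norm_num), hinp 4 (by norm_num), ← adjTable_apply F a]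
      change adjTable k F q = _
      rw [ha, sum_decode]
    have hG5 : s₃ 5 (s₃ 31 0) = if range (f ∘ a) ∈ E then 1 else 0 := by
      have e1 : s₃ 31 0 = ∑ l, (((f ∘ a) l : Fin n) : ℕ) * n ^ (l : ℕ) := by
        rw [i₃, Finset.sum_range]
        refine Finset.sum_congr rfl fun l _ => ?_
        simp
      rw [e1, f₃ 5 (by norm_num), f₂ 5 (by norm_num), hk 5 (by norm_num) (by norm_num),
        hinp 5 (by norm_num)]
      exact adjTable_apply (ofEdges E) (f ∘ a)
    refine Comp.charge fun s₄ k₄ z₄ => ⟨?_, ?_⟩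
    · exact (f₂.keep.trans (f₃.mono (by norm_num)).keep).trans (k₄ _)
    · rw [z₄, f₃ 24 (by norm_num), f₂ 24 (by norm_num)]
      simp only [Expr.eval]
      rw [hF4, hG5]
      refine and_congr_right fun _ => ?_
      simp only [hq, forall_true_left]
      by_cases h1 : range a ∈ F.edgeSet <;> by_cases h2 : range (f ∘ a) ∈ E <;> simp [h1, h2, ← ha]
  · intro s' hk hz
    refine hQ s' (fun b hb => hk b (by omega) (by omega)) ?_
    rw [hz, ← forall_edge_iff (k := k) hF]
    refine and_congr_right fun _ => ⟨fun hh a => ?_, fun hh q hq hq' => hh _⟩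
    obtain ⟨c, rfl⟩ := decode_surjective v k a
    exact hh c c.2 c.2

end Rep

/-! ### Correctness of the greedy program -/

section Rep

variable {k n v r t : ℕ} {E : Set (Set (Fin n))} {F : Hypergraph (Fin v)} {x : Fin r → Fin v}
  {W : Finset (Fin n)} {y : Fin t → Fin r → Fin n} {L : ℕ}
  {g : Choice n v t} {s : Store} {Z : ℕ} {Q : Store → Prop}

lemma mem_free_piece {j : ℕ} {a : Fin n} :
    a ∈ free (piece W L j) g ↔ a ∈ free W g ∧ rank W a % L = j := by
  simp only [free, piece, Set.mem_ofPred_eq, Finset.mem_filter]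
  tauto

/-- One comparison of labels checks that an internal vertex is in `W`, unused and in piece `j`.
Roots are required to have label `0`, which holds automatically for targets outside `W`. -/
lemma Rep.test (hZ : 1 ≤ Z) (hF : IsUniform k F) (hv : 0 < v)
    (hy : IsRootFamily W y) (hvZ : v ≤ Z) (hvkZ : v ^ k ≤ Z) (hkZ : k ≤ Z) (hrZ : r ≤ Z)
    (hnZ : n ≤ Z) (h : Rep k E F x W y L g s) {i : Fin t} (hi : s 14 0 = i) {j : ℕ}
    {f : Fin v → Fin n} {s₁ : Store}
    (hs₁ : Frame 16 s s₁) (hf : ∀ u : Fin v, s₁ 16 u = f u)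
    (h20 : ∀ u : Fin v, u ∈ range x → s₁ 20 u = 0)
    (h20' : ∀ u : Fin v, u ∉ range x → s₁ 20 u = j + 1)
    (hQ : ∀ s', Frame 24 s₁ s' → (s' 24 0 = 0 ↔
      g i = none ∧ IsRootedEmb F x E (y i) (free (piece W L j) g) f) → Q s') :
    Comp Z (testProg k r) s₁ Q := by
  classical
  have hinp : ∀ b < 6, s₁ b = input k (ofEdges E) F x W y b := fun b hb => by
    rw [hs₁ b (by omega), h.inp b hb]
  have hv' : s₁ 0 1 = v := by rw [hs₁ 0 (by norm_num), h.v_eq]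
  have hi₁ : s₁ 14 0 = i := by rw [hs₁ 14 (by norm_num), hi]
  refine Comp.seq hZ (Comp.assign ?_)
  set s₂ := write s₁ 24 ((Expr.lit 0).eval s₁) ((Expr.get 8 (var 14)).eval s₁) with hs₂
  have k₂ : Keep 25 s₁ s₂ := (Keep.refl 25 s₁).write (Or.inr rfl) _ _
  have z₂ : s₂ 24 0 = 0 ↔ g i = none := by
    have : s₂ 24 0 = s₁ 8 i := by simp [hs₂, write_apply, Expr.eval, hi₁]
    rw [this, hs₁ 8 (by norm_num), h.done]
    simp
  refine Comp.seq hZ (Comp.checkLoop hZ (by norm_num) hrZ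
    (fun q => ∀ hq : q < r, f (x ⟨q, hq⟩) = y i ⟨q, hq⟩) (fun _ _ => rfl) ?_ ?_)
  · intro q hq s' hk hiq
    refine Comp.charge fun s'' k'' z'' => ⟨k'' _, z''.trans (and_congr_right fun _ => ?_)⟩
    have hk' := k₂.trans hk
    have e1 : s' 2 q = x ⟨q, hq⟩ := by
      rw [hk' 2 (by norm_num) (by norm_num), hinp 2 (by norm_num)]
      exact input_root ⟨q, hq⟩
    have e2 : s' 3 (r * i + q) = y i ⟨q, hq⟩ := by
      rw [hk' 3 (by norm_num) (by norm_num), hinp 3 (by norm_num)]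
      exact input_target i ⟨q, hq⟩
    have e3 : s' 14 0 = i := by rw [hk' 14 (by norm_num) (by norm_num), hi₁]
    rw [Expr.eval_dist_eq_zero]
    simp only [Expr.eval, Expr.eval_times, hiq, e1, e3, e2]
    rw [hk' 16 (by norm_num) (by norm_num), hf]
    simp [Fin.ext_iff, hq]
  intro s₃ k₃ z₃
  have k₃' := k₂.trans k₃
  refine Comp.seq hZ (Comp.checkLoop hZ (by norm_num) hvZ
    (fun q => ∀ hq : q < v, s₁ 7 (f ⟨q, hq⟩) = s₁ 20 q) (fun s' hk => ?_) ?_ ?_)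
  · simp only [Expr.eval]
    rw [hk 0 (by norm_num) (by norm_num), k₃' 0 (by norm_num) (by norm_num), hv']
  · intro q hq s' hk hiq
    refine Comp.charge fun s'' k'' z'' => ⟨k'' _, z''.trans (and_congr_right fun _ => ?_)⟩
    have hk' := k₃'.trans hk
    rw [Expr.eval_dist_eq_zero]
    simp only [Expr.eval, hiq]
    rw [hk' 16 (by norm_num) (by norm_num), hk' 7 (by norm_num) (by norm_num),
      hk' 20 (by norm_num) (by norm_num), hf ⟨q, hq⟩]
    simp [hq]
  intro s₄ k₄ z₄
  have k₄' := k₃'.trans k₄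
  refine Comp.seq hZ (Comp.checkLoop hZ (by norm_num) hvZ
    (fun q => ∀ q' < q, s₁ 16 q ≠ s₁ 16 q') (fun s' hk => ?_) ?_ ?_)
  · simp only [Expr.eval]
    rw [hk 0 (by norm_num) (by norm_num), k₄' 0 (by norm_num) (by norm_num), hv']
  · intro q hq s' hk hiq
    have hk' := k₄'.trans hk
    refine Comp.checkLoop hZ (i := 26) (by norm_num) (hq.le.trans hvZ)
      (fun q' => s₁ 16 q ≠ s₁ 16 q') (fun s'' hk'' => ?_) ?_ fun s'' k'' z'' => ⟨k'', z''⟩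
    · simp only [Expr.eval]
      rw [hk'' 25 (by norm_num) (by norm_num), hiq]
    · intro q' hq' s'' hk'' hiq'
      refine Comp.charge fun s₆ k₆ z₆ => ⟨k₆ _, z₆.trans (and_congr_right fun _ => ?_)⟩
      simp only [Expr.eval, Expr.dist, hiq']
      rw [hk'' 25 (by norm_num) (by norm_num), hiq, hk'' 16 (by norm_num) (by norm_num),
        hk' 16 (by norm_num) (by norm_num)]
      omega
  intro s₅ k₅ z₅
  have k₅' := k₄'.trans k₅
  have f₅ : Frame 16 s s₅ := fun b hb => by
    rw [k₅' b (by omega) (by omega), hs₁ b hb]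
  refine h.edges hZ hF hv hvkZ hkZ hnZ f₅ (f := f) (fun u => ?_) fun s₆ f₆ z₆ => ?_
  · rw [k₅' 16 (by norm_num) (by norm_num), hf]
  refine hQ s₆ (fun b hb => ?_) ?_
  · rw [f₆ b hb, k₅' b (by omega) (by omega)]
  rw [z₆, z₅, z₄, z₃, z₂]
  have hlab : ∀ u : Fin v, s₁ 7 (f u) =
      if f u ∈ free W g then rank W (f u) % L + 1 else 0 := fun u => by
    rw [hs₁ 7 (by norm_num), h.label]
  constructor
  · rintro ⟨⟨⟨⟨h1, h2⟩, h3⟩, h4⟩, h5⟩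
    refine ⟨h1, fun a b hab => ?_, fun l => h2 l l.2 l.2, fun u hu => ?_, h5⟩
    · by_contra hne
      rcases lt_or_gt_of_ne hne with hlt | hlt
      · exact h4 b b.2 a hlt (by rw [hf, hf, hab])
      · exact h4 a a.2 b hlt (by rw [hf, hf, hab])
    · have := h3 u u.2 u.2
      rw [h20' u hu] at this
      have := (hlab u).symm.trans this
      rw [mem_free_piece]
      split_ifs at this with h6
      exact ⟨h6, by omega⟩
  · rintro ⟨h1, h2, h3, h4, h5⟩
    refine ⟨⟨⟨⟨h1, fun q hq _ => h3 _⟩, fun q hq _ => ?_⟩, fun q hq q' hq' => ?_⟩, h5⟩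
    · refine (hlab ⟨q, hq⟩).trans ?_
      by_cases hx : (⟨q, hq⟩ : Fin v) ∈ range x
      · rw [h20 ⟨q, hq⟩ hx, if_neg]
        obtain ⟨l, hl⟩ := hx
        rw [← hl, h3]
        exact fun hm => hy.2.1 i l hm.1
      · rw [h20' ⟨q, hq⟩ hx]
        have := mem_free_piece.1 (h4 _ hx)
        rw [if_pos this.1, this.2]
    · rw [hf ⟨q, hq⟩, hf ⟨q', hq'.trans hq⟩]
      intro h6
      have := h2 (Fin.ext h6)
      simp only [Fin.mk.injEq] at this
      omega

lemma mem_free_update {B : Finset (Fin n)} {i : Fin t} (hi : g i = none) {f : Fin v → Fin n}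
    {a : Fin n} : a ∈ free B (Function.update g i (some f)) ↔ a ∈ free B g ∧ a ∉ range f := by
  constructor
  · rintro ⟨h1, h2⟩
    refine ⟨⟨h1, fun i' f' h' => h2 i' f' ?_⟩, h2 i f (by simp)⟩
    rw [Function.update_of_ne, h']
    rintro rfl
    rw [hi] at h'; exact absurd h' (by simp)
  · rintro ⟨⟨h1, h2⟩, h3⟩
    refine ⟨h1, fun i' f' h' => ?_⟩
    by_cases h0 : i' = i
    · subst h0
      rw [Function.update_self, Option.some_inj] at h'
      exact h' ▸ h3
    · rw [Function.update_of_ne h0] at h'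
      exact h2 i' f' h'

lemma Rep.commit (hZ : 1 ≤ Z) (hvZ : v ≤ Z) (h : Rep k E F x W y L g s) {i : Fin t}
    (hi : s 14 0 = i) (hi13 : s 13 0 = i * v) (hgi : g i = none) {f : Fin v → Fin n}
    (hf : ∀ u : Fin v, s 16 u = f u)
    (hQ : ∀ s', (∀ b, 9 ≤ b → b < 16 → s' b = s b) →
      Rep k E F x W y L (Function.update g i (some f)) s' → Q s') :
    Comp Z commitProg s Q := by
  classical
  refine Comp.seq hZ (Comp.assign ?_)
  refine Comp.forLoop hZ hvZ (fun q s' => (∀ b < 21, b ≠ 6 → b ≠ 7 → b ≠ 8 → s' b = s b) ∧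
    (∀ p, s' 8 p = if p = i then 1 else s 8 p) ∧
    (∀ u : Fin v, u < q → s' 6 (i * v + u) = f u) ∧
    (∀ p, (∀ u < v, p ≠ i * v + u) → s' 6 p = s 6 p) ∧
    (∀ a : Fin n, s' 7 a = if ∃ u : Fin v, u < q ∧ f u = a then 0 else s 7 a)) ?_ ?_ ?_ ?_
  · refine ⟨fun b hb _ _ h8 => ?_, fun p => ?_, by simp, fun p _ => ?_, fun a => ?_⟩
    · rw [write_of_ne _ _ _ (by omega), write_of_ne _ _ _ (by omega)]
    · simp [write_apply, Expr.eval, hi]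
    · simp [write_apply]
    · simp [write_apply]
  · rintro q - s' ⟨hk, -⟩ -
    simp only [Expr.eval]
    rw [hk 0 (by norm_num) (by norm_num) (by norm_num) (by norm_num), h.v_eq]
  · rintro q hq s' ⟨hk, h8, h6, h6', h7⟩ hiq
    have e16 : s' 16 q = f ⟨q, hq⟩ := by
      rw [hk 16 (by norm_num) (by norm_num) (by norm_num) (by norm_num)]
      exact hf ⟨q, hq⟩
    have e13 : s' 13 0 = i * v := by
      rw [hk 13 (by norm_num) (by norm_num) (by norm_num) (by norm_num), hi13]
    refine Comp.seq hZ (Comp.assign (Comp.assign ⟨?_, fun b hb b6 b7 b8 => ?_, fun p => ?_,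
      fun u hu => ?_, fun p hp => ?_, fun a => ?_⟩))
    · simp [write_apply, hiq]
    · rw [write_of_ne _ _ _ (by omega), write_of_ne _ _ _ b7, write_of_ne _ _ _ b6,
        hk b hb b6 b7 b8]
    · simp [write_apply, h8]
    · simp only [write_apply, Expr.eval, hiq, e16, e13]
      norm_num
      split_ifs with h0
      · have : u = ⟨q, hq⟩ := Fin.ext h0
        rw [this]
      · exact h6 u (by omega)
    · have := hp q hq
      simp [write_apply, Expr.eval, hiq, e13, this, h6' p hp]
    · simp only [write_apply, Expr.eval, hiq, e16]
      norm_num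
      rw [e16]
      by_cases ha : a = f ⟨q, hq⟩
      · rw [if_pos (by rw [ha]), if_pos ⟨⟨q, hq⟩, by simp, ha.symm⟩]
      · rw [if_neg (fun h0 => ha (Fin.ext h0)), h7]
        refine if_congr ⟨?_, ?_⟩ rfl rfl
        · rintro ⟨u, hu, hua⟩; exact ⟨u, by omega, hua⟩
        · rintro ⟨u, hu, hua⟩
          refine ⟨u, ?_, hua⟩
          have : (u : ℕ) ≠ q := by
            rintro rfl
            exact ha hua.symm
          omega
  · rintro s' ⟨hk, h8, h6, h6', h7⟩ -
    have hk9 : ∀ b, 9 ≤ b → b < 16 → s' b = s b := fun b h1 h2 =>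
      hk b (by omega) (by omega) (by omega) (by omega)
    refine hQ s' hk9 ⟨fun b hb => ?_, fun i' f' hif u => ?_, fun a => ?_, fun i' => ?_, ?_, ?_, ?_⟩
    · rw [hk b (by omega) (by omega) (by omega) (by omega), h.inp b hb]
    · by_cases h0 : i' = i
      · subst h0
        rw [Function.update_self, Option.some_inj] at hif
        rw [← hif, h6 u u.2]
      · rw [Function.update_of_ne h0] at hif
        rw [h6', h.out i' f' hif u]
        -- Blocks of length `v` for different roots do not overlap, so earlier output is not
        -- overwritten.
        intro w hw heq
        have hne : (i' : ℕ) ≠ i := fun h1 => h0 (Fin.ext h1)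
        have hu := u.2
        rcases lt_or_gt_of_ne hne with hlt | hlt
        · have := Nat.mul_le_mul_right v hlt
          rw [Nat.succ_mul] at this; omega
        · have := Nat.mul_le_mul_right v hlt
          rw [Nat.succ_mul] at this; omega
    · rw [h7, h.label]
      by_cases ha : a ∈ range f
      · obtain ⟨u, hu⟩ := ha
        rw [if_pos ⟨u, u.2, hu⟩, if_neg]
        rw [mem_free_update hgi]
        exact fun h0 => h0.2 ⟨u, hu⟩
      · rw [if_neg (fun ⟨u, _, hu⟩ => ha ⟨u, hu⟩)]
        refine if_congr ?_ rfl rfl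
        rw [mem_free_update hgi]
        exact ⟨fun h0 => ⟨h0, ha⟩, fun h0 => h0.1⟩
    · rw [h8]
      by_cases h0 : i' = i
      · subst h0; simp
      · rw [if_neg (fun h1 => h0 (Fin.ext h1)), h.done, Function.update_of_ne h0]
    · rw [hk9 9 (by norm_num) (by norm_num), h.pieces]
    · rw [hk9 10 (by norm_num) (by norm_num), h.candidates]
    · rw [hk9 11 (by norm_num) (by norm_num), h.tuples]

/-- Tests the candidate whose number is in the variable `15`, and adopts it if it is valid. -/
def candidateProg (k r : ℕ) : Prog :=
  .seq (prepareProg r) (.seq (testProg k r) (.ite (var 24) .skip commitProg))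

/-- The greedy algorithm: for each piece and each root, all candidates are tested. -/
def greedyProg (k r : ℕ) : Prog :=
  forLoop 12 (var 9) (.seq (setVar 13 (.lit 0)) (forLoop 14 exprT
    (.seq (forLoop 15 (var 10) (candidateProg k r)) (setVar 13 (.add (var 13) exprV)))))

/-- All loops of the program run at most `Z` times. -/
structure Bounds (Z k n v r t L : ℕ) : Prop where
  one : 1 ≤ Z
  hn : n ≤ Z
  hv : v ≤ Z
  hk : k ≤ Z
  hr : r ≤ Z
  ht : t ≤ Z
  hL : L ≤ Z
  hnv : n ^ v ≤ Z
  hvk : v ^ k ≤ Z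

lemma Rep.candidate (hB : Bounds Z k n v r t L) (hn : 0 < n) (hF : IsUniform k F) (hv : 0 < v)
    (hy : IsRootFamily W y) (h : Rep k E F x W y L g s) {i : Fin t}
    {j : ℕ} (hj : s 12 0 = j) (hi13 : s 13 0 = i * v) (hi : s 14 0 = i) (c : Fin (n ^ v))
    (hc : s 15 0 = c)
    (hQ : ∀ s', (∀ b, 9 ≤ b → b < 16 → s' b = s b) →
      ((g i = none ∧ IsRootedEmb F x E (y i) (free (piece W L j) g) (decode n v c) ∧
        Rep k E F x W y L (Function.update g i (some (decode n v c))) s') ∨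
      (¬ (g i = none ∧ IsRootedEmb F x E (y i) (free (piece W L j) g) (decode n v c)) ∧
        Rep k E F x W y L g s')) → Q s') :
    Comp Z (candidateProg k r) s Q := by
  have hZ := hB.one
  refine Comp.seq hZ (h.prepare hZ hn hB.hv hB.hr hB.hnv hj c hc fun s₁ f₁ d₁ x₁ x₁' => ?_)
  refine Comp.seq hZ (h.test hZ hF hv hy hB.hv hB.hvk hB.hk hB.hr hB.hn hi f₁ d₁ x₁ x₁'
    fun s₂ f₂ z₂ => ?_)
  have hs₂ : Frame 16 s s₂ := f₁.trans (f₂.mono (by norm_num))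
  have h₂ : Rep k E F x W y L g s₂ := h.congr fun b hb => hs₂ b (by omega)
  refine Comp.ite hZ (fun h0 => Comp.skip ?_) fun h0 => ?_
  · exact hQ s₂ (fun b _ hb => hs₂ b hb) (Or.inr ⟨fun h1 => h0 (z₂.2 h1), h₂⟩)
  · obtain ⟨hgi, hemb⟩ := z₂.1 h0
    refine h₂.commit hZ hB.hv (by rw [hs₂ 14 (by norm_num), hi])
      (by rw [hs₂ 13 (by norm_num), hi13]) hgi (f := decode n v c)
      (fun u => by rw [f₂ 16 (by norm_num), d₁]) fun s₃ k₃ h₃ => ?_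
    exact hQ s₃ (fun b h1 h2 => by rw [k₃ b h1 h2, hs₂ b h2]) (Or.inl ⟨hgi, hemb, h₃⟩)

/-- The loop has no early exit: after an adoption the flag in array `8` rejects all further
candidates. Every map is the decoding of some number, so a full pass without success shows that no
embedding exists. -/
lemma Rep.candidates_loop (hB : Bounds Z k n v r t L) (hn : 0 < n) (hF : IsUniform k F) (hv : 0 < v)
    (hy : IsRootFamily W y) (h : Rep k E F x W y L g s) {i : Fin t}
    {j : ℕ} (hj : s 12 0 = j) (hi13 : s 13 0 = i * v) (hi : s 14 0 = i)
    (hQ : ∀ s' g', (∀ b, 9 ≤ b → b < 15 → s' b = s b) → Rep k E F x W y L g' s' →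
      GreedyStep F x E y (piece W L j) i g g' → Q s') :
    Comp Z (forLoop 15 (var 10) (candidateProg k r)) s Q := by
  refine Comp.forLoop hB.one hB.hnv (fun q s' => (∀ b, 9 ≤ b → b < 15 → s' b = s b) ∧
    ∃ g', Rep k E F x W y L g' s' ∧ ((g' = g ∧ (g i ≠ none ∨ ∀ c : Fin (n ^ v), c < q →
      ¬ IsRootedEmb F x E (y i) (free (piece W L j) g) (decode n v c))) ∨
    (g i = none ∧ ∃ f, IsRootedEmb F x E (y i) (free (piece W L j) g) f ∧
      g' = Function.update g i (some f)))) ?_ ?_ ?_ ?_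
  · refine ⟨fun b _ hb => write_of_ne _ _ _ hb.ne, g, h.congr fun b hb => ?_, Or.inl ⟨rfl, ?_⟩⟩
    · exact write_of_ne _ _ _ (by omega)
    · exact Or.inr (by simp)
  · rintro q - s' ⟨-, g', h', -⟩ -
    exact h'.candidates
  · rintro q hq s' ⟨hk, g', h', hstep⟩ hiq
    refine h'.candidate hB hn hF hv hy (i := i) (j := j) ?_ ?_ ?_ ⟨q, hq⟩ hiq
      fun s'' k'' hor => ⟨?_, fun b h1 h2 => ?_, ?_⟩
    · rw [hk 12 (by norm_num) (by norm_num), hj]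
    · rw [hk 13 (by norm_num) (by norm_num), hi13]
    · rw [hk 14 (by norm_num) (by norm_num), hi]
    · rw [k'' 15 (by norm_num) (by norm_num), hiq]
    · rw [write_of_ne _ _ _ h2.ne, k'' b h1 (by omega), hk b h1 h2]
    · have hrep : ∀ g'', Rep k E F x W y L g'' s'' →
          Rep k E F x W y L g'' (write s'' 15 0 (q + 1)) := fun g'' h0 =>
        h0.congr fun b hb => write_of_ne _ _ _ (by omega)
      rcases hor with ⟨h1, h2, h3⟩ | ⟨h1, h2⟩
      · rcases hstep with ⟨rfl, -⟩ | ⟨-, f, -, rfl⟩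
        · exact ⟨_, hrep _ h3, Or.inr ⟨h1, _, h2, rfl⟩⟩
        · rw [Function.update_self] at h1
          exact absurd h1 (by simp)
      · refine ⟨g', hrep _ h2, ?_⟩
        rcases hstep with ⟨rfl, h3⟩ | h3
        · refine Or.inl ⟨rfl, ?_⟩
          by_cases hgi : g' i = none
          · refine Or.inr fun c hc => ?_
            rcases Nat.lt_succ_iff_lt_or_eq.1 hc with hlt | heq
            · exact (h3.resolve_left (fun h0 => h0 hgi)) c hlt
            · have : c = ⟨q, hq⟩ := Fin.ext heq
              rw [this]
              exact fun h0 => h1 ⟨hgi, h0⟩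
          · exact Or.inl hgi
        · exact Or.inr h3
  · rintro s' ⟨hk, g', h', hstep⟩ -
    refine hQ s' g' hk h' ?_
    rcases hstep with ⟨h1, h2⟩ | h1
    · refine Or.inl ⟨h1, h2.imp_right fun h3 f => ?_⟩
      obtain ⟨c, rfl⟩ := decode_surjective n v f
      exact h3 c c.2
    · exact Or.inr h1

lemma Rep.greedy (hB : Bounds Z k n v r t L) (hn : 0 < n) (hF : IsUniform k F) (hv : 0 < v)
    (hy : IsRootFamily W y) (h : Rep k E F x W y L (fun _ => none) s)
    (hQ : ∀ s' g, Rep k E F x W y L g s' → Reach F x E y W L L 0 g → Q s') :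
    Comp Z (greedyProg k r) s Q := by
  have hZ := hB.one
  refine Comp.forLoop hZ hB.hL (fun q s' => ∃ g, Rep k E F x W y L g s' ∧
    Reach F x E y W L q 0 g) ?_ ?_ ?_ ?_
  · exact ⟨_, h.congr fun b hb => write_of_ne _ _ _ (by omega), .zero⟩
  · rintro q - s' ⟨g, h', -⟩ -
    exact h'.pieces
  · rintro j hj s' ⟨g, h', hr⟩ hij
    refine Comp.seq hZ (Comp.assign (Comp.forLoop hZ hB.ht (fun q s'' => ∃ g,
      Rep k E F x W y L g s'' ∧ Reach F x E y W L j q g ∧ s'' 12 0 = j ∧ s'' 13 0 = q * v)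
      ?_ ?_ ?_ ?_))
    · refine ⟨g, (h'.congr fun b hb => write_of_ne _ _ _ (by omega)).congr fun b hb =>
        write_of_ne _ _ _ (by omega), hr, ?_, ?_⟩
      · simp [write_apply, hij]
      · simp [write_apply, Expr.eval]
    · rintro q - s'' ⟨g, h'', -⟩ -
      exact h''.t_eq
    · rintro q hq s'' ⟨g, h'', hr', h12, h13⟩ hiq
      refine Comp.seq hZ (h''.candidates_loop hB hn hF hv hy (i := ⟨q, hq⟩) h12 h13 hiq
        fun s₃ g' k₃ h₃ hs₃ => Comp.assign ⟨?_, g', ?_, .step hr' hs₃, ?_, ?_⟩)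
      · simp [write_apply, k₃ 14 (by norm_num) (by norm_num), hiq]
      · exact (h₃.congr fun b hb => write_of_ne _ _ _ (by omega)).congr fun b hb =>
          write_of_ne _ _ _ (by omega)
      · simp [write_apply, k₃ 12 (by norm_num) (by norm_num), h12]
      · simp [write_apply, Expr.eval, k₃ 13 (by norm_num) (by norm_num), h13, h₃.v_eq, add_mul]
    · rintro s'' ⟨g, h'', hr', h12, -⟩ -
      exact ⟨h12, g, h''.congr fun b hb => write_of_ne _ _ _ (by omega), .next hr'⟩
  · rintro s' ⟨g, h', hr⟩ -
    exact hQ s' g h' hr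

end Rep

/-! ### The whole program -/

/-- Computes the number of pieces into the variable `9`. -/
def piecesProg : Prog :=
  .seq (setVar 9 (.lit 8)) (.seq (setVar 16 (.lit 1))
    (.loop (.sub (.add exprN (.lit 1)) (var 16))
      (.seq (setVar 16 (.add (var 16) (var 16))) (setVar 9 (.add (var 9) (.lit 4))))))

/-- Labels the elements of `W` by the numbers of their pieces, increased by one. -/
def labelProg : Prog :=
  .seq (setVar 17 (.lit 0)) (forLoop 18 exprN (.ite (.get 1 (var 18))
    (.seq (.assign 7 (var 18) (.add (var 17) (.lit 1)))
      (.seq (setVar 17 (.add (var 17) (.lit 1)))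
        (.ite (.sub (var 9) (var 17)) .skip (setVar 17 (.lit 0))))) .skip))

/-- The greedy algorithm with its initialization. -/
def mainProg (k r : ℕ) : Prog :=
  .seq piecesProg (.seq labelProg (.seq (powProg 16 exprN exprV) (.seq (setVar 10 (var 16))
    (.seq (powProg 16 exprV (.lit k)) (.seq (setVar 11 (var 16)) (greedyProg k r))))))

section Main

variable {k n v r t : ℕ} {E : Set (Set (Fin n))} {F : Hypergraph (Fin v)} {x : Fin r → Fin v}
  {W : Finset (Fin n)} {y : Fin t → Fin r → Fin n} {L : ℕ} {s : Store} {Z : ℕ} {Q : Store → Prop}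

/-- Doubling from `1` first exceeds `n` after `Nat.size n` steps. -/
lemma Comp.piecesProg (hZ : 1 ≤ Z) (hnZ : n ≤ Z) (hn : s 0 0 = n)
    (hQ : ∀ s', Frame 9 s s' → s' 9 0 = 4 * Nat.size n + 8 → Q s') : Comp Z piecesProg s Q := by
  refine Comp.seq hZ (Comp.assign (Comp.seq hZ (Comp.assign ?_)))
  have hsn : Nat.size n ≤ n := Nat.size_le.2 Nat.lt_two_pow_self
  refine Comp.loop hZ (hsn.trans hnZ) (fun q s' => Frame 9 s s' ∧ s' 9 0 = 4 * q + 8 ∧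
    s' 16 0 = 2 ^ q) ?_ ?_ ?_ ?_
  · refine ⟨((Frame.refl 9 s).write le_rfl _ _).write (by norm_num) _ _, ?_⟩
    simp [write_apply, Expr.eval]
  · rintro q hq s' ⟨hf, h9, h16⟩
    refine ⟨?_, Comp.seq hZ (Comp.assign (Comp.assign
      ⟨(hf.write (by norm_num) _ _).write le_rfl _ _, ?_, ?_⟩))⟩
    · simp only [Expr.eval, h16]
      rw [hf 0 (by norm_num), hn]
      have := Nat.lt_size.1 hq
      omega
    · simp [write_apply, Expr.eval, h9]; ring
    · simp [write_apply, Expr.eval, h16]; ring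
  · rintro s' ⟨hf, -, h16⟩
    simp only [Expr.eval, h16]
    rw [hf 0 (by norm_num), hn]
    have := Nat.lt_size_self n
    omega
  · rintro s' ⟨hf, h9, -⟩
    exact hQ s' hf h9

lemma card_filter_lt_succ (W : Finset (Fin n)) {q : ℕ} (hq : q < n) :
    (W.filter fun b : Fin n => (b : ℕ) < q + 1).card =
      (W.filter fun b : Fin n => (b : ℕ) < q).card + if (⟨q, hq⟩ : Fin n) ∈ W then 1 else 0 := by
  have hnot : (⟨q, hq⟩ : Fin n) ∉ W.filter fun b : Fin n => (b : ℕ) < q := by simp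
  split_ifs with h
  · rw [← Finset.card_insert_of_notMem hnot]
    congr 1
    ext b
    simp only [Finset.mem_filter, Finset.mem_insert, Fin.ext_iff]
    constructor
    · rintro ⟨h1, h2⟩
      rcases Nat.lt_succ_iff_lt_or_eq.1 h2 with h3 | h3
      · exact Or.inr ⟨h1, h3⟩
      · exact Or.inl h3
    · rintro (h1 | ⟨h1, h2⟩)
      · have : b = ⟨q, hq⟩ := Fin.ext h1
        exact ⟨this ▸ h, by omega⟩
      · exact ⟨h1, by omega⟩
  · rw [add_zero]
    congr 1
    refine Finset.filter_congr fun b hb => ?_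
    have : (b : ℕ) ≠ q := fun h1 => h (by
      have : b = ⟨q, hq⟩ := Fin.ext h1
      exact this ▸ hb)
    omega

lemma Comp.labelProg (hZ : 1 ≤ Z) (hnZ : n ≤ Z) (hL : 0 < L) (hn : s 0 0 = n) (h9 : s 9 0 = L)
    (h1 : ∀ a : Fin n, s 1 a = if a ∈ W then 1 else 0) (h7 : ∀ p, s 7 p = 0)
    (hQ : ∀ s', (∀ b < 16, b ≠ 7 → s' b = s b) →
      (∀ a : Fin n, s' 7 a = if a ∈ W then rank W a % L + 1 else 0) → Q s') :
    Comp Z labelProg s Q := by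
  refine Comp.seq hZ (Comp.assign ?_)
  refine Comp.forLoop hZ hnZ (fun q s' => (∀ b < 16, b ≠ 7 → s' b = s b) ∧
    s' 17 0 = (W.filter fun b : Fin n => (b : ℕ) < q).card % L ∧
    ∀ a : Fin n, s' 7 a = if (a : ℕ) < q ∧ a ∈ W then rank W a % L + 1 else 0) ?_ ?_ ?_ ?_
  · refine ⟨fun b hb _ => ?_, ?_, fun a => ?_⟩
    · rw [write_of_ne _ _ _ (by omega), write_of_ne _ _ _ (by omega)]
    · simp [write_apply, Expr.eval]
    · simp [write_apply, h7]
  · rintro q - s' ⟨hk, -⟩ -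
    simp only [Expr.eval]
    rw [hk 0 (by norm_num) (by norm_num), hn]
  · rintro q hq s' ⟨hk, h17, hl⟩ hiq
    have hs1 : (Expr.get 1 (var 18)).eval s' = if (⟨q, hq⟩ : Fin n) ∈ W then 1 else 0 := by
      simp only [Expr.eval, hiq]
      rw [hk 1 (by norm_num) (by norm_num)]
      exact h1 ⟨q, hq⟩
    have hcard := card_filter_lt_succ W hq
    refine Comp.ite hZ (fun h0 => ?_) fun h0 => ?_
    · have hqW : (⟨q, hq⟩ : Fin n) ∈ W := by
        by_contra hcon; rw [hs1, if_neg hcon] at h0; exact h0 rfl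
      rw [if_pos hqW] at hcard
      have hlab : ∀ a : Fin n, (if (a : ℕ) = q then
          (W.filter fun b : Fin n => (b : ℕ) < q).card % L + 1 else s' 7 a) =
          if (a : ℕ) < q + 1 ∧ a ∈ W then rank W a % L + 1 else 0 := fun a => by
        by_cases haq : (a : ℕ) = q
        · obtain rfl : a = ⟨q, hq⟩ := Fin.ext haq
          rw [if_pos haq, if_pos ⟨by omega, hqW⟩, rank]
          rfl
        · rw [if_neg haq, hl]
          exact if_congr (and_congr_left fun _ => by omega) rfl rfl
      have h9' : s' 9 0 = L := by rw [hk 9 (by norm_num) (by norm_num), h9]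
      set X := (W.filter fun b : Fin n => (b : ℕ) < q).card with hX
      have hmod := Nat.mod_lt X hL
      -- The rank modulo `L` is maintained by a counter that is reset to `0` on reaching `L`.
      have hmod' : (X + 1) % L = (X % L + 1) % L := (Nat.mod_add_mod X L 1).symm
      refine Comp.seq hZ (Comp.assign (Comp.seq hZ (Comp.assign (Comp.ite hZ
        (fun hlt => Comp.skip ⟨?_, fun b hb hb7 => ?_, ?_, fun a => ?_⟩)
        fun hge => Comp.assign ⟨?_, fun b hb hb7 => ?_, ?_, fun a => ?_⟩))))
      · simp [write_apply, hiq]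
      · rw [write_of_ne _ _ _ (by omega), write_of_ne _ _ _ (by omega), write_of_ne _ _ _ hb7,
          hk b hb hb7]
      · simp [write_apply, Expr.eval, h17, h9'] at hlt
        rw [hcard, hmod', Nat.mod_eq_of_lt (by omega)]
        simp [write_apply, Expr.eval, h17]
      · rw [← hlab]
        simp [write_apply, Expr.eval, h17, hiq]
      · simp [write_apply, hiq]
      · rw [write_of_ne _ _ _ (by omega), write_of_ne _ _ _ (by omega),
          write_of_ne _ _ _ (by omega), write_of_ne _ _ _ hb7, hk b hb hb7]
      · simp [write_apply, Expr.eval, h17, h9'] at hge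
        have : X % L + 1 = L := by omega
        rw [hcard, hmod', this, Nat.mod_self]
        simp [write_apply, Expr.eval]
      · rw [← hlab]
        simp [write_apply, Expr.eval, h17, hiq]
    · have hqW : (⟨q, hq⟩ : Fin n) ∉ W := by
        intro hcon; rw [hs1, if_pos hcon] at h0; exact one_ne_zero h0
      rw [if_neg hqW, add_zero] at hcard
      refine Comp.skip ⟨hiq, fun b hb hb7 => ?_, ?_, fun a => ?_⟩
      · rw [write_of_ne _ _ _ (by omega), hk b hb hb7]
      · rw [hcard, write_of_ne _ _ _ (by norm_num), h17]
      · rw [write_of_ne _ _ _ (by norm_num), hl]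
        refine if_congr (and_congr_left fun haW => ?_) rfl rfl
        have : (a : ℕ) ≠ q := fun h1 => hqW (by
          have : a = ⟨q, hq⟩ := Fin.ext h1
          exact this ▸ haW)
        omega
  · rintro s' ⟨hk, -, hl⟩ -
    refine hQ s' hk fun a => ?_
    rw [hl]
    exact if_congr ⟨fun h => h.2, fun h => ⟨a.2, h⟩⟩ rfl rfl

lemma Comp.mainProg (hB : Bounds Z k n v r t (4 * Nat.size n + 8)) (hn : 0 < n)
    (hF : IsUniform k F) (hv : 0 < v) (hy : IsRootFamily W y)
    (hQ : ∀ s' g, Rep k E F x W y (4 * Nat.size n + 8) g s' →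
      Reach F x E y W (4 * Nat.size n + 8) (4 * Nat.size n + 8) 0 g → Q s') :
    Comp Z (mainProg k r) (input k (ofEdges E) F x W y) Q := by
  have hZ := hB.one
  set s₀ := input k (ofEdges E) F x W y with hs₀
  have hn₀ : s₀ 0 0 = n := rfl
  have hv₀ : s₀ 0 1 = v := rfl
  refine Comp.seq hZ (Comp.piecesProg hZ hB.hn hn₀ fun s₁ f₁ h₁ => ?_)
  refine Comp.seq hZ (Comp.labelProg (W := W) hZ hB.hn (by omega)
    ((congrFun (f₁ 0 (by norm_num)) 0).trans hn₀) h₁ (fun a => ?_) (fun p => ?_)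
    fun s₂ k₂ l₂ => ?_)
  · rw [f₁ 1 (by norm_num)]
    refine (table_apply (fun a : Fin n => if a ∈ W then 1 else 0) a).trans ?_
    split_ifs <;> rfl
  · rw [f₁ 7 (by norm_num)]; rfl
  have hn₂ : s₂ 0 0 = n := by rw [k₂ 0 (by norm_num) (by norm_num), f₁ 0 (by norm_num), hn₀]
  have hv₂ : s₂ 0 1 = v := by rw [k₂ 0 (by norm_num) (by norm_num), f₁ 0 (by norm_num), hv₀]
  refine Comp.seq hZ (Comp.powProg hZ hB.hn hB.hv (fun s' hf => ?_) (fun s' hf => ?_)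
    fun s₃ f₃ h₃ => ?_)
  · simp only [Expr.eval]; rw [hf 0 (by norm_num), hn₂]
  · simp only [Expr.eval]; rw [hf 0 (by norm_num), hv₂]
  refine Comp.seq hZ (Comp.assign (Comp.seq hZ (Comp.powProg hZ hB.hv hB.hk (fun s' hf => ?_)
    (fun s' hf => rfl) fun s₄ f₄ h₄ => ?_)))
  · simp only [Expr.eval]; rw [hf 0 (by norm_num), write_of_ne _ _ _ (by norm_num), f₃ 0 (by norm_num), hv₂]
  refine Comp.seq hZ (Comp.assign ?_)
  have hlow : ∀ b < 10, b ≠ 7 → write s₄ 11 0 (s₄ 16 0) b = s₁ b := fun b hb hb7 => by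
    rw [write_of_ne _ _ _ (by omega), f₄ b (by omega), write_of_ne _ _ _ (by omega),
      f₃ b (by omega), k₂ b (by omega) hb7]
  refine Rep.greedy hB hn hF hv hy (W := W) ⟨fun b hb => ?_, by simp, fun a => ?_, fun i => ?_, ?_, ?_, ?_⟩ hQ
  · exact (hlow b (by omega) (by omega)).trans (f₁ b (by omega))
  · rw [write_of_ne _ _ _ (by norm_num), f₄ 7 (by norm_num), write_of_ne _ _ _ (by norm_num),
      f₃ 7 (by norm_num), l₂]
    have : a ∈ free W (fun _ => none : Choice n v t) ↔ a ∈ W := by simp [free]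
    simp only [this]
  · refine (congrFun (hlow 8 (by norm_num) (by norm_num)) i).trans ?_
    rw [f₁ 8 (by norm_num), if_pos rfl]
    rfl
  · exact (congrFun (hlow 9 (by norm_num) (by norm_num)) 0).trans h₁
  · rw [write_of_ne _ _ _ (by norm_num), f₄ 10 (by norm_num)]
    simp [write_apply, Expr.eval, h₃]
  · simp [write_apply, Expr.eval, h₄]

/-- All loop counts are at most `n ^ (v + k)`, and `v + k ≤ (k + 1) * v`, so a program of fixed size
and depth has a running time whose exponent is linear in `v`. -/
theorem run_mainProg {A : ℕ} (hA : (mainProg k r).size + (k + 1) * (mainProg k r).depth ≤ A)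
    (hn : 6 ≤ n) (hv : r + 2 ≤ v) (hvn : v ≤ n) (htn : t ≤ n)
    (hF : IsUniform k F) (hy : IsRootFamily W y)
    (hQ : ∀ s' g, Rep k E F x W y (4 * Nat.size n + 8) g s' →
      Reach F x E y W (4 * Nat.size n + 8) (4 * Nat.size n + 8) 0 g → Q s') :
    ∃ m s', Runs (mainProg k r) (input k (ofEdges E) F x W y) m s' ∧ m ≤ n ^ (A * v) ∧ Q s' := by
  have hpow : ∀ {d : ℕ}, d ≤ v + k → n ^ d ≤ n ^ (v + k) := fun hd =>
    Nat.pow_le_pow_right (by omega) hd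
  have hnZ : n ≤ n ^ (v + k) := by simpa using hpow (d := 1) (by omega)
  have hsn : Nat.size n ≤ n := Nat.size_le.2 Nat.lt_two_pow_self
  have hB : Bounds (n ^ (v + k)) k n v r t (4 * Nat.size n + 8) := by
    refine ⟨Nat.one_le_pow _ _ (by omega), hnZ, hvn.trans hnZ, ?_, by omega, htn.trans hnZ, ?_,
      hpow (by omega), ?_⟩
    · have : k < n ^ k := Nat.lt_pow_self (by omega)
      exact this.le.trans (hpow (by omega))
    · have : n ^ 2 ≤ n ^ (v + k) := hpow (by omega)
      nlinarith
    · exact (Nat.pow_le_pow_left hvn k).trans (hpow (by omega))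
  obtain ⟨m, s', h1, h2, h3⟩ := Comp.mainProg (E := E) (x := x) hB (by omega) hF (by omega) hy hQ
  refine ⟨m, s', h1, h2.trans ?_, h3⟩
  set S := (mainProg k r).size
  set D := (mainProg k r).depth
  have e1 : S ≤ n ^ (S * v) := (Nat.lt_pow_self (by omega : 1 < n)).le.trans
    (Nat.pow_le_pow_right (by omega) (Nat.le_mul_of_pos_right S (by omega)))
  calc S * (n ^ (v + k)) ^ D ≤ n ^ (S * v) * (n ^ (v + k)) ^ D := Nat.mul_le_mul_right _ e1
    _ = n ^ (S * v + (v + k) * D) := by rw [← pow_mul, ← pow_add]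
    _ ≤ n ^ (A * v) := by
      refine Nat.pow_le_pow_right (by omega) ?_
      have h4 : (v + k) * D ≤ (k + 1) * D * v := by
        have : v + k ≤ (k + 1) * v := by nlinarith
        calc (v + k) * D ≤ (k + 1) * v * D := Nat.mul_le_mul_right _ this
          _ = _ := by ring
      calc S * v + (v + k) * D ≤ S * v + (k + 1) * D * v := by omega
        _ = (S + (k + 1) * D) * v := by ring
        _ ≤ A * v := Nat.mul_le_mul_right _ hA

end Main

/-! ### The parameters -/

section Parameters

lemma density_pos {v r : ℕ} {F : Hypergraph (Fin v)} {x : Fin r → Fin v}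
    (hV : F.vertexSet = univ) (hrv : r + 2 ≤ v) (hx : Function.Injective x)
    (hne : F.edgeSet.Nonempty) : 0 < density F (range x) := by
  have h := le_density F F (range x) ⟨Set.Subset.rfl, Set.Subset.rfl⟩ hne (Or.inl (by simp [hV]))
  refine lt_of_lt_of_le (div_pos ?_ ?_) h
  · exact_mod_cast (Set.ncard_pos).2 hne
  · have hr : (range x).ncard = r := by
      rw [← Set.image_univ, Set.ncard_image_of_injective _ hx, Set.ncard_univ]; simp
    rw [hV, Set.univ_inter, hr, Set.ncard_univ, Nat.card_eq_fintype_card, Fintype.card_fin,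
      sub_pos, max_lt_iff]
    exact ⟨by exact_mod_cast (by omega : 1 < v), by exact_mod_cast (by omega : r < v)⟩

lemma size_le_logb {n : ℕ} (hn : 2 ≤ n) : ((4 * Nat.size n + 8 : ℕ) : ℝ) ≤ 16 * Real.logb 2 n := by
  have hn0 : (0 : ℝ) < n := by exact_mod_cast (by omega : 0 < n)
  have h1 : 1 ≤ Real.logb 2 n := by
    rw [Real.le_logb_iff_rpow_le (by norm_num) hn0, Real.rpow_one]
    exact_mod_cast hn
  obtain ⟨m, hm⟩ : ∃ m, Nat.size n = m + 1 :=
    Nat.exists_eq_succ_of_ne_zero (Nat.size_pos.2 (by omega)).ne'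
  have h2 : (m : ℝ) ≤ Real.logb 2 n := by
    rw [Real.le_logb_iff_rpow_le (by norm_num) hn0, Real.rpow_natCast]
    exact_mod_cast Nat.lt_size.1 (by omega : m < Nat.size n)
  rw [hm]; push_cast; linarith

lemma log_le_logb (n : ℕ) : Real.log n ≤ Real.logb 2 n := by
  have h0 : 0 ≤ Real.log n := Real.log_natCast_nonneg n
  rw [Real.logb, le_div_iff₀ (Real.log_pos (by norm_num))]
  have : Real.log 2 ≤ 1 := by linarith [Real.log_two_lt_d9]
  nlinarith

/-- The inequalities that the sizes of the pieces satisfy. -/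
lemma piece_bounds {n v w : ℕ} {K C : ℝ} (hK : 0 < K) (hC : C = 576 * (K + 5)) (hn : 2 ≤ n)
    (hv : 1 ≤ v) (hW : C * (v : ℝ) ^ 4 * Real.logb 2 n ^ 2 ≤ w) {ρ : ℝ}
    (hρ : ρ = w / (C * (v : ℝ) ^ 4 * Real.logb 2 n ^ 2)) :
    1 ≤ ρ ∧ 2 * w ≤ 3 * (4 * Nat.size n + 8) * (w / (4 * Nat.size n + 8)) ∧
      8 * ρ * v ^ 2 ≤ (w / (4 * Nat.size n + 8) : ℕ) ∧
      (2 * v + K + 3) * Real.log n ≤ (w / (4 * Nat.size n + 8) : ℕ) / (24 * v ^ 3 * ρ) := by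
  set ℓ := Real.logb 2 n with hℓ
  set L := 4 * Nat.size n + 8 with hLdef
  have hn0 : (0 : ℝ) < n := by exact_mod_cast (by omega : 0 < n)
  have h1 : 1 ≤ ℓ := by
    rw [hℓ, Real.le_logb_iff_rpow_le (by norm_num) hn0, Real.rpow_one]
    exact_mod_cast hn
  have hv1 : (1 : ℝ) ≤ v := by exact_mod_cast hv
  have hL : (L : ℝ) ≤ 16 * ℓ := size_le_logb hn
  have hL0 : (0 : ℝ) < L := by exact_mod_cast (by omega : 0 < L)
  have hC0 : 2880 ≤ C := by rw [hC]; linarith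
  set lam := C * (v : ℝ) ^ 4 * ℓ ^ 2 with hlam
  have hlam0 : 0 < lam := by positivity
  have hw0 : (0 : ℝ) < w := by linarith
  have hρ1 : 1 ≤ ρ := by rw [hρ, le_div_iff₀ hlam0]; linarith
  have hv2 : (1 : ℝ) ≤ v ^ 2 := one_le_pow₀ hv1
  have hv4 : (v : ℝ) ^ 2 ≤ v ^ 4 := pow_le_pow_right₀ hv1 (by norm_num)
  have hℓ2 : ℓ ≤ ℓ ^ 2 := by nlinarith
  have hbig : 2880 * (v : ℝ) ^ 2 * ℓ ≤ lam := by
    rw [hlam]; gcongr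
  -- Rounding down in `w / L` then loses at most a third.
  have h3L : 3 * (L : ℝ) ≤ w := by
    have : ℓ ≤ (v : ℝ) ^ 2 * ℓ := le_mul_of_one_le_left (by linarith) hv2
    nlinarith
  have h3L' : 3 * L ≤ w := by exact_mod_cast h3L
  have hdiv : 2 * w ≤ 3 * L * (w / L) := by
    have := Nat.lt_div_mul_add (a := w) (by omega : 0 < L)
    nlinarith
  have hdiv' : (2 * w : ℝ) ≤ 3 * L * (w / L : ℕ) := by exact_mod_cast hdiv
  set q : ℝ := ((w / L : ℕ) : ℝ) with hq
  have hρl : ρ * lam = w := by rw [hρ]; field_simp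
  refine ⟨hρ1, hdiv, ?_, ?_⟩
  · have e1 : 12 * (L : ℝ) * v ^ 2 ≤ lam := by nlinarith
    have e2 : ρ * (12 * L * v ^ 2) ≤ w := by
      rw [← hρl]; exact mul_le_mul_of_nonneg_left e1 (by linarith)
    have e3 : 3 * L * (8 * ρ * v ^ 2) ≤ 3 * L * q := by nlinarith
    exact le_of_mul_le_mul_left e3 (by positivity)
  · rw [le_div_iff₀ (by positivity)]
    have hlog := log_le_logb n
    have hlog0 : 0 ≤ Real.log n := Real.log_natCast_nonneg n
    have e1 : (2 * v + K + 3) * Real.log n ≤ (v * (K + 5)) * ℓ := by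
      refine mul_le_mul ?_ hlog hlog0 (by positivity)
      nlinarith
    have e2 : (2 * v + K + 3) * Real.log n * (24 * v ^ 3 * ρ) ≤
        (v * (K + 5)) * ℓ * (24 * v ^ 3 * ρ) :=
      mul_le_mul_of_nonneg_right e1 (by positivity)
    refine e2.trans ?_
    -- This fixes `C`: with `L ≤ 16 * ℓ` the left side is at most `1152 * (K + 5) * v ^ 4 * ℓ ^ 2 *
    -- ρ`, which is `2 * w` for `C = 576 * (K + 5)`.
    have e3 : 3 * (L : ℝ) * ((v * (K + 5)) * ℓ * (24 * v ^ 3 * ρ)) ≤ 3 * L * q := by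
      refine le_trans ?_ hdiv'
      rw [← hρl, hlam, hC]
      have : 3 * (L : ℝ) * ((v * (K + 5)) * ℓ * (24 * v ^ 3 * ρ)) =
          (72 * (K + 5) * v ^ 4 * ℓ * ρ) * L := by ring
      rw [this]
      have e4 : (72 * (K + 5) * v ^ 4 * ℓ * ρ) * L ≤ (72 * (K + 5) * v ^ 4 * ℓ * ρ) * (16 * ℓ) :=
        mul_le_mul_of_nonneg_left hL (by positivity)
      refine e4.trans (le_of_eq ?_)
      ring
    exact le_of_mul_le_mul_left e3 (by positivity)

/-- The `b` wasteful rounds satisfy `b * (w / L) ≤ w / 2`, while `w / L` is at least `2 * w / (3 *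
L)` after rounding. So `4 * b ≤ 3 * L`, and at least `L / 4 ≥ Nat.size n` halving rounds remain. -/
lemma rounds_suffice {n w d t : ℕ} (hn : 1 ≤ n) (hd : 1 ≤ d) (hwn : w ≤ n) (ht : 4 * (t * d) ≤ w)
    (hw : 2 * w ≤ 3 * (4 * Nat.size n + 8) * (w / (4 * Nat.size n + 8))) {b : ℕ}
    (hb : b * (w / (4 * Nat.size n + 8)) ≤ 2 * (t * d)) :
    t < 2 ^ (4 * Nat.size n + 8 - b) := by
  rcases Nat.eq_zero_or_pos w with rfl | hw0
  · have : t = 0 := by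
      by_contra h
      have : 1 * 1 ≤ t * d := Nat.mul_le_mul (by omega) hd
      omega
    rw [this]; positivity
  set L := 4 * Nat.size n + 8 with hL
  set q := w / L with hq
  have htn : t ≤ n := by
    have : t * 1 ≤ t * d := Nat.mul_le_mul_left t hd
    omega
  have hbL : 4 * b ≤ 3 * L := by
    by_contra! hcon
    have hq0 : 0 < q := by
      rcases Nat.eq_zero_or_pos q with h | h
      · rw [h] at hw; omega
      · exact h
    have h1 : (3 * L + 1) * q ≤ 4 * b * q := Nat.mul_le_mul_right q hcon
    have h2 : 4 * b * q = 4 * (b * q) := by ring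
    rw [add_mul, one_mul] at h1
    omega
  have h1 : Nat.size n ≤ L - b := by omega
  calc t ≤ n := htn
    _ < 2 ^ Nat.size n := Nat.lt_size_self n
    _ ≤ 2 ^ (L - b) := Nat.pow_le_pow_right (by norm_num) h1

end Parameters

end ConnectingLemma

open ConnectingLemma

theorem lemma3p3 (k r : ℕ) (hk : 2 ≤ k) (K : ℝ) (hK : 0 < K) :
    ∃ C : ℝ, 1 < C ∧ ∃ n₀ A : ℕ, ∃ M : Prog, ∀ n : ℕ, n₀ ≤ n →
      ∀ (v : ℕ) (F : Hypergraph (Fin v)) (x : Fin r → Fin v) (W : Finset (Fin n))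
        (p : unitInterval),
        F.vertexSet = Set.univ → IsUniform k F → r + 2 ≤ v →
        Function.Injective x → (∀ e ∈ F.edgeSet, ¬ e ⊆ Set.range x) →
        C * (v : ℝ) ^ 4 * Real.logb 2 n ^ 2 ≤ (W.card : ℝ) →
        (F.edgeSet.Nonempty →
          (C * (v : ℝ) ^ 4 * Real.logb 2 n ^ 2 / (W.card : ℝ)) ^
            (1 / density F (Set.range x)) ≤ (p : ℝ)) →
        1 - (n : ℝ) ^ (-K) ≤ (edgeLaw k n p).real
          {E | ∀ (t : ℕ) (y : Fin t → Fin r → Fin n),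
            (t : ℝ) * ((v : ℝ) - (r : ℝ)) ≤ (W.card : ℝ) / 4 →
            (∀ i, Function.Injective (y i)) → (∀ i j, y i j ∉ W) →
            (∀ i j, i ≠ j → Disjoint (Set.range (y i)) (Set.range (y j))) →
            (∃ H : Fin t → Hypergraph (Fin n),
              IsMatching (ofEdges E) F x y H ∧ InternalIn y H ↑W) ∧
            ∃ (m : ℕ) (s : Store),
              Runs M (input k (ofEdges E) F x W y) m s ∧ m ≤ n ^ (A * v) ∧
              ∃ H : Fin t → Hypergraph (Fin n),
                IsMatching (ofEdges E) F x y H ∧ InternalIn y H ↑W ∧ Describes s F x y H} := by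
  refine ⟨576 * (K + 5), by linarith, 6, (mainProg k r).size + (k + 1) * (mainProg k r).depth, mainProg k r,
    fun n hn v F x W p hV hF hrv hx hex hW hp => ?_⟩
  obtain ⟨C, hC⟩ : ∃ C, C = 576 * (K + 5) := ⟨_, rfl⟩
  rw [← hC] at hW hp
  -- Raising the hypothesis on `p` to the power of the density turns it into `1 / ρ ≤ p ^ density`.
  obtain ⟨ρ, hρ⟩ : ∃ ρ, ρ = W.card / (C * (v : ℝ) ^ 4 * Real.logb 2 n ^ 2) := ⟨_, rfl⟩
  obtain ⟨hρ1, hq, hq1, hq2⟩ := piece_bounds hK hC (by omega : 2 ≤ n) (by omega) hW hρ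
  set L := 4 * Nat.size n + 8 with hL
  have hWn : W.card ≤ n := by simpa using Finset.card_le_univ W
  have hpiece : ∀ j < L, W.card / L ≤ (piece W L j).card := fun j hj => le_card_piece W hj
  have hpiece' : ∀ j < L, ((W.card / L : ℕ) : ℝ) ≤ (piece W L j).card := fun j hj => by
    exact_mod_cast hpiece j hj
  have hv1 : (1 : ℝ) ≤ v := by exact_mod_cast (by omega : 1 ≤ v)
  have hvq : 2 * v ≤ W.card / L := by
    have : (2 * v : ℝ) ≤ (W.card / L : ℕ) := by nlinarith
    exact_mod_cast this
  have hvn : v ≤ n := by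
    have := Nat.div_le_self W.card L
    omega
  have hgood := le_prob_good (k := k) (F := F) (x := x) (W := W) (L := L) (p := p) hk hF hV hrv hx
    hex (by omega) (by
      have : Nat.size n ≤ n := Nat.size_le.2 Nat.lt_two_pow_self
      nlinarith) hρ1 hK (fun hne => by
      have hm := density_pos hV hrv hx hne
      have hpos : 0 < C * (v : ℝ) ^ 4 * Real.logb 2 n ^ 2 / W.card := by
        rw [← inv_div, ← hρ]; positivity
      have h1 := Real.rpow_pos_of_pos hpos (1 / density F (range x))
      refine ⟨h1.trans_le (hp hne), ?_⟩
      have h2 := Real.rpow_le_rpow h1.le (hp hne) hm.le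
      rw [← Real.rpow_mul hpos.le, one_div_mul_cancel hm.ne', Real.rpow_one] at h2
      rwa [hρ, one_div_div]) (fun j hj => hq1.trans (hpiece' j hj))
    (fun j hj => hq2.trans (div_le_div_of_nonneg_right (hpiece' j hj) (by positivity)))
  refine hgood.trans ?_
  have : MeasureTheory.IsProbabilityMeasure (edgeLaw k n p) := by
    unfold edgeLaw; infer_instance
  refine MeasureTheory.measureReal_mono (fun E hE t y ht hy₁ hy₂ hy₃ => ?_)
  have hy : IsRootFamily W y := ⟨hy₁, hy₂, hy₃⟩
  have ht' : 4 * (t * (v - r)) ≤ W.card := by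
    have : (4 : ℝ) * (t * ((v - r : ℕ) : ℝ)) ≤ W.card := by
      rw [Nat.cast_sub (by omega)]; linarith
    exact_mod_cast this
  have htn : t ≤ n := by
    have : t * 1 ≤ t * (v - r) := Nat.mul_le_mul_left t (by omega)
    omega
  have key : ∀ g, Reach F x E y W L L 0 g → ∃ f : Fin t → Fin v → Fin n,
      (∀ i, g i = some (f i)) ∧ (∀ i, IsRootedEmb F x E (y i) (↑W) (f i)) ∧
        ∀ i j, i ≠ j → Disjoint (range (f i)) (range (f j)) := fun g hg => by
    obtain ⟨hc, hsome⟩ := reach_complete (by omega) hE hy hx hvq hpiece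
      (fun b _ hb => rounds_suffice (by omega) (by omega : 1 ≤ v - r) hWn ht' hq hb) hg
    choose f hf using fun i => Option.ne_none_iff_exists'.1 (hsome i)
    exact ⟨f, hf, fun i => hc.1 i _ (hf i), fun i j hij => hc.2 i j _ _ hij (hf i) (hf j)⟩
  -- The matching found by the program also serves as witness for the existence claim.
  obtain ⟨m, s, hrun, hm, H, h1, h2, h3⟩ := run_mainProg (k := k) (r := r) (x := x) (E := E)
    (Q := fun s => ∃ H : Fin t → Hypergraph (Fin n),
      IsMatching (ofEdges E) F x y H ∧ InternalIn y H ↑W ∧ Describes s F x y H)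
    le_rfl hn hrv hvn htn hF hy fun s g hs hg => by
      obtain ⟨f, hgf, hf, hd⟩ := key g hg
      obtain ⟨h1, h2⟩ := isMatching_imageGraph hV hf hd
      exact ⟨_, h1, h2, fun i => ⟨f i, isIso_imageGraph hV (hf i).1, (hf i).2.1,
        fun u => hs.out i _ (hgf i) u⟩⟩
  exact ⟨⟨H, h1, h2⟩, m, s, hrun, hm, H, h1, h2, h3⟩
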